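/- For an integer $N\ge 1$ and $W\in(0,1/2)$ let $\widetilde\lambda_{0,N}(W)\ge\widetilde\lambda_{1,N}(W)\ge\cdots\ge\widetilde\lambda_{N-1,N}(W)$ be the $N$ largest eigenvalues, counted with multiplicity and arranged in decreasing order, of the integral operator $$\widetilde Q_{W,N}f(x)=\int_{-W}^{W}\frac{\sin(N\pi(x-y))}{\sin(\pi(x-y))}\,f(y)\,dy$$ on $L^2(-1/2,1/2)$ (the eigenvalues associated with the discrete prolate spheroidal wave functions). (1) For every integer $N\ge 3$, every real $W$ with $0<W<\frac{2}{e\pi}\frac{N-1}{N}$, and every integer $k$ with $2\le\frac{e\pi}{2}NW\le k\le N-1$, $$\widetilde\lambda_{k,N}(W)\le 2\exp\Big(-(2k+1)\log\Big(\frac{2(k+1)}{e\pi NW}\Big)\Big).$$ (2) Consequently, in Slepian's decay estimate $$\widetilde\lambda_{k,N}(W)\le C_1(W,\varepsilon)\,e^{-C_2(W,\varepsilon)N}\qquad\text{for all } N\ge N_1 \text{ and } \lceil 2NW(1+\varepsilon)\rceil\le k\le N-1,$$ one may take $C_1(W,\varepsilon)\le 2$ and $C_2(W,\varepsilon)\ge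 4W(1+\varepsilon)\log\Big(\frac{4(1+\varepsilon)+2}{e\pi}\Big)$: for every real $\varepsilon>\frac{e\pi-6}{4}$, every integer $N_1\ge 3$ and every real $W$ with $0<W\le\frac{2}{e\pi}\frac{N_1-1}{N_1}$, the estimate holds with this $N_1$, with $C_1=2$ and with $C_2=4W(1+\varepsilon)\log\Big(\frac{4(1+\varepsilon)+2}{e\pi}\Big)$. -/

import Mathlib

open MeasureTheory

noncomputable section

/-- The complex Hilbert space `L²(-1/2, 1/2)`. -/
abbrev L2Half : Type := Lp ℂ 2 (volume.restrict (Set.Ioo (-1 / 2 : ℝ) (1 / 2)))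

/-- The Dirichlet-type kernel `sin (N π (x - y)) / sin (π (x - y))`. On the diagonal it takes the
default value of a division by zero, which does not affect any integral over `y`. -/
def dpswfKernel (N : ℕ) (x y : ℝ) : ℝ :=
  Real.sin (N * Real.pi * (x - y)) / Real.sin (Real.pi * (x - y))

/-- The integral operator
`(Q f)(x) = ∫_{-W}^{W} sin (N π (x - y)) / sin (π (x - y)) f(y) dy`. -/
def dpswfOperator (N : ℕ) (W : ℝ) (f : ℝ → ℂ) (x : ℝ) : ℂ :=
  ∫ y in (-W)..W, (dpswfKernel N x y : ℂ) * f y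

/-- `f ∈ L²(-1/2, 1/2)` satisfies the eigenvalue equation `Q f = ν f` in `L²(-1/2, 1/2)`.
(Non-vanishing of `f` is not part of this predicate.) -/
def SatisfiesDPSWFEigenEq (N : ℕ) (W ν : ℝ) (f : L2Half) : Prop :=
  ∀ᵐ x ∂(volume.restrict (Set.Ioo (-1 / 2 : ℝ) (1 / 2))),
    dpswfOperator N W (fun y => f y) x = (ν : ℂ) * f x

/-- The eigenvalue with index `k = 0, 1, …, N - 1` of the operator `Q` on `L²(-1/2, 1/2)`, when the
eigenvalues are arranged in decreasing order and counted with multiplicity: the largest `μ` for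
which there are `k + 1` linearly independent eigenfunctions whose eigenvalues are all `≥ μ`. -/
def dpswfEigenvalue (N : ℕ) (W : ℝ) (k : ℕ) : ℝ :=
  sSup {μ : ℝ | ∃ (ν : Fin (k + 1) → ℝ) (f : Fin (k + 1) → L2Half),
    LinearIndependent ℂ f ∧ ∀ i, μ ≤ ν i ∧ SatisfiesDPSWFEigenEq N W (ν i) (f i)}

/-- Slepian's decay estimate holds with the constants `C₁`, `C₂`, `N₁`: for all `N ≥ N₁` and all
indices `⌈2 N W (1 + ε)⌉ ≤ k ≤ N - 1`, the `k`-th eigenvalue is at most `C₁ exp (-C₂ N)`. -/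
def SlepianDecay (W ε C₁ C₂ : ℝ) (N₁ : ℕ) : Prop :=
  ∀ N k : ℕ, N₁ ≤ N → ⌈2 * (N : ℝ) * W * (1 + ε)⌉ ≤ (k : ℤ) → k < N →
    dpswfEigenvalue N W k ≤ C₁ * Real.exp (-C₂ * N)

end

/-!
The operator `Q` has finite rank: its kernel is a sum of `N` exponentials at the centred frequencies
`n - (N - 1) / 2`, so its nonzero spectrum is that of the Gram operator of these exponentials on
`[-W, W]`. By min-max, `dpswfEigenvalue_le` bounds the `k`-th eigenvalue by `B` as soon as
`∫_{-W}^{W} |f|² ≤ B ‖b‖²` for all trigonometric sums `f` whose coefficient vector `b` lies in some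
subspace of codimension at most `k`. Two choices of the subspace are used.

*Vanishing at Chebyshev nodes.* If `f` vanishes at the `k` Chebyshev nodes of `[-W, W]`, the
interpolation error formula bounds `f` by its `k`-th derivative, and Cauchy-Schwarz bounds that by
`‖b‖`. With Stirling's formula this gives
`4 NW / (π k (2k+1)) * (e π N W / (2 k)) ^ (2 k)` (`dpswfEigenvalue_le_stirling`). Since
`(1 + s / k) ^ (2 k) ≤ exp (2 s)`, the `2 k` in the base may be replaced by `2 (k + s)` at the cost
of a factor `exp (2 s)`. The choice `s = 1` gives the first estimate.

*The second estimate.* It follows from the bound `2 (e π N W / (2 (k + N W))) ^ (2 k)`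
(`dpswfEigenvalue_le_inv_pow`), because `k ≥ 2 N W (1 + ε)`. For `N W ≤ 2.1` this is the Chebyshev
bound with `s = N W`. For `N W ≥ 2.1` the factor `exp (2 N W)` is too large, and the subspace is
taken to be spanned by eigenvectors of the tridiagonal operator `jacobiOp`, which commutes with the
Gram operator.

* At most `k` eigenvalues of `jacobiOp` lie below `k (k + 1)` (`card_eigenvalues_lt`): for `s = 0`
  the operator is triangular on the binomial vectors, with diagonal `j (j + 1)`, and it increases
  with `s`. The eigenvectors are orthogonal both in `ℂᴺ` and on the window.
* For an eigenvector with eigenvalue `χ ≥ κ² = k (k + 1)`, the cosine and the sine sum solve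
  `((cos θ - cos θ₀) g')' + q g = 0` with `θ₀ = 2 π W` (`spheroidalSolution_of_jacobiExpr`). Inside
  the window an energy functional bounds `∫ g²` by `θ₀ g(θ₀)²` up to a factor `c₁`
  (`SpheroidalSolution.integral_sq_le`). Outside it `g` grows at least as fast as an explicit
  subsolution of the Riccati equation, up to the turning point `θ₁`, where the lower bound for `q` that
  comes from `χ ≥ κ²` vanishes (`SpheroidalSolution.growth`, `riccati_feasible`). At `θ₁` the two sums
  are bounded by `‖b‖`, by Bessel's inequality (`phaseSum_sq_add_sq_le`).
* The resulting bound `1.21 N W / (c₁ exp …)` is at most the required one (`growth_beats_target`).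
-/

open scoped ComplexConjugate InnerProductSpace

/-! ### Elementary bounds for logarithms and square roots -/

/-- A lower bound for the exponent factor by a line, nearly tangent at `y = 2.48`. -/
lemma tangent_low {y : ℝ} (hy : 0 ≤ y) : 0.85 * y - 0.872 ≤ y ^ 2 / √(y ^ 2 + y + 16) := by
  have hs : 0 < √(y ^ 2 + y + 16) := Real.sqrt_pos.mpr (by positivity)
  have hs2 : √(y ^ 2 + y + 16) ^ 2 = y ^ 2 + y + 16 := Real.sq_sqrt (by positivity)
  rw [le_div_iff₀ hs]
  by_cases h : 0.85 * y - 0.872 ≤ 0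
  · nlinarith [mul_nonneg (neg_nonneg.mpr h) hs.le, sq_nonneg y]
  push Not at h
  apply abs_le_of_sq_le_sq' _ (by positivity) |>.2
  rw [mul_pow, hs2]
  have h1 : 0 ≤ y - 1 := by linarith
  nlinarith [mul_nonneg h1 (sq_nonneg (y - 2.48)), mul_nonneg (mul_nonneg h1 h1) (sq_nonneg (y - 2.48)), sq_nonneg (y-2.48)]

/-- A lower bound for the exponent factor by a line of slope one, its asymptotic slope. -/
lemma tangent_high {y : ℝ} (hy : 0 ≤ y) : y - 1.34 ≤ y ^ 2 / √(y ^ 2 + y + 16) := by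
  have hs : 0 < √(y ^ 2 + y + 16) := Real.sqrt_pos.mpr (by positivity)
  have hs2 : √(y ^ 2 + y + 16) ^ 2 = y ^ 2 + y + 16 := Real.sq_sqrt (by positivity)
  rw [le_div_iff₀ hs]
  by_cases h : y - 1.34 ≤ 0
  · nlinarith [mul_nonneg (neg_nonneg.mpr h) hs.le, sq_nonneg y]
  push Not at h
  apply abs_le_of_sq_le_sq' _ (by positivity) |>.2
  rw [mul_pow, hs2]
  have h1 : 0 ≤ y - 1.34 := by linarith
  nlinarith [mul_nonneg h1 (sq_nonneg (y - 3.9)), mul_nonneg (mul_nonneg h1 h1) (sq_nonneg (y - 3.9)), sq_nonneg (y-3.9)]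

lemma log_ge_cubic {t : ℝ} (h0 : 0 ≤ t) (h1 : t < 1) :
    2 * (t + t ^ 3 / 3) ≤ Real.log ((1 + t) / (1 - t)) := by
  have h := Real.hasSum_log_sub_log_of_abs_lt_one (x := t) (by rw [abs_of_nonneg h0]; exact h1)
  rw [Real.log_div (by linarith) (by linarith)]
  have := sum_le_hasSum (Finset.range 2) (fun i _ => by positivity) h
  simp [Finset.sum_range_succ] at this
  nlinarith

lemma neg_log_ge {t : ℝ} (h0 : 0 ≤ t) (h1 : t < 1) :
    t + t ^ 2 / 2 + t ^ 3 / 3 ≤ - Real.log (1 - t) := by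
  have h := Real.hasSum_pow_div_log_of_abs_lt_one (x := t) (by rw [abs_of_nonneg h0]; exact h1)
  have := sum_le_hasSum (Finset.range 3) (fun i _ => by positivity) h
  simp [Finset.sum_range_succ] at this
  norm_num at this
  linarith

lemma log_one_add_ge {t : ℝ} (h0 : 0 ≤ t) : 2 * t / (2 + t) ≤ Real.log (1 + t) := by
  have := Real.le_log_one_add_of_nonneg h0
  rwa [add_comm t 2] at this

lemma neg_log_le {t : ℝ} (h0 : 0 ≤ t) (h1 : t ≤ 0.3) :
    - Real.log (1 - t) ≤ t + 0.64 * t ^ 2 := by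
  have h := Real.abs_log_sub_add_sum_range_le (x := t) (by rw [abs_of_nonneg h0]; linarith) 5
  rw [abs_of_nonneg h0] at h
  have h2 := (abs_le.mp h).1
  norm_num [Finset.sum_range_succ] at h2
  have e3 : t ^ 3 ≤ 0.3 * t ^ 2 := by nlinarith [sq_nonneg t]
  have e4 : t ^ 4 ≤ 0.09 * t ^ 2 := by nlinarith [sq_nonneg t]
  have e5 : t ^ 5 ≤ 0.027 * t ^ 2 := by nlinarith [sq_nonneg t, pow_nonneg h0 4]
  have e6 : t ^ 6 ≤ 0.0081 * t ^ 2 := by nlinarith [sq_nonneg t, pow_nonneg h0 5]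
  have : t ^ 6 / (1 - t) ≤ t^2 * 0.0116 := by
    rw [div_le_iff₀ (by linarith)]
    nlinarith [mul_nonneg (sq_nonneg t) (sub_nonneg.mpr h1)]
  linarith [sq_nonneg t]

lemma log_one_add_le_cubic {u : ℝ} (h0 : 0 ≤ u) : Real.log (1 + u) ≤ u - u ^ 2 / 2 + u ^ 3 / 3 := by
  have key : ∀ x : ℝ, 0 ≤ x → 0 ≤ x - x ^ 2 / 2 + x ^ 3 / 3 - Real.log (1 + x) := by
    intro x hx
    have hm : MonotoneOn (fun x : ℝ => x - x ^ 2 / 2 + x ^ 3 / 3 - Real.log (1 + x)) (Set.Ici 0) := by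
      have hd : ∀ x : ℝ, 0 ≤ x → HasDerivAt (fun x : ℝ => x - x ^ 2 / 2 + x ^ 3 / 3 - Real.log (1 + x)) (1 - x + x^2 - 1/(1+x)) x := by
        intro x hx
        have h1 : HasDerivAt (fun x : ℝ => Real.log (1 + x)) (1 / (1 + x)) x :=
          ((hasDerivAt_id' x).const_add 1).log (by linarith)
        refine ((((hasDerivAt_id' x).sub ((hasDerivAt_pow 2 x).div_const 2)).add
          ((hasDerivAt_pow 3 x).div_const 3)).sub h1).congr_deriv ?_
        norm_num
      apply monotoneOn_of_deriv_nonneg (convex_Ici 0)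
      · intro x hx; exact (hd x hx).continuousAt.continuousWithinAt
      · intro x hx; simp at hx; exact (hd x hx.le).differentiableAt.differentiableWithinAt
      · intro x hx; simp at hx
        rw [(hd x hx.le).deriv, sub_nonneg, div_le_iff₀ (by linarith)]
        nlinarith [pow_pos hx 3]
    have := hm (Set.mem_Ici.mpr le_rfl) (Set.mem_Ici.mpr hx) hx
    simpa using this
  linarith [key u h0]

/-! ### Comparison of exponents near the critical bandwidth -/

lemma inv_pi_bounds : 0.3183 < 1 / Real.pi ∧ 1 / Real.pi < 0.31832 := by
  have h1 := Real.pi_gt_d4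
  have h2 := Real.pi_lt_d4
  constructor
  · rw [lt_div_iff₀ Real.pi_pos]; nlinarith
  · rw [div_lt_iff₀ Real.pi_pos]; nlinarith

lemma log_one_add_inv_pi : Real.log (1 + 1 / Real.pi) ≤ 0.2764 := by
  rw [Real.log_le_iff_le_exp (by have := Real.pi_pos; positivity)]
  have h := Real.sum_le_exp_of_nonneg (x := 0.2764) (by norm_num) 6
  norm_num [Finset.sum_range_succ, Nat.factorial] at h
  have := inv_pi_bounds.2
  norm_num at this ⊢
  linarith

/-- The logarithm of `(2 (k + a) / (e π a)) ^ (2 k)`, where `κ R = π a`, with the difference between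
`k` and `κ = √(k (k + 1))` expanded to first order. -/
lemma log_base_le {k κ R : ℝ} (hk : 0 < k) (hκ : 0 < κ) (hκ2 : κ ^ 2 = k * (k + 1)) (hR : 0 < R) :
    2 * k * Real.log (2 / Real.exp 1 * (k / (κ * R) + 1 / Real.pi)) ≤
      2 * k * (Real.log 2 - 1 + Real.log (1 + R * (1 / Real.pi)) - Real.log R)
        - k / (k + 1) / (1 + R * (1 / Real.pi)) := by
  have hp := Real.pi_pos
  have hq : 0 < 1 + R * (1 / Real.pi) := by positivity
  have hle : κ ≤ k + 1 / 2 := by nlinarith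
  have hkk : k / κ = κ / (k + 1) := by
    rw [div_eq_div_iff hκ.ne' (by positivity)]; linarith
  set u := (1 - k / κ) / (1 + R * (1 / Real.pi)) with hu
  have hu1 : 1 / (2 * (k + 1)) ≤ 1 - k / κ := by
    rw [hkk, div_le_iff₀ (by positivity)]
    field_simp
    linarith
  have e1 : 2 / Real.exp 1 * (k / (κ * R) + 1 / Real.pi)
      = 2 / Real.exp 1 * ((1 + R * (1 / Real.pi)) / R) * (1 - u) := by
    rw [hu]; field_simp; ring
  have hX : 0 < 2 / Real.exp 1 * (k / (κ * R) + 1 / Real.pi) := by positivity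
  have hA : 0 < 2 / Real.exp 1 * ((1 + R * (1 / Real.pi)) / R) := by positivity
  have hu' : 0 < 1 - u := by
    rw [e1] at hX; exact (pos_iff_pos_of_mul_pos hX).mp hA
  rw [e1, Real.log_mul hA.ne' hu'.ne', Real.log_mul (by positivity) (by positivity),
    Real.log_div (by positivity) (by positivity), Real.log_div (by positivity) (by positivity),
    Real.log_exp]
  have h1 := Real.log_le_sub_one_of_pos hu'
  have h2 : k / (k + 1) / (1 + R * (1 / Real.pi)) ≤ 2 * k * u := by
    rw [show 2 * k * u = 2 * k * (1 - k / κ) / (1 + R * (1 / Real.pi)) by rw [hu]; ring]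
    refine div_le_div_of_nonneg_right ?_ hq.le
    calc k / (k + 1) = 2 * k * (1 / (2 * (k + 1))) := by field_simp
      _ ≤ _ := by gcongr
  nlinarith

/-- The logarithm of the constant `c₁` of the energy estimate is bounded below by an affine function
of `s = 1 / (k + 1)`. -/
lemma log_coeff_ge {k t s κ2 : ℝ} (hk : 7 ≤ k) (hκ2 : κ2 = k * (k + 1)) (hsk : s * (k + 1) = 1)
    (hs0 : 0 < s) (hs8 : s ≤ 1 / 8) (ht : 0.0763 + 0.9237 * s ≤ t) :
    0.2 + 1.45 * s ≤ Real.log (1 + 3 * t - 6 / κ2) := by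
  have h6 : 6 / κ2 ≤ 0.8572 * s := by
    rw [hκ2, div_le_iff₀ (by positivity)]
    have : 0.8572 * s * (k * (k + 1)) = 0.8572 * k := by linear_combination 0.8572 * k * hsk
    rw [this]; linarith
  rw [Real.le_log_iff_exp_le (by linarith)]
  have hb := Real.exp_bound' (x := 0.2 + 1.45 * s) (by positivity) (by linarith) (n := 4)
    (by norm_num)
  norm_num [Finset.sum_range_succ, Nat.factorial] at hb
  norm_num at hb ⊢
  refine hb.trans ?_
  have h2 : s ^ 2 ≤ s / 8 := by nlinarith
  have hx2 : (1 / 5 + 29 / 20 * s) ^ 2 ≤ 0.04 + 0.8429 * s := by nlinarith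
  have hx0 : 0 ≤ 1 / 5 + 29 / 20 * s := by positivity
  have hx3 : (1 / 5 + 29 / 20 * s) ^ 3 ≤ 0.008 + 0.3795 * s := by
    calc (1 / 5 + 29 / 20 * s) ^ 3 = (1 / 5 + 29 / 20 * s) ^ 2 * (1 / 5 + 29 / 20 * s) := by ring
      _ ≤ (0.04 + 0.8429 * s) * (1 / 5 + 29 / 20 * s) := by gcongr
      _ ≤ _ := by nlinarith
  have hx4 : (1 / 5 + 29 / 20 * s) ^ 4 ≤ 0.0016 + 0.1571 * s := by
    calc (1 / 5 + 29 / 20 * s) ^ 4 = (1 / 5 + 29 / 20 * s) ^ 3 * (1 / 5 + 29 / 20 * s) := by ring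
      _ ≤ (0.008 + 0.3795 * s) * (1 / 5 + 29 / 20 * s) := by gcongr
      _ ≤ _ := by nlinarith
  norm_num at *
  linarith

/-- Near `R = 1` the leading term of `log_base_le` is bounded by a quadratic polynomial in `t`. -/
lemma log_base_low {t R : ℝ} (hR : 0 < R) (hRt : R ^ 2 = 1 - t) (ht0 : 0 ≤ t) (ht3 : t ≤ 0.3)
    (hRu : R ≤ 1 - t / 2 - t ^ 2 / 8) :
    Real.log 2 - 1 + Real.log (1 + R * (1 / Real.pi)) - Real.log R ≤
      - 0.03045 + 0.37935 * t + 0.29 * t ^ 2 := by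
  obtain ⟨hp1, hp2⟩ := inv_pi_bounds
  have h2 := Real.log_two_lt_d9
  have hlr : -Real.log R ≤ (t + 0.64 * t ^ 2) / 2 := by
    have := neg_log_le (t := t) (by linarith) ht3
    rw [← hRt, Real.log_pow] at this; push_cast at this; linarith
  have h1p : 0 < 1 + 1 / Real.pi := by linarith
  have h1R : 0 < 1 + R * (1 / Real.pi) := by positivity
  have hl := Real.log_le_sub_one_of_pos (div_pos h1R h1p)
  rw [Real.log_div h1R.ne' h1p.ne'] at hl
  have : (1 + R * (1 / Real.pi)) / (1 + 1 / Real.pi) - 1 ≤ - 0.2413 * (t / 2 + t ^ 2 / 8) := by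
    rw [sub_le_iff_le_add, div_le_iff₀ h1p]
    have e1 : R * (1 / Real.pi) ≤ (1 - t / 2 - t ^ 2 / 8) * (1 / Real.pi) := by gcongr
    have e2 : 0 ≤ (1 / Real.pi - 0.3183) * (t / 2 + t ^ 2 / 8) := by
      apply mul_nonneg <;> [linarith; positivity]
    nlinarith
  have := log_one_add_inv_pi
  linarith [sq_nonneg t]

lemma log_last_low {k κ R t : ℝ} (hk : 7 ≤ k) (hκ : 0 < κ) (hκu : κ ≤ k + 1 / 2) (hR : 0 < R)
    (hlogR : t ≤ - 2 * Real.log R) :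
    Real.log (1.21 * κ * R * (1 / Real.pi) / 2) ≤ 0.219 + k / 17 - t / 2 := by
  obtain ⟨hp1, hp2⟩ := inv_pi_bounds
  have hp := Real.pi_pos
  rw [show 1.21 * κ * R * (1 / Real.pi) / 2 = (1.21 * κ * (1 / Real.pi) / 2) * R by ring,
    Real.log_mul (by positivity) hR.ne']
  have h1 : 1.21 * κ * (1 / Real.pi) / 2 ≤ 3.2742 * ((k + 1 / 2) / 17) := by
    have : κ * (1 / Real.pi) ≤ (k + 1/2) * 0.31832 := by gcongr
    linarith
  have h2 : Real.log (1.21 * κ * (1 / Real.pi) / 2) ≤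
      Real.log (3.2742) + Real.log ((k + 1 / 2) / 17) := by
    rw [← Real.log_mul (by norm_num) (by positivity)]
    exact Real.log_le_log (by positivity) h1
  have h3 := Real.log_le_sub_one_of_pos (show 0 < (k + 1 / 2) / 17 by positivity)
  have h4 : Real.log 3.2742 ≤ 1.189 := by
    rw [Real.log_le_iff_le_exp (by norm_num)]
    have h := Real.sum_le_exp_of_nonneg (x := 1.189) (by norm_num) 8
    norm_num [Finset.sum_range_succ, Nat.factorial] at h
    norm_num
    linarith
  linarith

/-- The comparison of exponents when `π a` is close to `κ`, in terms of `R = π a / κ` and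
`t = 1 - R ^ 2`. -/
lemma regime_low {k κ t R : ℝ} (hk : 7 ≤ k) (hκ : 0 < κ) (hκ2 : κ ^ 2 = k * (k + 1))
    (hR : 0 < R) (hRt : R ^ 2 = 1 - t) (ht : 0.0763 + 0.9237 / (k + 1) ≤ t) (ht3 : t ≤ 0.3) :
    2 * k * Real.log (2 / Real.exp 1 * (k / (κ * R) + 1 / Real.pi)) +
      Real.log (1.21 * κ * R * (1 / Real.pi) / 2) ≤
    Real.log (1 + 3 * t - 6 / κ ^ 2) + κ ^ 2 * ((1 + t) / 2 * Real.log ((1 + t) / (1 - t)) - t)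
      / √((κ * t) ^ 2 + κ * t + 16) := by
  obtain ⟨s, hs⟩ : ∃ s, s = 1 / (k + 1) := ⟨_, rfl⟩
  have hs0 : 0 < s := by rw [hs]; positivity
  have hs8 : s ≤ 1 / 8 := by rw [hs]; gcongr; linarith
  have hsk : s * (k + 1) = 1 := by rw [hs]; field_simp
  rw [show 0.9237 / (k + 1) = 0.9237 * s by rw [hs]; ring] at ht
  have ht0 : 0.0763 ≤ t := by linarith
  obtain ⟨hp1, hp2⟩ := inv_pi_bounds
  have hκl : k + 0.48 ≤ κ := by nlinarith
  have hκu : κ ≤ k + 1 / 2 := by nlinarith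
  have hR1 : R ≤ 0.9612 := by nlinarith
  have hRu : R ≤ 1 - t / 2 - t ^ 2 / 8 := by
    apply abs_le_of_sq_le_sq' _ (by nlinarith) |>.2
    nlinarith [pow_nonneg (show (0:ℝ) ≤ t by linarith) 3, pow_nonneg (show (0:ℝ) ≤ t by linarith) 4]
  have hlogR : t ≤ - 2 * Real.log R := by
    have := Real.log_le_sub_one_of_pos (pow_pos hR 2)
    rw [Real.log_pow] at this; push_cast at this; linarith
  -- the right-hand side
  have hL : κ ^ 2 * (t ^ 2 * (1 + t / 3)) ≤
      κ ^ 2 * ((1 + t) / 2 * Real.log ((1 + t) / (1 - t)) - t) := by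
    have := log_ge_cubic (t := t) (by linarith) (by linarith)
    gcongr
    nlinarith [pow_nonneg (show (0:ℝ) ≤ t by linarith) 3, pow_nonneg (show (0:ℝ) ≤ t by linarith) 4]
  have hrhs : (0.85 * (κ * t) - 0.872) * (1 + t / 3) ≤
      κ ^ 2 * ((1 + t) / 2 * Real.log ((1 + t) / (1 - t)) - t)
      / √((κ * t) ^ 2 + κ * t + 16) := by
    have hy : 0 ≤ κ * t := by positivity
    refine le_trans ?_ (div_le_div_of_nonneg_right hL (Real.sqrt_nonneg _))
    have := mul_le_mul_of_nonneg_right (tangent_low hy) (show 0 ≤ 1 + t / 3 by positivity)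
    refine this.trans (le_of_eq ?_)
    ring
  have hrhs2 : 0.85 * (k * t) * (1 + t / 3) + 0.408 * t * (1 + t / 3) - 0.872 * (1 + t / 3) ≤
      (0.85 * (κ * t) - 0.872) * (1 + t / 3) := by
    have : 0 ≤ (κ - k - 0.48) * (t * (1 + t / 3)) := by
      apply mul_nonneg (by linarith); positivity
    linarith
  have hc1 := log_coeff_ge hk hκ2 hsk hs0 hs8 ht
  -- the left-hand side
  have hlogG := log_base_low hR hRt (by linarith) ht3 hRu
  have hbase := log_base_le (k := k) (by linarith) hκ hκ2 hR
  have hbase2 : 0.7655 * (1 - s) ≤ k / (k + 1) / (1 + R * (1 / Real.pi)) := by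
    have : k / (k + 1) = 1 - s := by rw [hs]; field_simp; ring
    rw [this, le_div_iff₀ (by positivity)]
    have h1 : R * (1 / Real.pi) ≤ 0.9612 * 0.31832 := by gcongr
    have h2 : 0.7655 * (1 - s) * (1 + R * (1 / Real.pi)) ≤ 0.7655 * (1 - s) * 1.30632 := by
      apply mul_le_mul_of_nonneg_left <;> linarith
    linarith
  have hlast := log_last_low hk hκ hκu hR hlogR
  have hk2 : 2 * k * (Real.log 2 - 1 + Real.log (1 + R * (1 / Real.pi)) - Real.log R) ≤
      2 * k * (- 0.03045 + 0.37935 * t + 0.29 * t ^ 2) := by gcongr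
  have hbr : 0.0614 ≤ 0.85 * t * (1 + t / 3) - 2 * (- 0.03045 + 0.37935 * t + 0.29 * t ^ 2) := by
    have := mul_nonneg (sub_nonneg.2 ht0) (sub_nonneg.2 ht3)
    linarith
  have hbrk := mul_le_mul_of_nonneg_left hbr (show 0 ≤ k by linarith)
  have hts : 0.408 * t * (1 + t / 3) - 0.872 * (1 + t / 3) + t / 2 ≥ -0.825 + 0.58 * s := by
    have := sq_nonneg (t - 0.0763)
    linarith
  have hfin : 0 ≤ 0.2 + 1.45 * s + 0.7655 * (1 - s) - 0.219 - 0.825 + 0.58 * s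
      + (0.0614 - 1 / 17) * k := by
    refine nonneg_of_mul_nonneg_right ?_ hs0
    have := sq_nonneg (s - 0.032)
    linarith
  linarith

/-! ### Comparison of exponents away from the critical bandwidth -/

lemma two_log_le {y : ℝ} (hy : 1 ≤ y) : 2 * Real.log y ≤ y - 1 / y := by
  have h := Real.self_le_sinh_iff.mpr (Real.log_nonneg hy)
  rw [Real.sinh_log (by linarith)] at h
  rw [one_div]; linarith

/-- An upper bound for the integrated growth rate; it controls the loss in `tangent_high`. -/
lemma entropy_le {t x : ℝ} (ht0 : 0 < t) (hx : 0 < x) (hxt : x ^ 2 = 1 - t) :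
    (1 + t) / 2 * Real.log ((1 + t) / (1 - t)) - t ≤ t * (t / x) := by
  have ht1 : 0 < 1 - t := by rw [← hxt]; positivity
  obtain ⟨w, hw, hw2⟩ : ∃ w : ℝ, 1 ≤ w ∧ w ^ 2 = 1 + t :=
    ⟨√(1 + t), by rw [Real.one_le_sqrt]; linarith, Real.sq_sqrt (by linarith)⟩
  have hx1 : x ≤ 1 := by nlinarith
  have h1 := two_log_le hw
  have h2 := two_log_le (y := 1 / x) (by rw [le_div_iff₀ hx]; linarith)
  rw [one_div_one_div, one_div, Real.log_inv] at h2
  rw [← hw2, ← hxt, Real.log_div (by positivity) (by positivity), Real.log_pow, Real.log_pow]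
  push_cast
  have h3 : w ^ 2 * (2 * Real.log w) ≤ w * t := by
    have := mul_le_mul_of_nonneg_left h1 (sq_nonneg w)
    have e : w ^ 2 * (w - 1 / w) = w * t := by field_simp; linear_combination hw2
    linarith
  have hwx : w + x ≤ 2 := by nlinarith [sq_nonneg (w - x)]
  have e2 : x⁻¹ - x = t / x := by field_simp; linarith
  rw [e2] at h2
  have e3 : x ^ 2 * (t / x) = x * t := by field_simp
  have h5 := mul_le_mul_of_nonneg_left h2 (show 0 ≤ w ^ 2 by positivity)
  have h6 : w * t + x * t ≤ 2 * t := by nlinarith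
  have e4 : w ^ 2 * (t / x) = 2 * (t * (t / x)) + x * t := by
    rw [hw2, ← e3, hxt]; ring
  linarith

/-- The difference between the growth exponent and the required exponent, both divided by `κ` up to
lower order, is bounded below by a cubic polynomial in `x`. -/
lemma gap_ge {t x : ℝ} (ht0 : 0.3 ≤ t) (hx : 0 < x) (hxt : x ^ 2 = 1 - t) :
    0.28036 - 0.63664 * x + 0.87303 * x ^ 2 - 0.4125 * x ^ 3 ≤
    ((1 + t) / 2 * Real.log ((1 + t) / (1 - t)) - t) / t
      - 2 * (Real.log 2 - 1 + Real.log (1 + x * (1 / Real.pi)) - Real.log x) := by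
  have ht1 : t < 1 := by nlinarith
  have htp : 0 < t := by linarith
  have hlx : t + t ^ 2 / 2 + t ^ 3 / 3 ≤ - (2 * Real.log x) := by
    have h := neg_log_ge htp.le ht1
    rw [← hxt, Real.log_pow] at h; exact_mod_cast h
  have hl1 := log_one_add_ge htp.le
  obtain ⟨hp1, hp2⟩ := inv_pi_bounds
  have hl2 := log_one_add_le_cubic (u := x * (1 / Real.pi)) (by positivity)
  have e : ((1 + t) / 2 * Real.log ((1 + t) / (1 - t)) - t) / t + 2 * Real.log x
      = (1 - t) / (2 * t) * (-(2 * Real.log x)) + (1 + t) / (2 * t) * Real.log (1 + t) - 1 := by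
    rw [← hxt, Real.log_div (by positivity) (by positivity), Real.log_pow, hxt]
    field_simp
    push_cast
    ring
  have h1 : (1 - t) * (1 / 2 + t / 4 + t ^ 2 / 6) ≤ (1 - t) / (2 * t) * (-(2 * Real.log x)) := by
    have := mul_le_mul_of_nonneg_left hlx (show 0 ≤ (1 - t) / (2 * t) by
      apply div_nonneg <;> linarith)
    refine le_trans (le_of_eq ?_) this
    field_simp
    ring
  have h2 : 1 - (0.33334 + 0.14494 * (1 - t)) ≤ (1 + t) / (2 * t) * Real.log (1 + t) := by
    have := mul_le_mul_of_nonneg_left hl1 (show 0 ≤ (1 + t) / (2 * t) by positivity)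
    refine le_trans ?_ this
    have e : (1 + t) / (2 * t) * (2 * t / (2 + t)) = (1 + t) / (2 + t) := by field_simp
    rw [e, le_div_iff₀ (by linarith)]
    nlinarith
  have h3 := Real.log_two_lt_d9
  have hx2 : x ≤ 0.8367 := by nlinarith
  have h4 : x * (1 / Real.pi) - (x * (1 / Real.pi)) ^ 2 / 2 + (x * (1 / Real.pi)) ^ 3 / 3 ≤
      0.31832 * x - 0.101314 / 2 * x ^ 2 + 0.032256 / 3 * x ^ 3 := by
    have a1 : x * (1 / Real.pi) ≤ x * 0.31832 := by gcongr
    have a2 : (x * 0.3183) ^ 2 ≤ (x * (1 / Real.pi)) ^ 2 := by gcongr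
    have a3 : (x * (1 / Real.pi)) ^ 3 ≤ (x * 0.31832) ^ 3 := by gcongr
    have a4 := pow_pos hx 3
    have a5 := sq_nonneg x
    linarith
  have h5 : 0.58334 * x ^ 4 - x ^ 6 / 6 ≤ 0.3906 * x ^ 3 := by
    have : 0.58334 * x - x ^ 3 / 6 ≤ 0.3906 := by nlinarith [mul_nonneg hx.le (sub_nonneg.2 hx2)]
    have := mul_le_mul_of_nonneg_left this (pow_pos hx 3).le
    linarith
  have ht : t = 1 - x ^ 2 := by linarith
  have h6 : (1 - t) * (1 / 2 + t / 4 + t ^ 2 / 6) + (1 - (0.33334 + 0.14494 * (1 - t)))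
     = x ^ 2 * (11 / 12) - 7 / 12 * x ^ 4 + x ^ 6 / 6 + 0.66666 - 0.14494 * x ^ 2 := by
    rw [ht]; ring
  have a4 := pow_pos hx 3
  have a5 := pow_pos hx 4
  have a6 := sq_nonneg x
  linarith

lemma regime_high_poly {x t : ℝ} (hx : 0 ≤ x) (hx2 : x ≤ 0.8367) (ht : t = 1 - x ^ 2) :
    0 ≤ 6.59 * (0.28036 - 0.63664 * x + 0.87303 * x ^ 2 - 0.4125 * x ^ 3 - 0.13 * x)
      - 0.48 * x * (0.28036 - 0.63664 * x + 0.87303 * x ^ 2 - 0.4125 * x ^ 3)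
      - (1.34 - 0.48 * t) + 0.875 * x * (1 - 0.31832 * x) + 0.58 * x + 0.6 * x := by
  subst ht
  nlinarith [mul_nonneg hx (sub_nonneg.2 hx2), mul_nonneg hx (sq_nonneg (x - 0.6)),
    mul_nonneg (sub_nonneg.2 hx2) (sq_nonneg (x - 0.6)), pow_nonneg hx 3, pow_nonneg hx 4]

/-- The comparison of exponents when `π a` is well below `κ`, in terms of `x = π a / κ` and
`t = 1 - x ^ 2`. -/
lemma regime_high {k κ t x : ℝ} (hk : 7 ≤ k) (hκ : 0 < κ) (hκ2 : κ ^ 2 = k * (k + 1))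
    (hx : 0 < x) (hxt : x ^ 2 = 1 - t) (hc : 6.59 ≤ κ * x) (ht3 : 0.3 ≤ t) {c1 : ℝ}
    (hc1 : 1.79 ≤ c1) :
    2 * k * Real.log (2 / Real.exp 1 * (k / (κ * x) + 1 / Real.pi)) +
      Real.log (1.21 * κ * x * (1 / Real.pi) / 2) ≤
    Real.log c1 + κ ^ 2 * ((1 + t) / 2 * Real.log ((1 + t) / (1 - t)) - t)
      / √((κ * t) ^ 2 + κ * t + 16) := by
  have htp : 0 < t := by linarith
  have ht1 : t < 1 := by nlinarith
  have hx2 : x ≤ 0.8367 := by nlinarith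
  obtain ⟨hp1, hp2⟩ := inv_pi_bounds
  have hκl : k + 0.48 ≤ κ := by nlinarith
  have hlast : Real.log (1.21 * κ * x * (1 / Real.pi) / 2) ≤ 0.13 * (κ * x) - 0.6 := by
    have h1 : 1.21 * κ * x * (1 / Real.pi) / 2 ≤ 1.4816 * (0.13 * (κ * x)) := by
      have : κ * x * (1 / Real.pi) ≤ κ * x * 0.31832 := by gcongr
      linarith
    have h2 := Real.log_le_log (by positivity) h1
    rw [Real.log_mul (by norm_num) (by positivity)] at h2
    have h3 := Real.log_le_sub_one_of_pos (show 0 < 0.13 * (κ * x) by positivity)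
    have h4 : Real.log 1.4816 ≤ 0.4 := by
      rw [Real.log_le_iff_le_exp (by norm_num)]
      have h := Real.sum_le_exp_of_nonneg (x := 0.4) (by norm_num) 4
      norm_num [Finset.sum_range_succ, Nat.factorial] at h
      norm_num
      linarith
    linarith
  have hlogc : 0.58 ≤ Real.log c1 := by
    rw [Real.le_log_iff_exp_le (by linarith)]
    have h := Real.exp_bound' (x := 0.58) (by norm_num) (by norm_num) (n := 5) (by norm_num)
    norm_num [Finset.sum_range_succ, Nat.factorial] at h
    norm_num at hc1 ⊢
    linarith
  have hgap := gap_ge ht3 hx hxt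
  have hent := entropy_le htp hx hxt
  have hbase := log_base_le (k := k) (by linarith) hκ hκ2 hx
  have hLpos : 0 ≤ (1 + t) / 2 * Real.log ((1 + t) / (1 - t)) - t := by
    have := log_ge_cubic htp.le ht1
    nlinarith [pow_pos htp 3]
  obtain ⟨L, hL⟩ : ∃ L, L = (1 + t) / 2 * Real.log ((1 + t) / (1 - t)) - t := ⟨_, rfl⟩
  obtain ⟨g, hg⟩ : ∃ g, g = Real.log 2 - 1 + Real.log (1 + x * (1 / Real.pi)) - Real.log x :=
    ⟨_, rfl⟩
  obtain ⟨Q, hQ⟩ : ∃ Q, Q = 0.28036 - 0.63664 * x + 0.87303 * x ^ 2 - 0.4125 * x ^ 3 := ⟨_, rfl⟩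
  rw [← hL] at hgap hent hLpos ⊢
  rw [← hg] at hgap hbase
  rw [← hQ] at hgap
  have hg0 : 0 ≤ g := by
    have h1 := log_one_add_ge (t := x * (1 / Real.pi)) (by positivity)
    have h2 := Real.log_le_sub_one_of_pos hx
    have h3 := Real.log_two_gt_d9
    have h4 : 0.28 * x ≤ 2 * (x * (1 / Real.pi)) / (2 + x * (1 / Real.pi)) := by
      rw [le_div_iff₀ (by positivity)]
      have a1 : x * (1 / Real.pi) ≤ 0.8367 * 0.31832 := by gcongr
      have a2 : x * 0.3183 ≤ x * (1 / Real.pi) := by gcongr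
      have := mul_le_mul_of_nonneg_left a1 hx.le
      linarith
    linarith
  have hmain : (L / t ^ 2) * (κ * t - 1.34) ≤ κ ^ 2 * L / √((κ * t) ^ 2 + κ * t + 16) := by
    have := mul_le_mul_of_nonneg_left (tangent_high (y := κ * t) (by positivity))
      (show 0 ≤ L / t ^ 2 by positivity)
    refine this.trans (le_of_eq ?_)
    field_simp
  have hfrac : 0.875 * (1 - 0.31832 * x) ≤ k / (k + 1) / (1 + x * (1 / Real.pi)) := by
    have h1 : 0.875 ≤ k / (k + 1) := by rw [le_div_iff₀ (by positivity)]; linarith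
    rw [le_div_iff₀ (by positivity)]
    have h2 : 1 - 0.31832 * x ≤ 1 - x * (1 / Real.pi) := by nlinarith
    have h3 : (1 - 0.31832 * x) * (1 + x * (1 / Real.pi)) ≤ 1 := by
      have : 0 ≤ x * (1 / Real.pi) := by positivity
      nlinarith
    linarith
  have hpoly := regime_high_poly hx.le hx2 (show t = 1 - x ^ 2 by linarith)
  rw [← hQ] at hpoly
  have hkg : 2 * k * g ≤ 2 * (κ - 0.48) * g := by
    apply mul_le_mul_of_nonneg_right _ hg0; linarith
  have hQ13 : 0 ≤ Q - 0.13 * x := by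
    rw [hQ]
    have := mul_nonneg (sub_nonneg.2 hx2) (sq_nonneg (x - 0.64))
    linarith
  -- total gain after multiplication by `x`
  have h1 : (L / t ^ 2) * (κ * t - 1.34) = κ * (L / t) - 1.34 / t * (L / t) := by
    field_simp
  have hH : L / t ≤ t / x := by rw [div_le_iff₀ htp]; linarith
  have h2 : (1.34 / t - 0.48) * (L / t) ≤ (1.34 - 0.48 * t) / x := by
    have : 0 ≤ 1.34 / t - 0.48 := by
      rw [sub_nonneg, le_div_iff₀ htp]; linarith
    refine (mul_le_mul_of_nonneg_left hH this).trans (le_of_eq ?_)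
    field_simp
  have h3 : (κ - 0.48) * Q ≤ (κ - 0.48) * (L / t - 2 * g) :=
    mul_le_mul_of_nonneg_left hgap (by linarith)
  have h4 : 0 ≤ (κ - 0.48) * Q - (1.34 - 0.48 * t) / x + 0.875 * (1 - 0.31832 * x) + 0.58
      - 0.13 * (κ * x) + 0.6 := by
    refine nonneg_of_mul_nonneg_right (a := x) ?_ hx
    have e : x * ((κ - 0.48) * Q - (1.34 - 0.48 * t) / x + 0.875 * (1 - 0.31832 * x) + 0.58
      - 0.13 * (κ * x) + 0.6) = κ * x * (Q - 0.13 * x) - 0.48 * x * Q - (1.34 - 0.48 * t)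
       + 0.875 * x * (1 - 0.31832 * x) + 0.58 * x + 0.6 * x := by field_simp; ring
    rw [e]
    have := mul_le_mul_of_nonneg_right hc hQ13
    linarith
  linarith

/-! ### The growth factor dominates the required power -/

/-- The growth exponent of `SpheroidalSolution.growth` in the variable `t = (M - 1) / (M + 1)`. -/
lemma exponent_eq {κ t : ℝ} (hκ : 0 < κ) (ht0 : 0 < t) (ht1 : t < 1) {M v E : ℝ}
    (hM : M = (1 + t) / (1 - t)) (hv : v = M - 1) (hE : E = 4 * (M + 1) / κ) :
    κ * M / √(v ^ 2 + E ^ 2 + E * v / 4) * (Real.log M - 1 + 1 / M) =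
      κ ^ 2 * ((1 + t) / 2 * Real.log ((1 + t) / (1 - t)) - t)
      / √((κ * t) ^ 2 + κ * t + 16) := by
  have h1 : 0 < 1 - t := by linarith
  have hy : 0 < √((κ * t) ^ 2 + κ * t + 16) := Real.sqrt_pos.mpr (by positivity)
  have e : √(v ^ 2 + E ^ 2 + E * v / 4) = 2 / ((1 - t) * κ) * √((κ * t) ^ 2 + κ * t + 16) := by
    rw [← Real.sqrt_sq (show 0 ≤ 2 / ((1 - t) * κ) by positivity), ← Real.sqrt_mul (by positivity)]
    congr 1
    rw [hE, hv, hM]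
    field_simp
    ring
  rw [e, ← hM]
  have hM0 : 0 < 1 + t := by linarith
  have : 1 / M = (1 - t) / (1 + t) := by rw [hM, one_div_div]
  rw [this]
  generalize Real.log M = l
  rw [hM]
  field_simp
  ring

/-- With `a = N W`, the bound obtained from the differential equation is at most
`2 / (2 (k + a) / (e π a)) ^ (2 k)`. The hypotheses force `k ≥ 7` and keep `π a / κ` away from `1`. -/
theorem growth_beats_target {k : ℕ} {a κ M v E c1 : ℝ} (ha : 2.1 ≤ a)
    (hka : Real.exp 1 * Real.pi * a ≤ 2 * (k + a)) (hκ : κ = √(k * (k + 1)))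
    (hM : M = 2 * κ ^ 2 / (Real.pi * a) ^ 2 - 1) (hv : v = M - 1) (hE : E = 4 * (M + 1) / κ)
    (hc1 : c1 = 1 + min 1 (3 * (1 - (Real.pi * a) ^ 2 / κ ^ 2)) - 6 / κ ^ 2) :
    0 < c1 ∧ 1.21 * a / 2 * (2 * (k + a) / (Real.exp 1 * Real.pi * a)) ^ (2 * k) ≤
      c1 * Real.exp (κ * M / √(v ^ 2 + E ^ 2 + E * v / 4) * (Real.log M - 1 + 1 / M)) := by
  have hp := Real.pi_pos
  have hp1 := Real.pi_gt_d4
  have hp2 := Real.pi_lt_d4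
  have he := Real.exp_one_gt_d9
  have ha0 : 0 < a := by linarith
  have hep : 8.53948 ≤ Real.exp 1 * Real.pi := by nlinarith
  have hak : 6.53948 * a ≤ 2 * k := by nlinarith
  have hk7 : (7 : ℝ) ≤ k := by
    have : (6 : ℝ) < k := by linarith
    exact_mod_cast this
  have hk0 : (0 : ℝ) < k := by linarith
  have hκ2 : κ ^ 2 = k * (k + 1) := by rw [hκ]; exact Real.sq_sqrt (by positivity)
  have hκ0 : 0 < κ := by rw [hκ]; exact Real.sqrt_pos.mpr (by positivity)
  obtain ⟨x, hx⟩ : ∃ x, x = Real.pi * a / κ := ⟨_, rfl⟩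
  obtain ⟨t, ht⟩ : ∃ t, t = 1 - (Real.pi * a) ^ 2 / κ ^ 2 := ⟨_, rfl⟩
  have hx0 : 0 < x := by rw [hx]; positivity
  have hκx : κ * x = Real.pi * a := by rw [hx]; field_simp
  have hxt : x ^ 2 = 1 - t := by rw [hx, ht]; ring
  have hc : Real.pi * a ≤ 0.96082 * k := by nlinarith
  have hc6 : 6.59 ≤ κ * x := by rw [hκx]; nlinarith
  have hts : 0.0763 + 0.9237 / (k + 1) ≤ t := by
    have h1 : (Real.pi * a) ^ 2 ≤ (0.96082 * k) ^ 2 := by gcongr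
    have h2 : (Real.pi * a) ^ 2 / κ ^ 2 ≤ 0.9237 * (k / (k + 1)) := by
      rw [hκ2, div_le_iff₀ (by positivity)]
      have : 0.9237 * ((k : ℝ) / (k + 1)) * (k * (k + 1)) = 0.9237 * k ^ 2 := by field_simp
      rw [this]; nlinarith
    have h3 : (k : ℝ) / (k + 1) = 1 - 1 / (k + 1) := by field_simp; ring
    rw [h3] at h2
    rw [ht]
    have h4 : 0.9237 / ((k : ℝ) + 1) = 0.9237 * (1 / (k + 1)) := by ring
    rw [h4]; linarith
  have ht0 : 0.0763 ≤ t := by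
    have : 0 ≤ 0.9237 / ((k : ℝ) + 1) := by positivity
    linarith
  have ht1 : t < 1 := by
    rw [ht]; have : 0 < (Real.pi * a) ^ 2 / κ ^ 2 := by positivity
    linarith
  have hMt : M = (1 + t) / (1 - t) := by
    rw [hM, ht]; field_simp; ring
  rw [← ht] at hc1
  have h6 : 6 / κ ^ 2 ≤ 0.11 := by
    rw [hκ2, div_le_iff₀ (by positivity)]; nlinarith
  have key : 0 < c1 ∧ 2 * k * Real.log (2 / Real.exp 1 * (k / (κ * x) + 1 / Real.pi)) +
      Real.log (1.21 * κ * x * (1 / Real.pi) / 2) ≤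
    Real.log c1 + κ ^ 2 * ((1 + t) / 2 * Real.log ((1 + t) / (1 - t)) - t)
      / √((κ * t) ^ 2 + κ * t + 16) := by
    rcases le_total t 0.3 with h3 | h3
    · have : c1 = 1 + 3 * t - 6 / κ ^ 2 := by rw [hc1, min_eq_right (by linarith)]
      rw [this]
      exact ⟨by linarith, regime_low hk7 hκ0 hκ2 hx0 hxt hts h3⟩
    · have : 1.79 ≤ c1 := by
        rw [hc1]
        have : 0.9 ≤ min 1 (3 * t) := le_min (by norm_num) (by linarith)
        linarith
      exact ⟨by linarith, regime_high hk7 hκ0 hκ2 hx0 hxt hc6 h3 this⟩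
  refine ⟨key.1, ?_⟩
  have hX : 2 / Real.exp 1 * (k / (κ * x) + 1 / Real.pi) = 2 * (k + a) / (Real.exp 1 * Real.pi * a) := by
    rw [hκx]; field_simp
  have hlast : 1.21 * κ * x * (1 / Real.pi) / 2 = 1.21 * a / 2 := by
    rw [mul_assoc 1.21, hκx]; field_simp
  have h := key.2
  rw [hX, hlast, ← exponent_eq hκ0 (by linarith) ht1 hMt hv hE] at h
  have hX0 : 0 < 2 * (k + a) / (Real.exp 1 * Real.pi * a) := by positivity
  rw [← Real.log_le_log_iff (by positivity) (mul_pos key.1 (Real.exp_pos _)),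
    Real.log_mul (by positivity) (by positivity), Real.log_pow,
    Real.log_mul key.1.ne' (Real.exp_pos _).ne', Real.log_exp]
  push_cast
  linarith

/-! ### A subsolution of the Riccati equation -/

lemma quartic_large_aux {n w : ℝ} (hn : 1 / 8 ≤ n) (hw : 0 ≤ w) :
    (3 + n) ^ 2 * w ^ 2 * (5 / 2 * n + w) ^ 2 ≤
      16 * (3 / 2 * n + w) * n * ((3 / 2 * n + w) * (5 + 3 * n) + 2 * (1 + n) * (2 + n)) *
        ((n / 2 + w) ^ 2 + 2 * n ^ 3 + 2 * n ^ 4 + (n / 2 + w) * n ^ 3) := by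
  obtain ⟨r, hr, rfl⟩ : ∃ r, 0 ≤ r ∧ n = 1 / 8 + r := ⟨n - 1 / 8, by linarith, by ring⟩
  rw [← sub_nonneg]
  ring_nf
  positivity

/-- The discriminant inequality of `quadratic_form_le_one` for `n ≥ 1 / 8`. Here `T` is positive only
if `D > 3 n / 2`, and after shifting both variables to their minima all coefficients are positive. -/
lemma discr_le_of_large {n D S T : ℝ} (hn : 1 / 8 ≤ n)
    (hS : S = (D - n) ^ 2 + 2 * n ^ 3 + n ^ 4 + D * n ^ 3)
    (hT : T = D * (3 + n) - 2 * n * (1 + n) * (2 + n)) (hT0 : 0 < T) :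
    T ^ 2 * (n + D) ^ 2 ≤ 16 * D * (3 * (1 + n) ^ 2 * D - T) * S := by
  obtain ⟨w, hw⟩ : ∃ w, w = D - 3 / 2 * n := ⟨_, rfl⟩
  have hDw : D = 3 / 2 * n + w := by linarith
  have hn3 : 0 ≤ n * (2 * n ^ 2 + 4.5 * n - 0.5) := by
    apply mul_nonneg (by linarith); nlinarith
  have h1 : T ≤ (3 + n) * w := by rw [hT, hDw]; linarith
  have hw0 : 0 ≤ w := by
    have : 0 < w * (3 + n) := by linarith
    exact (pos_of_mul_pos_left this (by linarith)).le
  have h2 : T ^ 2 ≤ ((3 + n) * w) ^ 2 := by gcongr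
  have h3 := quartic_large_aux hn hw0
  have h4 : 16 * D * (3 * (1 + n) ^ 2 * D - T) * S = 16 * (3 / 2 * n + w) * n *
      ((3 / 2 * n + w) * (5 + 3 * n) + 2 * (1 + n) * (2 + n)) *
        ((n / 2 + w) ^ 2 + 2 * n ^ 3 + 2 * n ^ 4 + (n / 2 + w) * n ^ 3) := by
    rw [hS, hT, hDw]; ring
  rw [h4]
  refine le_trans (mul_le_mul_of_nonneg_right h2 (sq_nonneg _)) (le_trans (le_of_eq ?_) h3)
  rw [hDw]; ring

/-- The discriminant inequality of `quadratic_form_le_one` for `D ≤ 4.7 n`, homogenized by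
`D = n (1 + q)`. -/
lemma discr_le_of_mid {n D S T : ℝ} (hn0 : 0 < n) (hD : 0 < D) (hDn : D ≤ 4.7 * n)
    (hS : S = (D - n) ^ 2 + 2 * n ^ 3 + n ^ 4 + D * n ^ 3)
    (hT : T = D * (3 + n) - 2 * n * (1 + n) * (2 + n)) (hT0 : 0 < T) :
    T ^ 2 * (n + D) ^ 2 ≤ 16 * D * (3 * (1 + n) ^ 2 * D - T) * S := by
  obtain ⟨q, hq⟩ : ∃ q, q = (D - n) / n := ⟨_, rfl⟩
  have hDq : D = n * (1 + q) := by rw [hq]; field_simp; ring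
  have hq0 : 0 ≤ q := by
    have h1 : 0 < (D - n) * (3 + n) := by nlinarith [sq_nonneg n, pow_pos hn0 3]
    rw [hq]; exact div_nonneg (pos_of_mul_pos_left h1 (by linarith)).le hn0.le
  have hq1 : q ≤ 3.7 := by
    rw [hq, div_le_iff₀ hn0]; linarith
  have h1 : T ≤ (3 + n) * (n * q) := by rw [hT, hDq]; nlinarith [sq_nonneg n, pow_pos hn0 3]
  have h2 : T ^ 2 ≤ ((3 + n) * (n * q)) ^ 2 := by gcongr
  have h3 : (2 + q) ^ 2 * (3 + n) ^ 2 ≤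
      16 * (n * (1 + q) * (5 + 3 * n) + 2 * (1 + n) * (2 + n)) * (1 + q) := by
    have a0 : 9 * (2 + q) ^ 2 ≤ 64 * (1 + q) := by
      nlinarith [mul_nonneg hq0 (sub_nonneg.2 hq1)]
    have a1 : 6 * (2 + q) ^ 2 ≤ 16 * (1 + q) * (5 * (1 + q) + 6) := by nlinarith
    have a2 : (2 + q) ^ 2 ≤ 16 * (1 + q) * (3 * (1 + q) + 2) := by nlinarith
    have b1 := mul_le_mul_of_nonneg_left a1 hn0.le
    have b2 := mul_le_mul_of_nonneg_left a2 (sq_nonneg n)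
    linarith
  have h4 : (n * q) ^ 2 ≤ S := by
    rw [hS, hDq]
    have : 0 ≤ n * (1 + q) * n ^ 3 := by positivity
    nlinarith [pow_pos hn0 3, pow_pos hn0 4]
  have h5 : 16 * D * (3 * (1 + n) ^ 2 * D - T) =
      n ^ 2 * (16 * (n * (1 + q) * (5 + 3 * n) + 2 * (1 + n) * (2 + n)) * (1 + q)) := by
    rw [hT, hDq]; ring
  have h6 : 0 ≤ 16 * D * (3 * (1 + n) ^ 2 * D - T) := by rw [h5]; positivity
  refine le_trans ?_ (mul_le_mul_of_nonneg_left h4 h6)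
  rw [h5]
  have h7 := mul_le_mul_of_nonneg_left h3 (show 0 ≤ n ^ 2 * (n * q) ^ 2 by positivity)
  refine le_trans (mul_le_mul_of_nonneg_right h2 (sq_nonneg _)) (le_trans (le_of_eq ?_)
    (h7.trans (le_of_eq ?_)))
  · rw [hDq]; ring
  · ring

/-- The substitute for the discriminant inequality in the range `n ≤ 1 / 8`, `D ≥ 4.7 n`: it states
`Y / 2 ≤ 1 - X` in `quadratic_form_le_one`. -/
lemma half_le_of_small {n D S T : ℝ} (hn0 : 0 ≤ n) (hn : n ≤ 1 / 8) (hDn : 4.7 * n ≤ D)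
    (hS : S = (D - n) ^ 2 + 2 * n ^ 3 + n ^ 4 + D * n ^ 3)
    (hT : T = D * (3 + n) - 2 * n * (1 + n) * (2 + n)) :
    ((1 + n) ^ 2 * D + T) * (n + D) ^ 2 ≤ 8 * D * S := by
  have h3 : 0 ≤ 8 * D * (D - n) ^ 2 - 4 * (D - n) * (D + n) ^ 2 := by
    obtain ⟨r, hr, rfl⟩ : ∃ r, 0 ≤ r ∧ D = 47 / 10 * n + r := ⟨D - 4.7 * n, by linarith, by ring⟩
    ring_nf; positivity
  have hB : 0 ≤ 8 * (8 * D * (D - n) ^ 2 - 4 * (D - n) * (D + n) ^ 2)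
      + 16 * D * n ^ 2 - (3 * D - 6 * n) * (D + n) ^ 2 - 1 / 8 * ((D + n) ^ 2 * (D - 2 * n)) := by
    obtain ⟨r, hr, rfl⟩ : ∃ r, 0 ≤ r ∧ D = 47 / 10 * n + r := ⟨D - 4.7 * n, by linarith, by ring⟩
    ring_nf; positivity
  have hD0 : 0 ≤ D := by linarith
  have a1 := mul_nonneg (show 0 ≤ 1 - 8 * n by linarith) h3
  have a2 := mul_nonneg hn0 hB
  have a3 : 0 ≤ n * (1 / 8 - n) * ((D + n) ^ 2 * (D - 2 * n)) := by
    apply mul_nonneg (mul_nonneg hn0 (by linarith)) (mul_nonneg (sq_nonneg _) (by linarith))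
  have a4 : 0 ≤ 8 * D * n ^ 3 * (n + D) := by positivity
  rw [hS, hT]
  linarith

/-- The normalized form of `riccati_feasible`, with `n = m - 1` and `D = M - m`. Writing `1 - X` and
`Y - 1 / 4` over a common denominator produces the polynomials `S ≥ 0` and `T`. For `T ≤ 0` the claim
is immediate. Otherwise the claim follows from `p + e ≥ 1` and a quadratic form in `(p, e)` being
nonnegative, except for `n ≤ 1 / 8` and `D ≥ 4.7 n`, where `Y / 2 ≤ 1 - X` suffices. -/
lemma quadratic_form_le_one {p e X Y n D M : ℝ} (hp : 0 ≤ p) (he : 0 ≤ e)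
    (hpe : p ^ 2 + e ^ 2 + p * e / 4 = 1) (hn : 0 ≤ n) (hD : 0 < D) (hM : M = 1 + n + D)
    (hX : X = (M + 1) * D * ((1 + n) ^ 2 - 1) / ((1 + n) ^ 2 * (n + D) ^ 2))
    (hY : Y = (6 + 2 / (1 + n)) / 8 - (1 - 1 / (1 + n) ^ 2) * M / (2 * D)) :
    X * p ^ 2 + Y * e ≤ 1 := by
  obtain ⟨S, hS⟩ : ∃ S, S = (D - n) ^ 2 + 2 * n ^ 3 + n ^ 4 + D * n ^ 3 := ⟨_, rfl⟩
  obtain ⟨T, hT⟩ : ∃ T, T = D * (3 + n) - 2 * n * (1 + n) * (2 + n) := ⟨_, rfl⟩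
  have hm : 0 < 1 + n := by linarith
  have hv : 0 < n + D := by linarith
  have hXS : 1 - X = S / ((1 + n) ^ 2 * (n + D) ^ 2) := by
    rw [hX, hS, hM]; field_simp; ring
  have hYT : Y = 1 / 4 + T / (4 * (1 + n) ^ 2 * D) := by
    rw [hY, hT, hM]; field_simp; ring
  have hS0 : 0 ≤ S := by rw [hS]; positivity
  have hX1 : 0 ≤ 1 - X := by rw [hXS]; positivity
  have hpe0 : 0 ≤ p * e := mul_nonneg hp he
  have hsum : 1 ≤ p + e := by nlinarith
  have he1 : e ≤ 1 := by nlinarith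
  have hY1 : Y ≤ 1 := by
    have : T / (4 * (1 + n) ^ 2 * D) ≤ 3 / 4 := by
      rw [div_le_iff₀ (by positivity), hT]
      have : 0 ≤ 2 * n * (1 + n) * (2 + n) := by positivity
      nlinarith [mul_nonneg hn hD.le, mul_nonneg (sq_nonneg n) hD.le]
    linarith
  have hXp : X * p ^ 2 = p ^ 2 - (1 - X) * p ^ 2 := by ring
  rcases le_or_gt T 0 with hT0 | hT0
  · have hY4 : Y ≤ 1 / 4 := by
      have := div_nonpos_of_nonpos_of_nonneg hT0 (show 0 ≤ 4 * (1 + n) ^ 2 * D by positivity)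
      linarith
    have h1 := mul_le_mul_of_nonneg_right hY4 he
    have h2 := mul_nonneg hX1 (sq_nonneg p)
    nlinarith
  have hdisc : T ^ 2 * (n + D) ^ 2 ≤ 16 * D * (3 * (1 + n) ^ 2 * D - T) * S → X * p ^ 2 + Y * e ≤ 1 := by
    intro h
    obtain ⟨Z, hZ⟩ : ∃ Z, Z = T / (4 * (1 + n) ^ 2 * D) := ⟨_, rfl⟩
    rw [← hZ] at hYT
    have hZ0 : 0 < Z := by rw [hZ]; positivity
    have hd : Z ^ 2 ≤ (1 - X) * (3 - 4 * Z) := by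
      rw [hXS, hZ]
      rw [← sub_nonneg] at h ⊢
      have : S / ((1 + n) ^ 2 * (n + D) ^ 2) * (3 - 4 * (T / (4 * (1 + n) ^ 2 * D)))
        - (T / (4 * (1 + n) ^ 2 * D)) ^ 2 =
        (16 * D * (3 * (1 + n) ^ 2 * D - T) * S - T ^ 2 * (n + D) ^ 2)
          / (16 * (1 + n) ^ 4 * D ^ 2 * (n + D) ^ 2) := by
        field_simp
        ring
      rw [this]; positivity
    have hq : 0 ≤ (1 - X) * p ^ 2 - Z * (p * e) + (3 / 4 - Z) * e ^ 2 := by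
      rcases hX1.eq_or_lt with h0 | h0
      · exfalso; rw [← h0] at hd; nlinarith
      · refine nonneg_of_mul_nonneg_right (a := 4 * (1 - X)) ?_ (by linarith)
        nlinarith [sq_nonneg (2 * (1 - X) * p - Z * e), mul_nonneg (sub_nonneg.2 hd) (sq_nonneg e)]
    have h1 : Y * e ≤ Y * (e * (e + p)) := by
      apply mul_le_mul_of_nonneg_left _ (by linarith)
      have := mul_nonneg he (sub_nonneg.2 hsum)
      linarith
    rw [hYT] at h1 ⊢
    rw [hXp]
    linarith
  rcases le_total (1 / 8) n with h8 | h8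
  · exact hdisc (discr_le_of_large h8 hS hT hT0)
  rcases le_total D (4.7 * n) with h47 | h47
  · have hn0 : 0 < n := by
      rcases hn.eq_or_lt with h | h
      · rw [← h] at h47; linarith
      · exact h
    exact hdisc (discr_le_of_mid hn0 hD h47 hS hT hT0)
  have h := half_le_of_small hn h8 h47 hS hT
  have hY0 : 0 ≤ Y := by
    have : 0 < T / (4 * (1 + n) ^ 2 * D) := by positivity
    linarith
  have hYX : Y / 2 ≤ 1 - X := by
    rw [hXS, hYT]
    rw [← sub_nonneg] at h ⊢
    have : S / ((1 + n) ^ 2 * (n + D) ^ 2) - (1 / 4 + T / (4 * (1 + n) ^ 2 * D)) / 2 =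
      (8 * D * S - ((1 + n) ^ 2 * D + T) * (n + D) ^ 2) / (8 * D * (1 + n) ^ 2 * (n + D) ^ 2) := by
      field_simp; ring
    rw [this]; positivity
  -- `e - e² = e (p² + pe/4) / (1 + e) ≤ (p² + pe/4) / 2` on the constraint curve
  have h1 : 2 * (e - e ^ 2) ≤ p ^ 2 + p * e / 4 := by linarith [sq_nonneg (1 - e)]
  have h2 := mul_le_mul_of_nonneg_left h1 hY0
  have h3 := mul_le_mul_of_nonneg_right hYX (sq_nonneg p)
  have h4 := mul_nonneg (sub_nonneg.2 hY1) (sq_nonneg e)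
  have h5 := mul_nonneg (sub_nonneg.2 hY1) hpe0
  rw [hXp]
  linarith

/-- In the variable `m`, proportional to `1 - cos θ` up to a shift and running from `1` at the window
edge to `M` at the turning point, the trial logarithmic derivative `b (1 / m - 1 / M)` is a
subsolution of the Riccati equation with potential `κ² (M - m) / (2 (M + 1))`. The value of `b` is
what makes `(v / Z, E / Z)` lie on the curve `p² + e² + p e / 4 = 1`, `Z` being the square root. -/
theorem riccati_feasible {κ M m v E b u : ℝ} (hκ : 0 < κ) (hm : 1 ≤ m) (hmM : m ≤ M) (hM1 : 1 < M)
    (hv : v = M - 1) (hE : E = 4 * (M + 1) / κ)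
    (hb : b = κ * M / (2 * √(v ^ 2 + E ^ 2 + E * v / 4))) (hu : u = 1 / m - 1 / M) :
    2 * (m ^ 2 - 1) * (b ^ 2 * u ^ 2 - b / m ^ 2) + (3 * m + 1) * (b * u) ≤
      κ ^ 2 / (2 * (M + 1)) * (M - m) := by
  have hv0 : 0 < v := by linarith
  have hE0 : 0 < E := by rw [hE]; apply div_pos _ hκ; linarith
  obtain ⟨Z, hZ⟩ : ∃ Z, Z = √(v ^ 2 + E ^ 2 + E * v / 4) := ⟨_, rfl⟩
  have hZ0 : 0 < Z := by rw [hZ]; exact Real.sqrt_pos.mpr (by positivity)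
  have hZ2 : Z ^ 2 = v ^ 2 + E ^ 2 + E * v / 4 := by rw [hZ]; exact Real.sq_sqrt (by positivity)
  rw [← hZ] at hb
  rcases hmM.eq_or_lt with h | h
  · subst h
    rw [hu, sub_self, sub_self]
    have h1 : 0 ≤ m ^ 2 - 1 := by nlinarith
    have h2 : 0 ≤ b / m ^ 2 := by rw [hb]; positivity
    nlinarith [mul_nonneg h1 h2]
  have hD : 0 < M - m := by linarith
  have hm0 : 0 < m := by linarith
  have key := quadratic_form_le_one (p := v / Z) (e := E / Z) (n := m - 1) (D := M - m) (M := M)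
    (by positivity) (by positivity)
    (by field_simp; rw [hZ2]; ring) (by linarith) hD (by ring) rfl rfl
  rw [show 1 + (m - 1) = m by ring, show m - 1 + (M - m) = v by rw [hv]; ring] at key
  have hM1' : 0 < M + 1 := by linarith
  have e : 2 * (m ^ 2 - 1) * (b ^ 2 * u ^ 2 - b / m ^ 2) + (3 * m + 1) * (b * u) =
      κ ^ 2 / (2 * (M + 1)) * (M - m) * ((M + 1) * (M - m) * (m ^ 2 - 1) / (m ^ 2 * v ^ 2) *
      (v / Z) ^ 2 + ((6 + 2 / m) / 8 - (1 - 1 / m ^ 2) * M / (2 * (M - m))) * (E / Z)) := by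
    have hM0 : 0 < M := by linarith
    rw [hb, hu, hE]
    field_simp
    ring
  rw [e]
  have : 0 ≤ κ ^ 2 / (2 * (M + 1)) * (M - m) := by positivity
  nlinarith

/-! ### Trigonometric sums and the min-max bound -/

/-- The frequencies `n - (N - 1) / 2`, symmetric about zero. -/
noncomputable def centeredFreq (N : ℕ) (n : Fin N) : ℝ := n - (N - 1) / 2

/-- The exponential of frequency `centeredFreq N n`. -/
noncomputable def expMode (N : ℕ) (n : Fin N) (x : ℝ) : ℂ :=
  Complex.exp ((2 * Real.pi * centeredFreq N n * x : ℝ) * Complex.I)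

/-- The trigonometric sum with coefficient vector `b`. -/
noncomputable def trigSum {N : ℕ} (b : EuclideanSpace ℂ (Fin N)) (x : ℝ) : ℂ := ∑ n, b n * expMode N n x

lemma continuous_expMode (N : ℕ) (n : Fin N) : Continuous (expMode N n) := by
  unfold expMode; fun_prop

lemma norm_expMode (N : ℕ) (n : Fin N) (x : ℝ) : ‖expMode N n x‖ = 1 :=
  Complex.norm_exp_ofReal_mul_I _

lemma continuous_trigSum {N : ℕ} (b : EuclideanSpace ℂ (Fin N)) : Continuous (trigSum b) := by
  unfold trigSum
  exact continuous_finsetSum _ fun n _ => continuous_const.mul (continuous_expMode N n)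

lemma trigSum_add {N : ℕ} (b b' : EuclideanSpace ℂ (Fin N)) :
    trigSum (b + b') = trigSum b + trigSum b' := by
  ext x; simp [trigSum, add_mul, Finset.sum_add_distrib]

lemma trigSum_smul {N : ℕ} (c : ℂ) (b : EuclideanSpace ℂ (Fin N)) :
    trigSum (c • b) = c • trigSum b := by
  ext x; simp [trigSum, Finset.mul_sum, mul_assoc]

/-- The Dirichlet kernel as a geometric sum. -/
lemma sin_mul_sum_exp (N : ℕ) (s : ℝ) :
    (Real.sin (Real.pi * s) : ℂ) *
      ∑ n : Fin N, Complex.exp ((2 * Real.pi * centeredFreq N n * s : ℝ) * Complex.I) =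
      Real.sin (N * Real.pi * s) := by
  have key : ∀ n ∈ Finset.range N, (Real.sin (Real.pi * s) : ℂ) *
      Complex.exp ((2 * Real.pi * ((n : ℝ) - (N - 1) / 2) * s : ℝ) * Complex.I) =
      (Complex.exp ((2 * Real.pi * ((n + 1 : ℕ) - N / 2) * s : ℝ) * Complex.I) -
        Complex.exp ((2 * Real.pi * ((n : ℕ) - N / 2) * s : ℝ) * Complex.I)) / (2 * Complex.I) := by
    intro n _
    have hI : (2 * Complex.I) ≠ 0 := by simp
    have h1 : Complex.exp ((2 * Real.pi * ((n + 1 : ℕ) - N / 2) * s : ℝ) * Complex.I) =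
        Complex.exp ((2 * Real.pi * ((n : ℝ) - (N - 1) / 2) * s : ℝ) * Complex.I) *
          Complex.exp ((Real.pi * s : ℝ) * Complex.I) := by
      rw [← Complex.exp_add]; congr 1; push_cast; ring
    have h2 : Complex.exp ((2 * Real.pi * ((n : ℕ) - N / 2) * s : ℝ) * Complex.I) =
        Complex.exp ((2 * Real.pi * ((n : ℝ) - (N - 1) / 2) * s : ℝ) * Complex.I) *
          Complex.exp (-(Real.pi * s : ℝ) * Complex.I) := by
      rw [← Complex.exp_add]; congr 1; push_cast; ring
    rw [h1, h2, ← mul_sub, eq_div_iff hI, Complex.ofReal_sin, Complex.sin]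
    generalize Complex.exp ((2 * Real.pi * ((n : ℝ) - (N - 1) / 2) * s : ℝ) * Complex.I) = w
    linear_combination (Complex.exp (-(Real.pi * s : ℝ) * Complex.I) -
      Complex.exp ((Real.pi * s : ℝ) * Complex.I)) * w * Complex.I_sq
  simp only [centeredFreq]
  rw [Fin.sum_univ_eq_sum_range (fun n : ℕ => Complex.exp
    ((2 * Real.pi * ((n : ℝ) - (N - 1) / 2) * s : ℝ) * Complex.I)) N, Finset.mul_sum,
    Finset.sum_congr rfl key, ← Finset.sum_div,
    Finset.sum_range_sub (fun n : ℕ =>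
      Complex.exp ((2 * Real.pi * ((n : ℕ) - N / 2) * s : ℝ) * Complex.I))]
  have hI : (2 * Complex.I) ≠ 0 := by simp
  rw [div_eq_iff hI, Complex.ofReal_sin, Complex.sin]
  have h1 : ((2 * Real.pi * ((N : ℕ) - N / 2) * s : ℝ) : ℂ) * Complex.I =
      ((N * Real.pi * s : ℝ) : ℂ) * Complex.I := by push_cast; ring
  have h2 : ((2 * Real.pi * ((0 : ℕ) - N / 2) * s : ℝ) : ℂ) * Complex.I =
      -((N * Real.pi * s : ℝ) : ℂ) * Complex.I := by push_cast; ring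
  rw [h1, h2]
  linear_combination (Complex.exp ((N * Real.pi * s : ℝ) * Complex.I) -
      Complex.exp (-(N * Real.pi * s : ℝ) * Complex.I)) * Complex.I_sq

lemma dpswfKernel_eq_sum (N : ℕ) (x y : ℝ) (h : Real.sin (Real.pi * (x - y)) ≠ 0) :
    (dpswfKernel N x y : ℂ) = ∑ n, expMode N n x * conj (expMode N n y) := by
  have h1 := sin_mul_sum_exp N (x - y)
  rw [dpswfKernel]
  push_cast
  push_cast at h1
  rw [div_eq_iff (by exact_mod_cast h), ← h1, mul_comm]
  congr 1
  refine Finset.sum_congr rfl fun n _ => ?_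
  rw [expMode, expMode, ← Complex.exp_conj, ← Complex.exp_add]
  congr 1
  simp only [map_mul, Complex.conj_ofReal, Complex.conj_I]
  push_cast; ring

lemma ae_sin_ne_zero (x : ℝ) : ∀ᵐ y : ℝ, Real.sin (Real.pi * (x - y)) ≠ 0 := by
  have : {y : ℝ | ¬ Real.sin (Real.pi * (x - y)) ≠ 0} ⊆ Set.range (fun n : ℤ => x - n) := by
    intro y hy
    simp only [ne_eq, not_not, Set.mem_ofPred_eq, Real.sin_eq_zero_iff] at hy
    obtain ⟨n, hn⟩ := hy
    refine ⟨n, ?_⟩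
    have : (n : ℝ) = x - y := by
      have hp := Real.pi_ne_zero
      rw [mul_comm] at hn; exact mul_left_cancel₀ hp hn
    simp only; linarith
  exact measure_mono_null this ((Set.countable_range _).measure_zero _)

/-- The inner products on `[-W, W]` of `f` with the exponentials. -/
noncomputable def windowCoeff (N : ℕ) (W : ℝ) (f : ℝ → ℂ) : EuclideanSpace ℂ (Fin N) :=
  WithLp.toLp 2 fun n => ∫ y in (-W)..W, conj (expMode N n y) * f y

lemma dpswfOperator_eq_trigSum {N : ℕ} {W : ℝ} {f : ℝ → ℂ}
    (hf : IntervalIntegrable f volume (-W) W) (x : ℝ) :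
    dpswfOperator N W f x = trigSum (windowCoeff N W f) x := by
  have hi : ∀ n : Fin N, IntervalIntegrable (fun y => conj (expMode N n y) * f y) volume (-W) W := by
    intro n
    exact hf.continuousOn_mul (Complex.continuous_conj.comp (continuous_expMode N n)).continuousOn
  rw [dpswfOperator, trigSum]
  simp only [windowCoeff]
  have h1 : ∫ y in (-W)..W, (dpswfKernel N x y : ℂ) * f y =
      ∫ y in (-W)..W, ∑ n, expMode N n x * (conj (expMode N n y) * f y) := by
    refine intervalIntegral.integral_congr_ae ?_
    filter_upwards [ae_sin_ne_zero x] with y hy _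
    rw [dpswfKernel_eq_sum N x y hy, Finset.sum_mul]
    exact Finset.sum_congr rfl fun n _ => by ring
  rw [h1, intervalIntegral.integral_finsetSum fun n _ => (hi n).const_mul _]
  refine Finset.sum_congr rfl fun n _ => ?_
  rw [intervalIntegral.integral_const_mul, mul_comm]

/-- The Gram operator of the exponentials on `[-W, W]`. -/
noncomputable def windowGram (N : ℕ) (W : ℝ) : EuclideanSpace ℂ (Fin N) →ₗ[ℂ] EuclideanSpace ℂ (Fin N) where
  toFun b := windowCoeff N W (trigSum b)
  map_add' b b' := by
    ext n
    simp only [windowCoeff, trigSum_add, Pi.add_apply, mul_add, PiLp.add_apply]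
    apply intervalIntegral.integral_add <;> apply Continuous.intervalIntegrable
    · exact (Complex.continuous_conj.comp (continuous_expMode N n)).mul (continuous_trigSum b)
    · exact (Complex.continuous_conj.comp (continuous_expMode N n)).mul (continuous_trigSum b')
  map_smul' c b := by
    ext n
    simp only [windowCoeff, trigSum_smul, Pi.smul_apply, smul_eq_mul, PiLp.smul_apply,
      RingHom.id_apply]
    rw [← intervalIntegral.integral_const_mul]
    congr 1; ext x; ring

lemma inner_windowGram {N : ℕ} (W : ℝ) (b b' : EuclideanSpace ℂ (Fin N)) :
    ⟪b, windowGram N W b'⟫_ℂ = ∫ y in (-W)..W, conj (trigSum b y) * trigSum b' y := by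
  have : ∀ y, conj (trigSum b y) * trigSum b' y =
      ∑ n, conj (b n) * (conj (expMode N n y) * trigSum b' y) := by
    intro y
    rw [trigSum, map_sum, Finset.sum_mul]
    exact Finset.sum_congr rfl fun n _ => by rw [map_mul]; ring
  simp only [this]
  rw [intervalIntegral.integral_finsetSum]
  · rw [PiLp.inner_apply]
    refine Finset.sum_congr rfl fun n _ => ?_
    rw [intervalIntegral.integral_const_mul, RCLike.inner_apply, mul_comm]
    rfl
  · intro n _
    apply Continuous.intervalIntegrable
    exact continuous_const.mul
      ((Complex.continuous_conj.comp (continuous_expMode N n)).mul (continuous_trigSum b'))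

lemma windowGram_isSymmetric (N : ℕ) (W : ℝ) : (windowGram N W).IsSymmetric := by
  intro b b'
  rw [← inner_conj_symm, inner_windowGram, inner_windowGram, intervalIntegral, intervalIntegral,
    map_sub, ← integral_conj, ← integral_conj]
  simp [mul_comm]

lemma re_inner_windowGram_self {N : ℕ} (W : ℝ) (b : EuclideanSpace ℂ (Fin N)) :
    RCLike.re ⟪windowGram N W b, b⟫_ℂ = ∫ y in (-W)..W, ‖trigSum b y‖ ^ 2 := by
  rw [windowGram_isSymmetric, inner_windowGram]
  have : ∀ y, conj (trigSum b y) * trigSum b y = ((‖trigSum b y‖ ^ 2 : ℝ) : ℂ) := by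
    intro y; rw [mul_comm, Complex.mul_conj, Complex.normSq_eq_norm_sq]
  simp only [this, intervalIntegral.integral_ofReal]
  exact Complex.ofReal_re _

/-- On the span of eigenvectors with eigenvalues at least `μ`, the quadratic form is bounded below by
`μ`. The eigenvectors need not be orthogonal. -/
lemma LinearMap.IsSymmetric.mul_norm_sq_le_re_inner_of_mem_span {𝕜 E ι : Type*}
    [RCLike 𝕜] [NormedAddCommGroup E] [InnerProductSpace 𝕜 E] [FiniteDimensional 𝕜 E] {T : E →ₗ[𝕜] E}
    (hT : T.IsSymmetric) {ν : ι → ℝ} {b : ι → E} (hb : ∀ i, T (b i) = (ν i : 𝕜) • b i) {μ : ℝ}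
    (hμ : ∀ i, μ ≤ ν i) {x : E} (hx : x ∈ Submodule.span 𝕜 (Set.range b)) :
    μ * ‖x‖ ^ 2 ≤ RCLike.re ⟪T x, x⟫_𝕜 := by
  set u := hT.eigenvectorBasis rfl with hu
  set l := hT.eigenvalues rfl with hl
  have hTu : ∀ j, T (u j) = (l j : 𝕜) • u j := fun j => hT.apply_eigenvectorBasis rfl j
  have hz : ∀ j, l j < μ → ⟪u j, x⟫_𝕜 = 0 := by
    intro j hj
    induction hx using Submodule.span_induction with
    | mem y hy =>
      obtain ⟨i, rfl⟩ := hy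
      have h := hT (u j) (b i)
      rw [hTu, hb, inner_smul_left, inner_smul_right, RCLike.conj_ofReal, ← sub_eq_zero,
        ← sub_mul, mul_eq_zero] at h
      refine h.resolve_left ?_
      have := hμ i
      rw [← RCLike.ofReal_sub]
      exact RCLike.ofReal_ne_zero.mpr (by linarith)
    | zero => simp
    | add y z _ _ hy hz => rw [inner_add_right, hy, hz, add_zero]
    | smul c y _ hy => rw [inner_smul_right, hy, mul_zero]
  have h1 : ‖x‖ ^ 2 = ∑ j, ‖⟪u j, x⟫_𝕜‖ ^ 2 := (u.sum_sq_norm_inner_right x).symm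
  have h2 : RCLike.re ⟪T x, x⟫_𝕜 = ∑ j, l j * ‖⟪u j, x⟫_𝕜‖ ^ 2 := by
    rw [← u.sum_inner_mul_inner, map_sum]
    refine Finset.sum_congr rfl fun j _ => ?_
    rw [hT, hTu, inner_smul_right, mul_assoc, ← inner_conj_symm x (u j), mul_comm (conj _),
      RCLike.mul_conj, ← RCLike.ofReal_pow]
    exact (RCLike.re_ofReal_mul _ _).trans (by rw [RCLike.ofReal_re])
  rw [h1, h2, Finset.mul_sum]
  refine Finset.sum_le_sum fun j _ => ?_
  rcases lt_or_ge (l j) μ with h | h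
  · simp [hz j h]
  · gcongr

lemma memLp_trigSum {N : ℕ} (b : EuclideanSpace ℂ (Fin N)) :
    MemLp (trigSum b) 2 (volume.restrict (Set.Ioo (-1 / 2 : ℝ) (1 / 2))) := by
  refine MemLp.of_bound (continuous_trigSum b).aestronglyMeasurable (∑ n, ‖b n‖) ?_
  filter_upwards with x
  refine (norm_sum_le _ _).trans (Finset.sum_le_sum fun n _ => ?_)
  rw [norm_mul, norm_expMode, mul_one]

/-- The trigonometric sum as an element of `L²(-1/2, 1/2)`. -/
noncomputable def trigSumLp (N : ℕ) : EuclideanSpace ℂ (Fin N) →ₗ[ℂ] L2Half where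
  toFun b := (memLp_trigSum b).toLp (trigSum b)
  map_add' b b' := by
    rw [← MemLp.toLp_add]; congr 1; exact trigSum_add b b'
  map_smul' c b := by
    rw [RingHom.id_apply, ← MemLp.toLp_const_smul]; congr 1; exact trigSum_smul c b

/-- The min-max upper bound. Eigenfunctions of `Q` with nonzero eigenvalue are trigonometric sums
whose coefficients are eigenvectors of `windowGram`; `k + 1` of them span a space that meets `V`. -/
theorem dpswfEigenvalue_le {N k : ℕ} {W B : ℝ} (hW : 0 < W) (hW2 : W ≤ 1 / 2)
    (V : Submodule ℂ (EuclideanSpace ℂ (Fin N))) (hV : N ≤ Module.finrank ℂ V + k) (hB : 0 ≤ B)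
    (h : ∀ b ∈ V, ∫ x in (-W)..W, ‖trigSum b x‖ ^ 2 ≤ B * ‖b‖ ^ 2) :
    dpswfEigenvalue N W k ≤ B := by
  refine Real.sSup_le ?_ hB
  rintro μ ⟨ν, f, hf, hμ⟩
  by_contra! hμB
  have hν : ∀ i, (ν i : ℂ) ≠ 0 := fun i => by
    have := (hμ i).1; rw [Complex.ofReal_ne_zero]; linarith
  have hint : ∀ i, IntervalIntegrable (f i) volume (-W) W := by
    intro i
    rw [intervalIntegrable_iff_integrableOn_Ioo_of_le (by linarith)]
    have := (Lp.memLp (f i)).integrable (by norm_num)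
    exact IntegrableOn.mono_set this (Set.Ioo_subset_Ioo (by linarith) hW2)
  set b : Fin (k + 1) → EuclideanSpace ℂ (Fin N) :=
    fun i => (ν i : ℂ)⁻¹ • windowCoeff N W (f i) with hb
  have hfb : ∀ i, (f i : ℝ → ℂ) =ᵐ[volume.restrict (Set.Ioo (-1 / 2 : ℝ) (1 / 2))] trigSum (b i) := by
    intro i
    filter_upwards [(hμ i).2] with x hx
    rw [dpswfOperator_eq_trigSum (hint i)] at hx
    rw [hb]
    simp only
    rw [trigSum_smul, Pi.smul_apply, hx, smul_eq_mul, inv_mul_cancel_left₀ (hν i)]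
  have hΦ : ∀ i, trigSumLp N (b i) = f i := by
    intro i
    exact Lp.ext ((MemLp.coeFn_toLp (memLp_trigSum (b i))).trans (hfb i).symm)
  have hind : LinearIndependent ℂ b := by
    refine LinearIndependent.of_comp (trigSumLp N) ?_
    convert hf using 1
    ext1 i; exact hΦ i
  have hG : ∀ i, windowGram N W (b i) = (ν i : ℂ) • b i := by
    intro i
    have h1 : windowGram N W (b i) = windowCoeff N W (f i) := by
      ext n
      refine intervalIntegral.integral_congr_ae ?_
      have := (ae_restrict_iff' measurableSet_Ioo).mp (hfb i)
      have hne : ∀ᵐ y : ℝ, y ≠ 1 / 2 := by simp [ae_iff]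
      filter_upwards [this, hne] with y hy hy2 hyW
      rw [Set.uIoc_of_le (by linarith)] at hyW
      rw [hy ⟨by linarith [hyW.1], lt_of_le_of_ne (hyW.2.trans hW2) hy2⟩]
    rw [h1, hb]; simp only
    rw [smul_inv_smul₀ (hν i)]
  set S := Submodule.span ℂ (Set.range b) with hS
  have hSr : Module.finrank ℂ S = k + 1 := by
    rw [hS, finrank_span_eq_card hind, Fintype.card_fin]
  have hne : S ⊓ V ≠ ⊥ := by
    intro hbot
    have h1 := Submodule.finrank_sup_add_finrank_inf_eq S V
    have h2 : Module.finrank ℂ ↥(S ⊔ V) ≤ N := by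
      have := Submodule.finrank_le (S ⊔ V)
      rwa [finrank_euclideanSpace, Fintype.card_fin] at this
    rw [hbot, finrank_bot] at h1
    omega
  obtain ⟨x, hx, hx0⟩ := Submodule.exists_mem_ne_zero_of_ne_bot hne
  have h1 := (windowGram_isSymmetric N W).mul_norm_sq_le_re_inner_of_mem_span hG
    (fun i => (hμ i).1) hx.1
  rw [re_inner_windowGram_self] at h1
  have h2 := h x hx.2
  have h3 : 0 < ‖x‖ ^ 2 := by have := norm_pos_iff.mpr hx0; positivity
  nlinarith

/-! ### Trigonometric sums vanishing at Chebyshev nodes -/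

/-- Iterated Rolle: `n + 1` zeros of `F j` give a zero of its `n`-th derivative `F (j + n)`. -/
lemma exists_zero_of_strictMono_zeros {F : ℕ → ℝ → ℝ}
    (hF : ∀ j x, HasDerivAt (F j) (F (j + 1) x) x) (n : ℕ) :
    ∀ (j : ℕ) (x : Fin (n + 1) → ℝ), StrictMono x → (∀ i, F j (x i) = 0) → ∃ ξ, F (j + n) ξ = 0 := by
  induction n with
  | zero => exact fun j x _ h => ⟨x 0, h 0⟩
  | succ n ih =>
    intro j x hx h
    have hr : ∀ i : Fin (n + 1), ∃ y ∈ Set.Ioo (x i.castSucc) (x i.succ), F (j + 1) y = 0 := by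
      intro i
      obtain ⟨y, hy, hy0⟩ := exists_hasDerivAt_eq_zero (hx (Fin.castSucc_lt_succ (i := i)))
        (fun z _ => (hF j z).continuousAt.continuousWithinAt) ((h _).trans (h _).symm)
        (fun z _ => hF j z)
      exact ⟨y, hy, hy0⟩
    choose y hy hy0 using hr
    have hmono : StrictMono y := by
      intro a b hab
      calc y a < x a.succ := (hy a).2
        _ ≤ x b.castSucc := hx.monotone (by
          rw [Fin.le_def]; simpa using hab)
        _ < y b := (hy b).1
    obtain ⟨ξ, hξ⟩ := ih (j + 1) y hmono hy0
    exact ⟨ξ, by rw [← hξ]; congr 1; omega⟩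

lemma eval_iterate_derivative_of_natDegree_eq {P : Polynomial ℝ} {k : ℕ} (hP : P.natDegree = k)
    (x : ℝ) : (Polynomial.derivative^[k] P).eval x = k.factorial * P.leadingCoeff := by
  have h : (Polynomial.derivative^[k] P).natDegree ≤ 0 := by
    have := Polynomial.natDegree_iterate_derivative P k
    omega
  rw [Polynomial.eq_C_of_natDegree_le_zero h, Polynomial.eval_C, Polynomial.coeff_iterate_derivative,
    zero_add, Nat.descFactorial_self, nsmul_eq_mul, Polynomial.leadingCoeff, hP]

/-- The interpolation error formula: a function `F 0` vanishing at the `k` simple zeros of `P` is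
bounded by `P` times the supremum of its `k`-th derivative `F k`. -/
lemma abs_mul_le_of_zeros {F : ℕ → ℝ → ℝ} (hF : ∀ j x, HasDerivAt (F j) (F (j + 1) x) x)
    {P : Polynomial ℝ} {k : ℕ} (hP : P.natDegree = k) (hP0 : P.leadingCoeff ≠ 0)
    (hcard : P.roots.toFinset.card = k) (hz : ∀ t, P.eval t = 0 → F 0 t = 0) {A : ℝ}
    (hA : ∀ x, |F k x| ≤ A) (x : ℝ) :
    |F 0 x| * (k.factorial * |P.leadingCoeff|) ≤ A * |P.eval x| := by
  by_cases hx : P.eval x = 0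
  · rw [hx, hz x hx]; simp
  set c := F 0 x / P.eval x with hc
  set G : ℕ → ℝ → ℝ := fun j y => F j y - c * (Polynomial.derivative^[j] P).eval y with hG
  have hGd : ∀ j y, HasDerivAt (G j) (G (j + 1) y) y := by
    intro j y
    have := (hF j y).sub (((Polynomial.derivative^[j] P).hasDerivAt y).const_mul c)
    rw [hG]
    simp only [Function.iterate_succ_apply']
    exact this
  have hPne : P ≠ 0 := by rintro rfl; simp at hx
  have hmem : x ∉ P.roots.toFinset := by
    rw [Multiset.mem_toFinset, Polynomial.mem_roots hPne]; exact hx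
  have hcard' : (insert x P.roots.toFinset).card = k + 1 := by
    rw [Finset.card_insert_of_notMem hmem, hcard]
  obtain ⟨ξ, hξ⟩ := exists_zero_of_strictMono_zeros hGd k 0
    ((insert x P.roots.toFinset).orderEmbOfFin hcard') (OrderEmbedding.strictMono _) (by
      intro i
      have hi := (insert x P.roots.toFinset).orderEmbOfFin_mem hcard' i
      generalize (insert x P.roots.toFinset).orderEmbOfFin hcard' i = y at hi
      rcases Finset.mem_insert.mp hi with rfl | hi
      · simp only [hG, Function.iterate_zero, id]
        rw [hc, div_mul_cancel₀ _ hx, sub_self]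
      · rw [Multiset.mem_toFinset, Polynomial.mem_roots hPne] at hi
        have hi' : P.eval y = 0 := hi
        simp [hG, hi', hz y hi'])
  rw [zero_add] at hξ
  simp only [hG] at hξ
  rw [eval_iterate_derivative_of_natDegree_eq hP, sub_eq_zero] at hξ
  have h1 := hA ξ
  rw [hξ, hc, abs_mul, abs_div, abs_mul, Nat.abs_cast, div_mul_eq_mul_div,
    div_le_iff₀ (abs_pos.mpr hx)] at h1
  exact h1

/-- The first inequality makes power sums telescope; the second carries the induction. -/
lemma sub_pow_ge (a : ℝ) (k : ℕ) :
    2 * (2 * k + 1) * a ^ (2 * k) ≤ (a + 1) ^ (2 * k + 1) - (a - 1) ^ (2 * k + 1) ∧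
      2 * a ^ (2 * k + 2) ≤ a * ((a + 1) ^ (2 * k + 1) + (a - 1) ^ (2 * k + 1)) := by
  induction k with
  | zero => constructor <;> simp <;> nlinarith
  | succ k ih =>
    obtain ⟨h1, h2⟩ := ih
    have e1 : ∀ y : ℝ, y ^ (2 * (k + 1) + 1) = y ^ 2 * y ^ (2 * k + 1) := fun y => by ring
    have e2 : a ^ (2 * (k + 1)) = a ^ 2 * a ^ (2 * k) := by ring
    have e3 : a ^ (2 * (k + 1) + 2) = a ^ 2 * a ^ (2 * k + 2) := by ring
    have e4 : a ^ (2 * k + 2) = a ^ 2 * a ^ (2 * k) := by ring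
    have hp : 0 ≤ a ^ (2 * k) := by rw [pow_mul]; positivity
    rw [e1, e1, e2, e3]
    rw [e4] at h2 ⊢
    generalize (a + 1) ^ (2 * k + 1) = u at *
    generalize (a - 1) ^ (2 * k + 1) = w at *
    generalize a ^ (2 * k) = q at *
    have hq : 0 ≤ (2 * (2 * (k : ℝ) + 1)) * q := by positivity
    have h3 := mul_le_mul_of_nonneg_left h1 (show 0 ≤ a ^ 2 by positivity)
    have h4 := mul_le_mul_of_nonneg_left h2 (show 0 ≤ a ^ 2 by positivity)
    have h5 : 0 ≤ u - w := hq.trans h1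
    have h6 : 0 ≤ a * (u + w) := by refine le_trans ?_ h2; positivity
    push_cast
    constructor
    · nlinarith
    · nlinarith [mul_nonneg (sq_nonneg a) h5]

lemma sum_centeredFreq_pow_le (N k : ℕ) :
    ∑ n : Fin N, (2 * centeredFreq N n) ^ (2 * k) ≤ (N : ℝ) ^ (2 * k + 1) / (2 * k + 1) := by
  rw [le_div_iff₀ (by positivity)]
  have h : ∑ n : Fin N, 2 * (2 * (k : ℝ) + 1) * (2 * centeredFreq N n) ^ (2 * k) ≤
      ∑ n : Fin N, ((2 * ((n : ℕ) + 1 : ℕ) - N : ℝ) ^ (2 * k + 1) - (2 * (n : ℕ) - N : ℝ) ^ (2 * k + 1)) := by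
    refine Finset.sum_le_sum fun n _ => ?_
    have := (sub_pow_ge (2 * centeredFreq N n) k).1
    refine this.trans (le_of_eq ?_)
    rw [centeredFreq]; push_cast
    congr 2 <;> ring
  rw [Fin.sum_univ_eq_sum_range (fun n : ℕ => ((2 * (n + 1 : ℕ) - N : ℝ) ^ (2 * k + 1)
      - (2 * n - N : ℝ) ^ (2 * k + 1))) N,
    Finset.sum_range_sub (fun n : ℕ => (2 * (n : ℝ) - N : ℝ) ^ (2 * k + 1)), ← Finset.mul_sum] at h
  have e : (2 * (N : ℝ) - N) ^ (2 * k + 1) - (2 * ((0 : ℕ) : ℝ) - N) ^ (2 * k + 1)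
      = 2 * (N : ℝ) ^ (2 * k + 1) := by
    have : (2 * ((0 : ℕ) : ℝ) - N) = -N := by push_cast; ring
    rw [this, Odd.neg_pow ⟨k, rfl⟩]; ring
  rw [e] at h
  linarith

/-- The `j`-th derivative of `trigSum b`. -/
noncomputable def trigDeriv {N : ℕ} (b : EuclideanSpace ℂ (Fin N)) (j : ℕ) (x : ℝ) : ℂ :=
  ∑ n, b n * ((2 * Real.pi * centeredFreq N n : ℝ) * Complex.I) ^ j * expMode N n x

lemma trigDeriv_zero {N : ℕ} (b : EuclideanSpace ℂ (Fin N)) : trigDeriv b 0 = trigSum b := by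
  ext x; simp [trigDeriv, trigSum]

lemma hasDerivAt_expMode (N : ℕ) (n : Fin N) (x : ℝ) : HasDerivAt (expMode N n)
    (((2 * Real.pi * centeredFreq N n : ℝ) * Complex.I) * expMode N n x) x := by
  unfold expMode
  have h : HasDerivAt (fun x : ℝ => ((2 * Real.pi * centeredFreq N n * x : ℝ) : ℂ) * Complex.I)
      ((2 * Real.pi * centeredFreq N n : ℝ) * Complex.I) x := by
    have := (((hasDerivAt_id' x).const_mul (2 * Real.pi * centeredFreq N n)).ofReal_comp).mul_const
      Complex.I
    simpa using this
  convert h.cexp using 1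
  rw [mul_comm]

lemma hasDerivAt_trigDeriv {N : ℕ} (b : EuclideanSpace ℂ (Fin N)) (j : ℕ) (x : ℝ) :
    HasDerivAt (trigDeriv b j) (trigDeriv b (j + 1) x) x := by
  unfold trigDeriv
  refine HasDerivAt.fun_sum fun n _ => ?_
  refine ((hasDerivAt_expMode N n x).const_mul _).congr_deriv ?_
  rw [pow_succ]; ring

lemma sq_norm_trigDeriv_le {N : ℕ} (b : EuclideanSpace ℂ (Fin N)) (k : ℕ) (x : ℝ) :
    ‖trigDeriv b k x‖ ^ 2 ≤
      ‖b‖ ^ 2 * (Real.pi ^ (2 * k) * ((N : ℝ) ^ (2 * k + 1) / (2 * k + 1))) := by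
  have h1 : ‖trigDeriv b k x‖ ≤ ∑ n, ‖b n‖ * |Real.pi * (2 * centeredFreq N n)| ^ k := by
    refine (norm_sum_le _ _).trans (Finset.sum_le_sum fun n _ => le_of_eq ?_)
    rw [norm_mul, norm_mul, norm_expMode, mul_one, norm_pow, norm_mul, Complex.norm_I, mul_one,
      Complex.norm_real, Real.norm_eq_abs, mul_assoc, mul_left_comm]
  calc ‖trigDeriv b k x‖ ^ 2 ≤ (∑ n, ‖b n‖ * |Real.pi * (2 * centeredFreq N n)| ^ k) ^ 2 := by gcongr
    _ ≤ (∑ n, ‖b n‖ ^ 2) * ∑ n, (|Real.pi * (2 * centeredFreq N n)| ^ k) ^ 2 :=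
      Finset.sum_mul_sq_le_sq_mul_sq _ _ _
    _ = ‖b‖ ^ 2 * (Real.pi ^ (2 * k) * ∑ n, (2 * centeredFreq N n) ^ (2 * k)) := by
      rw [EuclideanSpace.norm_sq_eq, Finset.mul_sum (f := fun n => (2 * centeredFreq N n) ^ (2 * k))]
      refine congrArg _ (Finset.sum_congr rfl fun n _ => ?_)
      rw [← pow_mul, mul_comm k 2, pow_mul, sq_abs, ← pow_mul, mul_pow]
    _ ≤ _ := by
      gcongr
      exact sum_centeredFreq_pow_le N k

lemma sq_norm_trigSum_le_of_zeros {N k : ℕ} (hk : 1 ≤ k) {W : ℝ} (hW : 0 < W)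
    (b : EuclideanSpace ℂ (Fin N))
    (hb : ∀ t : ℝ, (Polynomial.Chebyshev.T ℝ k).eval t = 0 → trigSum b (W * t) = 0) {x : ℝ}
    (hx : |x| ≤ W) :
    ‖trigSum b x‖ ^ 2 ≤ 4 * (N / (2 * k + 1)) * (Real.pi * N * W / 2) ^ (2 * k)
      / (k.factorial : ℝ) ^ 2 * ‖b‖ ^ 2 := by
  obtain ⟨A, hA⟩ : ∃ A, A = W ^ k * √(‖b‖ ^ 2 * (Real.pi ^ (2 * k) * ((N : ℝ) ^ (2 * k + 1) / (2 * k + 1)))) :=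
    ⟨_, rfl⟩
  -- a unimodular factor turning `trigSum b x` into its norm
  obtain ⟨ω, hω, hωx⟩ : ∃ ω : ℂ, ‖ω‖ = 1 ∧ ω * trigSum b x = ‖trigSum b x‖ := by
    obtain ⟨θ, hθ⟩ : ∃ θ, θ = Complex.arg (trigSum b x) := ⟨_, rfl⟩
    refine ⟨Complex.exp ((-θ : ℝ) * Complex.I), Complex.norm_exp_ofReal_mul_I _, ?_⟩
    conv_lhs => rw [← Complex.norm_mul_exp_arg_mul_I (trigSum b x), ← hθ]
    rw [mul_left_comm, ← Complex.exp_add]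
    push_cast
    rw [neg_mul, neg_add_cancel, Complex.exp_zero, mul_one]
  have hF : ∀ j y, HasDerivAt (fun y => W ^ j * (ω * trigDeriv b j (W * y)).re)
      (W ^ (j + 1) * (ω * trigDeriv b (j + 1) (W * y)).re) y := by
    intro j y
    have h1 : HasDerivAt (fun y => trigDeriv b j (W * y)) (W • trigDeriv b (j + 1) (W * y)) y := by
      have := (hasDerivAt_trigDeriv b j (W * y)).scomp y ((hasDerivAt_id' y).const_mul W)
      rw [mul_one] at this
      exact this
    have h2 := (Complex.reCLM.hasFDerivAt.comp_hasDerivAt y (h1.const_mul ω)).const_mul (W ^ j)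
    refine h2.congr_deriv ?_
    change W ^ j * (ω * (W • trigDeriv b (j + 1) (W * y))).re = _
    rw [Complex.real_smul, mul_left_comm, Complex.re_ofReal_mul, pow_succ, mul_assoc]
  have hbd : ∀ y, |W ^ k * (ω * trigDeriv b k (W * y)).re| ≤ A := by
    intro y
    rw [abs_mul, abs_of_nonneg (by positivity : 0 ≤ W ^ k), hA]
    gcongr
    refine (Complex.abs_re_le_norm _).trans ?_
    rw [norm_mul, hω, one_mul]
    exact Real.le_sqrt_of_sq_le (sq_norm_trigDeriv_le b k _)
  have hroots : (Polynomial.Chebyshev.T ℝ k).roots.toFinset.card = k := by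
    have hnd := Polynomial.Chebyshev.roots_T_real_nodup k
    rw [Polynomial.Chebyshev.roots_T_real, Finset.val_toFinset, Finset.card_image_of_injOn,
      Finset.card_range]
    exact (Finset.range k).nodup_map_iff_injOn.mp hnd
  have key := abs_mul_le_of_zeros hF (P := Polynomial.Chebyshev.T ℝ k) (k := k) (by simp)
    (by simp) hroots (by
      intro t ht
      simp [trigDeriv_zero, hb t ht]) hbd (x / W)
  have hT : |(Polynomial.Chebyshev.T ℝ k).eval (x / W)| ≤ 1 :=
    Polynomial.Chebyshev.abs_eval_T_real_le_one _ (by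
      rw [abs_div, abs_of_pos hW, div_le_one hW]; exact hx)
  have hA0 : 0 ≤ A := by rw [hA]; positivity
  rw [mul_div_cancel₀ _ hW.ne', trigDeriv_zero, hωx, pow_zero, one_mul, Complex.ofReal_re,
    abs_of_nonneg (norm_nonneg _), Polynomial.Chebyshev.leadingCoeff_T, Int.natAbs_natCast,
    abs_of_nonneg (by positivity)] at key
  have h1 : ‖trigSum b x‖ * (k.factorial * 2 ^ (k - 1)) ≤ A := key.trans (by nlinarith)
  have h2 : ‖trigSum b x‖ ≤ 2 * A / (k.factorial * 2 ^ k) := by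
    rw [le_div_iff₀ (by positivity)]
    have : (2 : ℝ) ^ k = 2 * 2 ^ (k - 1) := by rw [← pow_succ']; congr 1; omega
    rw [this]; linarith
  calc ‖trigSum b x‖ ^ 2 ≤ (2 * A / (k.factorial * 2 ^ k)) ^ 2 := by gcongr
    _ = _ := by
      rw [div_pow, mul_pow, hA, mul_pow, Real.sq_sqrt (by positivity)]
      have e1 : (Real.pi * N * W / 2) ^ (2 * k) = Real.pi ^ (2 * k) * (N : ℝ) ^ (2 * k) * (W ^ k) ^ 2 / (2 ^ k) ^ 2 := by
        rw [div_pow, mul_pow, mul_pow, ← pow_mul, ← pow_mul, mul_comm k 2]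
      rw [e1, pow_succ (N : ℝ) (2 * k)]
      field_simp
      ring

/-- `dpswfEigenvalue_le` for the trigonometric sums vanishing at the Chebyshev nodes of `[-W, W]`. -/
theorem dpswfEigenvalue_le_chebyshev {N k : ℕ} {W : ℝ} (hk : 1 ≤ k) (hW : 0 < W)
    (hW2 : W ≤ 1 / 2) :
    dpswfEigenvalue N W k ≤ 8 * (N * W) / (2 * k + 1) * (Real.pi * N * W / 2) ^ (2 * k)
      / (k.factorial : ℝ) ^ 2 := by
  let L : EuclideanSpace ℂ (Fin N) →ₗ[ℂ] (Fin k → ℂ) :=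
    { toFun := fun b j => trigSum b (W * Real.cos ((2 * (j : ℕ) + 1) * Real.pi / (2 * k)))
      map_add' := fun b b' => by ext j; simp [trigSum_add]
      map_smul' := fun c b => by ext j; simp [trigSum_smul] }
  refine dpswfEigenvalue_le hW hW2 (LinearMap.ker L) ?_ (by positivity) ?_
  · have h1 := L.finrank_range_add_finrank_ker
    have h2 := Submodule.finrank_le (LinearMap.range L)
    rw [finrank_euclideanSpace, Fintype.card_fin] at h1
    rw [Module.finrank_fin_fun] at h2
    omega
  · intro b hb
    have hz : ∀ t : ℝ, (Polynomial.Chebyshev.T ℝ k).eval t = 0 → trigSum b (W * t) = 0 := by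
      intro t ht
      have hT0 : Polynomial.Chebyshev.T ℝ (k : ℤ) ≠ 0 := by
        rw [← Polynomial.leadingCoeff_ne_zero]; simp
      have hr : t ∈ (Polynomial.Chebyshev.T ℝ k).roots := (Polynomial.mem_roots hT0).mpr ht
      rw [Polynomial.Chebyshev.roots_T_real, Finset.mem_val, Finset.mem_image] at hr
      obtain ⟨j, hj, rfl⟩ := hr
      exact congrFun (LinearMap.mem_ker.mp hb) ⟨j, Finset.mem_range.mp hj⟩
    have hint : ∫ x in (-W)..W, ‖trigSum b x‖ ^ 2 ≤
        ∫ x in (-W)..W, 4 * (N / (2 * k + 1)) * (Real.pi * N * W / 2) ^ (2 * k)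
      / (k.factorial : ℝ) ^ 2 * ‖b‖ ^ 2 := by
      refine intervalIntegral.integral_mono_on (by linarith)
        (Continuous.intervalIntegrable (by have := continuous_trigSum b; fun_prop) _ _)
        (by simp) ?_
      intro x hx
      exact sq_norm_trigSum_le_of_zeros hk hW b hz (abs_le.mpr hx)
    refine hint.trans (le_of_eq ?_)
    rw [intervalIntegral.integral_const, smul_eq_mul]
    ring

/-! ### Bounds through Stirling's formula -/

lemma dpswfEigenvalue_le_stirling {N k : ℕ} {W : ℝ} (hk : 1 ≤ k) (hW : 0 < W) (hW2 : W ≤ 1 / 2) :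
    dpswfEigenvalue N W k ≤ 4 * (N * W) / (Real.pi * k * (2 * k + 1)) *
      (Real.exp 1 * Real.pi * (N * W) / (2 * k)) ^ (2 * k) := by
  refine (dpswfEigenvalue_le_chebyshev hk hW hW2).trans ?_
  have hp := Real.pi_pos
  have hk0 : (0 : ℝ) < k := by exact_mod_cast hk
  have hs := Stirling.le_factorial_stirling k
  have h1 : 2 * Real.pi * k * ((k / Real.exp 1) ^ (2 * k)) ≤ (k.factorial : ℝ) ^ 2 := by
    calc 2 * Real.pi * k * ((k / Real.exp 1) ^ (2 * k))
        = (√(2 * Real.pi * k) * (k / Real.exp 1) ^ k) ^ 2 := by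
          rw [mul_pow, Real.sq_sqrt (by positivity), ← pow_mul, mul_comm k 2]
      _ ≤ _ := by gcongr
  calc 8 * (N * W) / (2 * k + 1) * (Real.pi * N * W / 2) ^ (2 * k) / (k.factorial : ℝ) ^ 2
      ≤ 8 * (N * W) / (2 * k + 1) * (Real.pi * N * W / 2) ^ (2 * k) /
        (2 * Real.pi * k * ((k / Real.exp 1) ^ (2 * k))) := by gcongr
    _ = _ := by
      have : Real.exp 1 * Real.pi * (N * W) / (2 * k) = (Real.pi * N * W / 2) / (k / Real.exp 1) := by
        field_simp
      rw [this, div_pow (Real.pi * N * W / 2)]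
      field_simp
      ring

lemma one_add_div_pow_le_exp {a : ℝ} (ha : 0 ≤ a) {k : ℕ} (hk : 1 ≤ k) :
    (1 + a / k) ^ (2 * k) ≤ Real.exp (2 * a) := by
  have hk0 : (0 : ℝ) < k := by exact_mod_cast hk
  have h : 1 + a / k ≤ Real.exp (a / k) := by rw [add_comm]; exact Real.add_one_le_exp _
  calc (1 + a / k) ^ (2 * k) ≤ Real.exp (a / k) ^ (2 * k) := by gcongr
    _ = Real.exp (2 * a) := by
      rw [← Real.exp_nat_mul]; congr 1; push_cast; field_simp

/-- The base of the power is lowered from `1 / (2 k)` to `1 / (2 (k + s))` at the cost of `exp (2 s)`. -/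
lemma dpswfEigenvalue_le_of_mul_exp_le {N k : ℕ} {W s : ℝ} (hk : 1 ≤ k) (hW : 0 < W)
    (hW2 : W ≤ 1 / 2) (hs : 0 ≤ s) :
    dpswfEigenvalue N W k ≤ 4 * (N * W) * Real.exp (2 * s) / (Real.pi * k * (2 * k + 1)) *
      (Real.exp 1 * Real.pi * (N * W) / (2 * (k + s))) ^ (2 * k) := by
  refine (dpswfEigenvalue_le_stirling hk hW hW2).trans ?_
  have hp := Real.pi_pos
  have hk0 : (0 : ℝ) < k := by exact_mod_cast hk
  have e : Real.exp 1 * Real.pi * (N * W) / (2 * k) =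
      Real.exp 1 * Real.pi * (N * W) / (2 * (k + s)) * (1 + s / k) := by field_simp
  rw [e, mul_pow]
  have h := one_add_div_pow_le_exp hs hk
  calc _ ≤ 4 * (N * W) / (Real.pi * k * (2 * k + 1)) *
      ((Real.exp 1 * Real.pi * (N * W) / (2 * (k + s))) ^ (2 * k) * Real.exp (2 * s)) := by gcongr
    _ = _ := by ring

lemma exp_mul_pi_bounds : 8.5394 < Real.exp 1 * Real.pi ∧ Real.exp 1 * Real.pi < 8.54 := by
  have hp1 := Real.pi_gt_d4
  have hp2 := Real.pi_lt_d4
  have he := Real.exp_one_gt_d9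
  have he2 := Real.exp_one_lt_d9
  constructor <;> nlinarith

/-- The Chebyshev bound with `s = 1`. -/
theorem dpswfEigenvalue_le_exp_neg_log {N k : ℕ} {W : ℝ} (hk : 1 ≤ k) (hN : 1 ≤ N) (hW : 0 < W)
    (hW2 : W ≤ 1 / 2) :
    dpswfEigenvalue N W k ≤ 2 * Real.exp (-(2 * (k : ℝ) + 1) *
      Real.log (2 * ((k : ℝ) + 1) / (Real.exp 1 * Real.pi * N * W))) := by
  refine (dpswfEigenvalue_le_of_mul_exp_le hk hW hW2 zero_le_one).trans ?_
  have hp := Real.pi_pos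
  have hk1 : (1 : ℝ) ≤ k := by exact_mod_cast hk
  have hN0 : (0 : ℝ) < N := by exact_mod_cast hN
  have hexp : Real.exp (-(2 * (k : ℝ) + 1) *
      Real.log (2 * ((k : ℝ) + 1) / (Real.exp 1 * Real.pi * N * W))) =
      (Real.exp 1 * Real.pi * (N * W) / (2 * ((k : ℝ) + 1))) ^ (2 * k + 1) := by
    have hb : (0 : ℝ) < Real.exp 1 * Real.pi * (N * W) / (2 * ((k : ℝ) + 1)) := by positivity
    have e : 2 * ((k : ℝ) + 1) / (Real.exp 1 * Real.pi * N * W) =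
        (Real.exp 1 * Real.pi * (N * W) / (2 * (k + 1)))⁻¹ := by
      rw [inv_div]; congr 1; ring
    rw [e, Real.log_inv, neg_mul_neg]
    conv_rhs => rw [← Real.exp_log hb, ← Real.exp_nat_mul]
    push_cast; rfl
  rw [hexp, pow_succ', ← mul_assoc (2 : ℝ) (Real.exp 1 * Real.pi * (N * W) / _)]
  refine mul_le_mul_of_nonneg_right ?_ (by positivity)
  have he : Real.exp (2 * 1) = Real.exp 1 * Real.exp 1 := by rw [← Real.exp_add]; norm_num
  rw [he, ← mul_div_assoc, div_le_div_iff₀ (by positivity) (by positivity)]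
  have h1 : 4 * Real.exp 1 * (k + 1) ≤ Real.pi ^ 2 * (k * (2 * k + 1)) := by
    have := Real.exp_one_lt_d9
    have := Real.pi_gt_d4
    have : 9.8 ≤ Real.pi ^ 2 := by nlinarith
    calc 4 * Real.exp 1 * (k + 1) ≤ 11 * ((k : ℝ) + 1) := by gcongr; linarith
      _ ≤ 9.8 * (k * (2 * k + 1)) := by nlinarith
      _ ≤ _ := by gcongr
  have h2 := mul_le_mul_of_nonneg_left h1 (show 0 ≤ 2 * (Real.exp 1 * (N * W)) by positivity)
  linarith

/-- The Chebyshev bound with `s = N W`. -/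
theorem dpswfEigenvalue_le_inv_pow_of_small {N k : ℕ} {W : ℝ} (hk : 1 ≤ k) (hN : 1 ≤ N)
    (hW : 0 < W) (hW2 : W ≤ 1 / 2) (ha : N * W ≤ 2.1)
    (hka : Real.exp 1 * Real.pi * (N * W) ≤ 2 * (k + N * W)) :
    dpswfEigenvalue N W k ≤ 2 / (2 * (k + N * W) / (Real.exp 1 * Real.pi * (N * W))) ^ (2 * k) := by
  have hp := Real.pi_pos
  have hN0 : (0 : ℝ) < N := by exact_mod_cast hN
  have hk0 : (0 : ℝ) < k := by exact_mod_cast hk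
  obtain ⟨a, haW⟩ : ∃ a : ℝ, a = N * W := ⟨_, rfl⟩
  have ha0 : 0 < a := by rw [haW]; positivity
  refine (dpswfEigenvalue_le_of_mul_exp_le hk hW hW2 (show 0 ≤ N * W by positivity)).trans ?_
  rw [← haW] at ha hka ⊢
  rw [div_eq_mul_inv 2, ← inv_pow, inv_div]
  refine mul_le_mul_of_nonneg_right ?_ (by positivity)
  rw [div_le_iff₀ (by positivity)]
  have hexp42 : Real.exp (21 / 5) ≤ 66.8 := by
    have h1 : Real.exp (21 / 5) = Real.exp 1 ^ 4 * Real.exp 0.2 := by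
      rw [← Real.exp_nat_mul, ← Real.exp_add]; norm_num
    have h2 := Real.exp_bound' (x := 0.2) (by norm_num) (by norm_num) (n := 4) (by norm_num)
    have h3 := Real.exp_one_lt_d9
    rw [h1]
    calc Real.exp 1 ^ 4 * Real.exp 0.2 ≤ 2.7182818286 ^ 4 * 1.2215 := by
          gcongr
          refine h2.trans ?_
          norm_num [Finset.sum_range_succ, Nat.factorial]
      _ ≤ _ := by norm_num
  -- convexity of `exp`: on `[0, 4.2]` it lies below its chord
  have hchord : Real.exp (2 * a) ≤ 1 + 31.4 * a := by
    have := convexOn_exp.2 (Set.mem_univ 0) (Set.mem_univ (21 / 5)) (show 0 ≤ 1 - a / (21 / 10) by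
      rw [sub_nonneg, div_le_one (by norm_num)]; linarith) (show 0 ≤ a / (21 / 10) by positivity)
      (by ring)
    simp only [smul_eq_mul, mul_zero, zero_add, Real.exp_zero, mul_one] at this
    rw [show a / (21 / 10) * (21 / 5) = 2 * a by ring] at this
    have h2 := mul_le_mul_of_nonneg_left hexp42 (show 0 ≤ a / (21 / 10) by positivity)
    linarith
  have hk3 : 3.2697 * a ≤ k := by nlinarith [exp_mul_pi_bounds.1]
  have h1 : 2 * a * (1 + 31.4 * a) ≤ 3.14 * (k * (2 * k + 1)) := by nlinarith
  have h2 : 4 * a * Real.exp (2 * a) ≤ 4 * a * (1 + 31.4 * a) := by gcongr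
  have h3 : 3.14 * ((k : ℝ) * (2 * k + 1)) ≤ Real.pi * (k * (2 * k + 1)) := by
    have := Real.pi_gt_d2
    gcongr
  linarith

/-! ### The energy estimate inside the window -/

lemma one_sub_cos_le_mul_sin {θ : ℝ} (h0 : 0 ≤ θ) (h1 : θ ≤ Real.pi / 2) :
    1 - Real.cos θ ≤ θ * Real.sin θ := by
  have hd : ∀ x : ℝ, HasDerivAt (fun x => x * Real.sin x + Real.cos x) (x * Real.cos x) x := by
    intro x
    refine (((hasDerivAt_id' x).mul (Real.hasDerivAt_sin x)).add (Real.hasDerivAt_cos x)).congr_deriv ?_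
    ring
  have hm : MonotoneOn (fun x => x * Real.sin x + Real.cos x) (Set.Icc 0 (Real.pi / 2)) := by
    refine monotoneOn_of_hasDerivWithinAt_nonneg (f' := fun x => x * Real.cos x) (convex_Icc _ _)
      (fun x _ => (hd x).continuousAt.continuousWithinAt) (fun x _ => (hd x).hasDerivWithinAt) ?_
    intro x hx
    rw [interior_Icc] at hx
    exact mul_nonneg hx.1.le (Real.cos_nonneg_of_mem_Icc ⟨by linarith [hx.1, Real.pi_pos], hx.2.le⟩)
  have := hm (Set.left_mem_Icc.mpr (by linarith)) ⟨h0, h1⟩ h0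
  simp at this
  linarith

/-- `g` solves `((cos θ - cos θ₀) g')' + q g = 0`, with `g'` and `g''` its first two derivatives. The
equation degenerates at `θ = ± θ₀`. -/
structure SpheroidalSolution (θ₀ : ℝ) (q : ℝ → ℝ) (g g' g'' : ℝ → ℝ) : Prop where
  deriv₁ : ∀ θ, HasDerivAt g (g' θ) θ
  deriv₂ : ∀ θ, HasDerivAt g' (g'' θ) θ
  ode : ∀ θ, (Real.cos θ - Real.cos θ₀) * g'' θ - Real.sin θ * g' θ + q θ * g θ = 0

/-- Bound for the main part of the coefficient of `g ^ 2` in the energy estimate. -/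
lemma coeff_weight_ge {η t : ℝ} (h0 : 0 ≤ η) (h1 : η ≤ 1) (ht : 0 ≤ t) :
    min 1 (3 * t) ≤ (1 + η + η ^ 2) * (1 - (1 - t) * η) := by
  have e : (1 + η + η ^ 2) * (1 - (1 - t) * η) = 1 - η ^ 3 + t * (η + η ^ 2 + η ^ 3) := by ring
  have h2 : η ^ 2 ≤ η := by nlinarith
  have h3 : η ^ 3 ≤ η ^ 2 := by nlinarith [sq_nonneg η]
  have h4 : t * (3 * η ^ 3) ≤ t * (η + η ^ 2 + η ^ 3) := by gcongr; linarith
  rw [e]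
  rcases le_total 1 (3 * t) with h | h
  · rw [min_eq_left h]
    nlinarith [pow_nonneg h0 3]
  · rw [min_eq_right h]
    nlinarith [pow_nonneg h0 3]

/-- Bound for the remainder in the coefficient of `g ^ 2` in the energy estimate. -/
lemma coeff_deriv_ge {η p0 : ℝ} (h0 : 0 ≤ η) (h1 : η ≤ 1) (hp0 : 0 ≤ p0) (hp1 : p0 ≤ 1) :
    -6 ≤ (1 - 4 * η) * (η * (2 - p0 * η)) + (1 + η - 2 * η ^ 2) * (1 - p0 * η) := by
  have a0 : 0 ≤ (1 - η) * (7 + 10 * η) := by apply mul_nonneg <;> linarith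
  have a1 : 0 ≤ 7 + 2 * η - 12 * η ^ 2 + 6 * η ^ 3 := by
    nlinarith [mul_nonneg h0 (sub_nonneg.2 h1), mul_nonneg (mul_nonneg h0 (sub_nonneg.2 h1)) h0, pow_nonneg h0 3]
  have b0 := mul_nonneg (sub_nonneg.2 hp1) a0
  have b1 := mul_nonneg hp0 a1
  nlinarith

/-- The energy estimate inside the window. The functional `Ψ` of the proof vanishes at `0`, equals
`θ₀ g(θ₀)²` at `θ₀`, and its derivative is a diagonal quadratic form in `g` and the derivative of `g`
which is at least `c₁ g²`. -/
theorem SpheroidalSolution.integral_sq_le {θ₀ χ Λ t κ2 : ℝ} {g g' g'' : ℝ → ℝ} (h0 : 0 < θ₀)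
    (h1 : θ₀ ≤ Real.pi / 2) (hκ : 0 < κ2) (hχ : κ2 ≤ χ) (hΛ : 0 ≤ Λ) (ht : 0 < t) (ht1 : t ≤ 1)
    (hΛχ : Λ * ((1 - Real.cos θ₀) / 2) ≤ (1 - t) * κ2)
    (hg : SpheroidalSolution θ₀ (fun θ => (χ - Λ * ((1 - Real.cos θ) / 2)) / 2) g g' g'')
    (hz : g 0 * g' 0 = 0) :
    (1 + min 1 (3 * t) - 6 / κ2) * ∫ θ in (0 : ℝ)..θ₀, g θ ^ 2 ≤ θ₀ * g θ₀ ^ 2 := by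
  have hχ0 : 0 < χ := lt_of_lt_of_le hκ hχ
  obtain ⟨c1, hc1⟩ : ∃ c1, c1 = 1 + min 1 (3 * t) - 6 / κ2 := ⟨_, rfl⟩
  obtain ⟨p0, hp0⟩ : ∃ p0, p0 = 1 - Real.cos θ₀ := ⟨_, rfl⟩
  have hcos0 : 0 ≤ Real.cos θ₀ := Real.cos_nonneg_of_mem_Icc ⟨by linarith, h1⟩
  have hcos1 : Real.cos θ₀ < 1 := by
    rw [← Real.cos_zero]
    exact Real.cos_lt_cos_of_nonneg_of_le_pi_div_two le_rfl h1 h0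
  have hp00 : 0 < p0 := by rw [hp0]; linarith
  have hp01 : p0 ≤ 1 := by rw [hp0]; linarith
  set q : ℝ → ℝ := fun θ => (χ - Λ * ((1 - Real.cos θ) / 2)) / 2 with hq
  set p : ℝ → ℝ := fun θ => Real.cos θ - Real.cos θ₀ with hp
  set η : ℝ → ℝ := fun θ => (1 - Real.cos θ) / p0 with hη
  rw [← hc1]
  have hpη : ∀ θ, p θ = p0 * (1 - η θ) := by
    intro θ; simp only [hp, hη]; field_simp; rw [hp0]; ring
  have hcosη : ∀ θ, Real.cos θ = 1 - p0 * η θ := by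
    intro θ; simp only [hη]; field_simp; ring
  have hcosle : ∀ θ ∈ Set.Icc 0 θ₀, Real.cos θ₀ ≤ Real.cos θ := fun θ hθ =>
    Real.cos_le_cos_of_nonneg_of_le_pi hθ.1 (by linarith [Real.pi_pos]) hθ.2
  have hηmem : ∀ θ ∈ Set.Icc 0 θ₀, 0 ≤ η θ ∧ η θ ≤ 1 := by
    intro θ hθ
    have := hcosle θ hθ
    constructor
    · exact div_nonneg (by linarith [Real.cos_le_one θ]) hp00.le
    · simp only [hη]; rw [div_le_one hp00, hp0]; linarith
  have hΛ2 : Λ * (p0 / 2) ≤ (1 - t) * χ := by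
    rw [hp0]; refine hΛχ.trans ?_
    exact mul_le_mul_of_nonneg_left hχ (by linarith)
  have hqlow : ∀ θ ∈ Set.Icc 0 θ₀, χ / 2 * (1 - (1 - t) * η θ) ≤ q θ := by
    intro θ hθ
    have h2 := mul_le_mul_of_nonneg_right hΛ2 (hηmem θ hθ).1
    have h3 : 1 - Real.cos θ = p0 * η θ := by rw [hcosη θ]; ring
    simp only [hq]; rw [h3]; linarith
  have hqpos : ∀ θ ∈ Set.Icc 0 θ₀, 0 < q θ := by
    intro θ hθ
    refine lt_of_lt_of_le ?_ (hqlow θ hθ)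
    have : (1 - t) * η θ ≤ (1 - t) * 1 := mul_le_mul_of_nonneg_left (hηmem θ hθ).2 (by linarith)
    have : 0 < 1 - (1 - t) * η θ := by linarith
    positivity
  have hqup : ∀ θ, q θ ≤ χ / 2 := by
    intro θ
    have : 0 ≤ Λ * ((1 - Real.cos θ) / 2) := by
      apply mul_nonneg hΛ; linarith [Real.cos_le_one θ]
    simp only [hq]; linarith
  have hpd : ∀ θ, HasDerivAt p (-Real.sin θ) θ := fun θ => (Real.hasDerivAt_cos θ).sub_const _
  have hqd : ∀ θ, HasDerivAt q (-(Λ * Real.sin θ / 4)) θ := by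
    intro θ
    refine (((((Real.hasDerivAt_cos θ).const_sub 1).div_const 2).const_mul Λ).const_sub χ
      |>.div_const 2).congr_deriv ?_
    ring
  have hηd : ∀ θ, HasDerivAt η (Real.sin θ / p0) θ := by
    intro θ
    refine (((Real.hasDerivAt_cos θ).const_sub 1).div_const p0).congr_deriv ?_
    ring
  -- the energy `θ (g² + (p / q) g'²)` with a correction that trades part of `g'²` for `g²`; since
  -- `(1 + η + η²) p = p₀ (1 - η³) ≤ p₀`, the coefficient of `g'²` stays nonnegative
  set Ψ : ℝ → ℝ := fun θ => θ * (g θ ^ 2 + p θ / q θ * g' θ ^ 2) - (2 / χ) *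
    ((1 + η θ + η θ ^ 2) * p θ * (g θ * g' θ)
      - 1 / 2 * ((1 + η θ - 2 * η θ ^ 2) * Real.sin θ) * g θ ^ 2) with hΨ
  set R : ℝ → ℝ := fun θ => (1 - 4 * η θ) * (η θ * (2 - p0 * η θ))
    + (1 + η θ - 2 * η θ ^ 2) * (1 - p0 * η θ) with hR
  set Ψ' : ℝ → ℝ := fun θ => g θ ^ 2 * (1 + (1 + η θ + η θ ^ 2) * q θ * (2 / χ) + R θ / χ) +
    g' θ ^ 2 * ((p θ + θ * Real.sin θ + θ * p θ * (Λ * Real.sin θ / 4) / q θ) / q θ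
      - (1 + η θ + η θ ^ 2) * p θ * (2 / χ)) with hΨ'
  have hΨd : ∀ θ ∈ Set.Icc 0 θ₀, HasDerivAt Ψ (Ψ' θ) θ := by
    intro θ hθ
    have hqθ := (hqpos θ hθ).ne'
    have d1 := ((hg.deriv₁ θ).pow 2).add (((hpd θ).div (hqd θ) hqθ).mul ((hg.deriv₂ θ).pow 2))
    have d2 := (hasDerivAt_id' θ).mul d1
    have d3 := (((hηd θ).const_add 1).add ((hηd θ).pow 2)).mul (hpd θ) |>.mul
      ((hg.deriv₁ θ).mul (hg.deriv₂ θ))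
    have d4 := ((((hηd θ).const_add 1).sub (((hηd θ).pow 2).const_mul 2)).mul
      (Real.hasDerivAt_sin θ)).const_mul (1 / 2) |>.mul ((hg.deriv₁ θ).pow 2)
    have d5 := d2.sub ((d3.sub d4).const_mul (2 / χ))
    refine d5.congr_deriv ?_
    have hode := hg.ode θ
    have hpg : p θ * g'' θ = Real.sin θ * g' θ - q θ * g θ := by
      simp only [hp, hq] at hode ⊢; linarith
    have hs2 : Real.sin θ ^ 2 = p0 * η θ * (2 - p0 * η θ) := by
      have := Real.sin_sq_add_cos_sq θ
      rw [hcosη θ] at this; linarith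
    simp only [hΨ', hR, Pi.add_apply, Pi.mul_apply, Pi.sub_apply, Pi.pow_apply, Pi.div_apply]
    rw [hcosη θ]
    rw [hpη θ] at hpg ⊢
    clear_value p q η Ψ R Ψ'
    generalize q θ = Q at *
    generalize η θ = y at *
    generalize g θ = a at *
    generalize g' θ = b at *
    generalize g'' θ = c at *
    generalize Real.sin θ = s at *
    field_simp
    push_cast
    linear_combination (8 * p0 * Q * χ * θ * b - 8 * p0 * Q ^ 2 * (1 + y + y ^ 2) * a) * hpg +
      4 * Q ^ 2 * a ^ 2 * (1 - 4 * y) * hs2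
  have hlow : ∀ θ ∈ Set.Icc 0 θ₀, c1 * g θ ^ 2 ≤ Ψ' θ := by
    intro θ hθ
    obtain ⟨hη0, hη1⟩ := hηmem θ hθ
    have hQ := hqpos θ hθ
    have hs0 : 0 ≤ Real.sin θ := Real.sin_nonneg_of_mem_Icc
      ⟨hθ.1, by linarith [hθ.2, Real.pi_pos]⟩
    have hθ0 : 0 ≤ θ := hθ.1
    have hpnn : 0 ≤ p θ := by rw [hpη]; exact mul_nonneg hp00.le (by linarith)
    -- coefficient of `g ^ 2`
    have k1 : c1 ≤ 1 + (1 + η θ + η θ ^ 2) * q θ * (2 / χ) + R θ / χ := by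
      have e1 := coeff_weight_ge hη0 hη1 ht.le
      have e2 : (1 + η θ + η θ ^ 2) * (1 - (1 - t) * η θ) ≤
          (1 + η θ + η θ ^ 2) * q θ * (2 / χ) := by
        have := mul_le_mul_of_nonneg_left (hqlow θ hθ)
          (show 0 ≤ (1 + η θ + η θ ^ 2) * (2 / χ) by positivity)
        refine le_trans (le_of_eq ?_) (this.trans (le_of_eq ?_))
        · field_simp
        · ring
      have e3 : -(6 / κ2) ≤ R θ / χ := by
        have h6 : -6 ≤ R θ := coeff_deriv_ge hη0 hη1 hp00.le hp01
        have h7 : 6 / χ ≤ 6 / κ2 := by gcongr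
        have h8 := div_le_div_of_nonneg_right h6 hχ0.le
        rw [neg_div] at h8
        linarith
      rw [hc1]; linarith
    -- coefficient of `g' ^ 2`
    have k2 : 0 ≤ (p θ + θ * Real.sin θ + θ * p θ * (Λ * Real.sin θ / 4) / q θ) / q θ
      - (1 + η θ + η θ ^ 2) * p θ * (2 / χ) := by
      have e1 : p0 ≤ p θ + θ * Real.sin θ := by
        have := one_sub_cos_le_mul_sin hθ0 (hθ.2.trans h1)
        simp only [hp]; rw [hp0]; linarith
      have e2 : p0 ≤ p θ + θ * Real.sin θ + θ * p θ * (Λ * Real.sin θ / 4) / q θ := by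
        have : 0 ≤ θ * p θ * (Λ * Real.sin θ / 4) / q θ := by positivity
        linarith
      have e3 : (1 + η θ + η θ ^ 2) * p θ ≤ p0 := by
        rw [hpη]; nlinarith [pow_nonneg hη0 3, mul_nonneg hp00.le (pow_nonneg hη0 3)]
      have e4 : p0 * (2 / χ) ≤ p0 / q θ := by
        rw [div_eq_mul_inv p0]
        refine mul_le_mul_of_nonneg_left ?_ hp00.le
        rw [div_le_iff₀ hχ0, inv_mul_eq_div, le_div_iff₀ hQ]
        linarith [hqup θ]
      have e5 := div_le_div_of_nonneg_right e2 hQ.le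
      have e6 := mul_le_mul_of_nonneg_right e3 (show 0 ≤ 2 / χ by positivity)
      linarith
    have := mul_le_mul_of_nonneg_right k1 (sq_nonneg (g θ))
    have := mul_nonneg (sq_nonneg (g' θ)) k2
    simp only [hΨ']
    linarith
  have hgc : Continuous g := continuous_iff_continuousAt.mpr fun θ => (hg.deriv₁ θ).continuousAt
  have key := intervalIntegral.integral_le_sub_of_hasDeriv_right_of_le h0.le
    (fun θ hθ => (hΨd θ hθ).continuousAt.continuousWithinAt)
    (fun θ hθ => (hΨd θ (Set.Ioo_subset_Icc_self hθ)).hasDerivWithinAt)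
    (φ := fun θ => c1 * g θ ^ 2) (Continuous.integrableOn_Icc (by fun_prop))
    (fun θ hθ => hlow θ (Set.Ioo_subset_Icc_self hθ))
  rw [intervalIntegral.integral_const_mul] at key
  refine key.trans (le_of_eq ?_)
  have hη1 : η θ₀ = 1 := by simp only [hη]; rw [hp0]; exact div_self (by linarith)
  have hη0 : η 0 = 0 := by simp [hη]
  have hpθ : p θ₀ = 0 := by simp [hp]
  simp only [hΨ, hη1, hη0, hpθ, hz]
  rw [Real.sin_zero]
  ring

/-! ### Growth outside the window -/

/-- Growth between the window edge and the turning point. The variable `m` is affine in `cos θ`, with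
`m = 1` at `θ₀` and `m = M` at `θ₁`; `hF` says that `b (1 / m - 1 / M)` is a subsolution of the Riccati
equation. Hence the difference between the logarithmic derivative of `g` and the subsolution, weighted
by `g²` and the leading coefficient, is nondecreasing; it vanishes at `θ₀`, where the equation
degenerates. -/
theorem SpheroidalSolution.growth {θ₀ θ₁ M b C : ℝ} {q g g' g'' : ℝ → ℝ} (h0 : 0 < θ₀)
    (h01 : θ₀ < θ₁) (h1 : θ₁ ≤ Real.pi) (hM : 1 < M) (hb : 0 ≤ b) (hC : 0 ≤ C)
    (hMθ : 2 * (1 - Real.cos θ₁) / (1 - Real.cos θ₀) - 1 = M)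
    (hF : ∀ m, 1 ≤ m → m ≤ M → 2 * (m ^ 2 - 1) * (b ^ 2 * (1 / m - 1 / M) ^ 2 - b / m ^ 2)
      + (3 * m + 1) * (b * (1 / m - 1 / M)) ≤ C * (M - m))
    (hq : ∀ θ, C * (M - (2 * (1 - Real.cos θ) / (1 - Real.cos θ₀) - 1)) ≤ q θ)
    (hg : SpheroidalSolution θ₀ q g g' g'') :
    g θ₀ ^ 2 * Real.exp (2 * b * (Real.log M - 1 + 1 / M)) ≤ g θ₁ ^ 2 := by
  obtain ⟨p0, hp0⟩ : ∃ p0, p0 = 1 - Real.cos θ₀ := ⟨_, rfl⟩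
  have hcos1 : Real.cos θ₀ < 1 := by
    rw [← Real.cos_zero]
    exact Real.cos_lt_cos_of_nonneg_of_le_pi le_rfl (by linarith) h0
  have hp00 : 0 < p0 := by rw [hp0]; linarith
  set m : ℝ → ℝ := fun θ => 2 * (1 - Real.cos θ) / p0 - 1 with hm
  set P : ℝ → ℝ := fun θ => Real.cos θ₀ - Real.cos θ with hP
  have hcosm : ∀ θ, Real.cos θ = 1 - p0 * (m θ + 1) / 2 := by
    intro θ; simp only [hm]; field_simp; ring
  have hPm : ∀ θ, P θ = p0 * (m θ - 1) / 2 := by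
    intro θ; simp only [hP]; rw [hcosm θ, show Real.cos θ₀ = 1 - p0 by rw [hp0]; ring]; ring
  have hm0 : m θ₀ = 1 := by
    simp only [hm]; rw [← hp0]; field_simp; norm_num
  have hm1 : m θ₁ = M := by rw [← hMθ, ← hp0]
  have hmmem : ∀ θ ∈ Set.Icc θ₀ θ₁, 1 ≤ m θ ∧ m θ ≤ M := by
    intro θ hθ
    have c1 : Real.cos θ ≤ Real.cos θ₀ :=
      Real.cos_le_cos_of_nonneg_of_le_pi h0.le (hθ.2.trans h1) hθ.1
    have c2 : Real.cos θ₁ ≤ Real.cos θ :=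
      Real.cos_le_cos_of_nonneg_of_le_pi (h0.le.trans hθ.1) h1 hθ.2
    rw [← hm0, ← hm1]
    constructor <;> (simp only [hm]; gcongr)
  have hmd : ∀ θ, HasDerivAt m (2 * Real.sin θ / p0) θ := by
    intro θ
    refine (((((Real.hasDerivAt_cos θ).const_sub 1).const_mul 2).div_const p0).sub_const 1).congr_deriv ?_
    ring
  have hPd : ∀ θ, HasDerivAt P (Real.sin θ) θ := by
    intro θ
    refine ((Real.hasDerivAt_cos θ).const_sub _).congr_deriv ?_
    ring
  -- the logarithmic derivative `w` of the comparison function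
  set w : ℝ → ℝ := fun θ => b * (1 / m θ - 1 / M) * (2 * Real.sin θ / p0) with hw
  -- `P w` written without a quotient by `p0`
  set Pw : ℝ → ℝ := fun θ => b * (1 / m θ - 1 / M) * ((m θ - 1) * Real.sin θ) with hPw
  have hPPw : ∀ θ, Pw θ = P θ * w θ := by
    intro θ; simp only [hPw, hw]; rw [hPm]; field_simp
  have hPwd : ∀ θ ∈ Set.Icc θ₀ θ₁, HasDerivAt Pw (b * (-(2 * Real.sin θ / p0) / m θ ^ 2) *
      ((m θ - 1) * Real.sin θ) + b * (1 / m θ - 1 / M) * ((2 * Real.sin θ / p0) * Real.sin θ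
        + (m θ - 1) * Real.cos θ)) θ := by
    intro θ hθ
    have hmθ : m θ ≠ 0 := by linarith [(hmmem θ hθ).1]
    have d1 := (((hmd θ).inv hmθ).sub_const (1 / M)).const_mul b
    have d2 := ((hmd θ).sub_const 1).mul (Real.hasDerivAt_sin θ)
    have d3 := d1.mul d2
    simp only [hPw, one_div] at d3 ⊢
    exact d3
  have hricc : ∀ θ ∈ Set.Icc θ₀ θ₁, P θ * w θ ^ 2 + (b * (-(2 * Real.sin θ / p0) / m θ ^ 2) *
      ((m θ - 1) * Real.sin θ) + b * (1 / m θ - 1 / M) * ((2 * Real.sin θ / p0) * Real.sin θ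
        + (m θ - 1) * Real.cos θ)) ≤ q θ := by
    intro θ hθ
    obtain ⟨hmθ1, hmθM⟩ := hmmem θ hθ
    refine le_trans ?_ (hq θ)
    rw [← hp0]
    change _ ≤ C * (M - m θ)
    have hs2 : Real.sin θ ^ 2 = p0 * (m θ + 1) / 2 * (2 - p0 * (m θ + 1) / 2) := by
      have := Real.sin_sq_add_cos_sq θ
      rw [hcosm θ] at this; linarith
    have hz1 : p0 * (m θ + 1) / 4 ≤ 1 := by
      have := Real.neg_one_le_cos θ
      rw [hcosm θ] at this; linarith
    have hu : 0 ≤ 1 / m θ - 1 / M := by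
      rw [sub_nonneg]; exact one_div_le_one_div_of_le (by linarith) hmθM
    have hFm := hF (m θ) hmθ1 hmθM
    simp only [hw]
    rw [hcosm θ, hPm θ]
    generalize m θ = y at *
    generalize Real.sin θ = s at *
    obtain ⟨u, hu'⟩ : ∃ u, u = 1 / y - 1 / M := ⟨_, rfl⟩
    rw [← hu'] at hu hFm ⊢
    have hy0 : 0 < y := by linarith
    have e : p0 * (y - 1) / 2 * (b * u * (2 * s / p0)) ^ 2 + (b * (-(2 * s / p0) / y ^ 2) * ((y - 1) * s)
        + b * u * (2 * s / p0 * s + (y - 1) * (1 - p0 * (y + 1) / 2))) =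
        (1 - p0 * (y + 1) / 4) * (2 * (y ^ 2 - 1) * (b ^ 2 * u ^ 2 - b / y ^ 2) + (3 * y + 1) * (b * u))
          - p0 * (y + 1) / 4 * (b * u * (y - 1)) := by
      field_simp
      linear_combination 16 * b * (y ^ 2 * (y - 1) * b * u ^ 2 - (y - 1) + y ^ 2 * u) * hs2
    rw [e]
    have hz0 : 0 ≤ p0 * (y + 1) / 4 := by positivity
    have h2 : 0 ≤ p0 * (y + 1) / 4 * (b * u * (y - 1)) :=
      mul_nonneg hz0 (mul_nonneg (mul_nonneg hb hu) (by linarith))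
    have h3 := mul_le_mul_of_nonneg_left hFm (show 0 ≤ 1 - p0 * (y + 1) / 4 by linarith)
    have h4 : 0 ≤ C * (M - y) := mul_nonneg hC (by linarith)
    nlinarith [mul_nonneg hz0 h4]
  -- `K = P (g g' - w g²)` compares `g` with the subsolution without dividing by `g`
  set K : ℝ → ℝ := fun θ => g θ * (P θ * g' θ) - Pw θ * g θ ^ 2 with hK
  have hKd : ∀ θ ∈ Set.Icc θ₀ θ₁, HasDerivAt K (P θ * (g' θ - w θ * g θ) ^ 2 + g θ ^ 2 *
      (q θ - (P θ * w θ ^ 2 + (b * (-(2 * Real.sin θ / p0) / m θ ^ 2) *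
      ((m θ - 1) * Real.sin θ) + b * (1 / m θ - 1 / M) * ((2 * Real.sin θ / p0) * Real.sin θ
        + (m θ - 1) * Real.cos θ))))) θ := by
    intro θ hθ
    have d1 := ((hg.deriv₁ θ).mul ((hPd θ).mul (hg.deriv₂ θ))).sub
      ((hPwd θ hθ).mul ((hg.deriv₁ θ).pow 2))
    refine d1.congr_deriv ?_
    have hode := hg.ode θ
    have e : Real.sin θ * g' θ + P θ * g'' θ = q θ * g θ := by simp only [hP]; linarith
    simp only [Pi.mul_apply, Pi.pow_apply, hPPw θ]
    push_cast
    linear_combination g θ * e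
  have hKmono : MonotoneOn K (Set.Icc θ₀ θ₁) := by
    refine monotoneOn_of_hasDerivWithinAt_nonneg (convex_Icc _ _)
      (fun x hx => (hKd x hx).continuousAt.continuousWithinAt)
      (fun x hx => (hKd x (interior_subset hx)).hasDerivWithinAt) ?_
    intro x hx
    have hx' := interior_subset hx
    have hPnn : 0 ≤ P x := by
      rw [hPm]; have := (hmmem x hx').1
      exact div_nonneg (mul_nonneg hp00.le (by linarith)) zero_le_two
    exact add_nonneg (mul_nonneg hPnn (sq_nonneg _))
      (mul_nonneg (sq_nonneg _) (sub_nonneg.mpr (hricc x hx')))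
  have hK0 : ∀ θ ∈ Set.Icc θ₀ θ₁, 0 ≤ K θ := by
    intro θ hθ
    have h := hKmono (Set.left_mem_Icc.mpr h01.le) hθ hθ.1
    have : K θ₀ = 0 := by simp only [hK, hPw, hP, hm0]; ring
    rwa [this] at h
  -- `g ^ 2 / h ^ 2` is nondecreasing, where `h = exp (b (log m - m / M))`
  set S : ℝ → ℝ := fun θ => g θ ^ 2 * Real.exp (-(2 * (b * (Real.log (m θ) - m θ / M)))) with hS
  have hSd : ∀ θ ∈ Set.Icc θ₀ θ₁, HasDerivAt S (Real.exp (-(2 * (b * (Real.log (m θ) - m θ / M)))) *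
      (2 * (g θ * g' θ - w θ * g θ ^ 2))) θ := by
    intro θ hθ
    have hmθ : m θ ≠ 0 := by linarith [(hmmem θ hθ).1]
    have d1 := ((((((hmd θ).log hmθ).sub ((hmd θ).div_const M)).const_mul b).const_mul 2).neg).exp
    have d2 := ((hg.deriv₁ θ).pow 2).mul d1
    refine d2.congr_deriv ?_
    simp only [hw, Pi.pow_apply, Pi.neg_apply, Pi.sub_apply]
    push_cast
    ring
  have hSmono : MonotoneOn S (Set.Icc θ₀ θ₁) := by
    refine monotoneOn_of_hasDerivWithinAt_nonneg (convex_Icc _ _)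
      (fun x hx => (hSd x hx).continuousAt.continuousWithinAt)
      (fun x hx => (hSd x (interior_subset hx)).hasDerivWithinAt) ?_
    intro x hx
    have hx' := interior_subset hx
    rw [interior_Icc] at hx
    have hPpos : 0 < P x := by
      have := Real.cos_lt_cos_of_nonneg_of_le_pi h0.le (hx.2.le.trans h1) hx.1
      simp only [hP]; linarith
    have h := hK0 x hx'
    have e : K x = P x * (g x * g' x - w x * g x ^ 2) := by
      simp only [hK]; rw [hPPw]; ring
    rw [e] at h
    have := nonneg_of_mul_nonneg_right h hPpos
    positivity
  have h := hSmono (Set.left_mem_Icc.mpr h01.le) (Set.right_mem_Icc.mpr h01.le) h01.le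
  simp only [hS, hm0, hm1] at h
  have hM0 : M ≠ 0 := by linarith
  rw [Real.log_one, div_self hM0] at h
  have h2 := mul_le_mul_of_nonneg_right h (Real.exp_pos (2 * (b * (Real.log M - 1)))).le
  rw [mul_assoc, mul_assoc, ← Real.exp_add, ← Real.exp_add, neg_add_cancel, Real.exp_zero,
    mul_one] at h2
  refine le_trans (le_of_eq ?_) h2
  congr 2
  ring

/-! ### The commuting tridiagonal operator and its differential equation -/

lemma sum_range_shift {N : ℕ} {f : ℕ → ℝ} (h : f 0 = f N) :
    ∑ n ∈ Finset.range N, f (n + 1) = ∑ n ∈ Finset.range N, f n := by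
  have h1 := Finset.sum_range_succ f N
  have h2 := Finset.sum_range_succ' f N
  linarith

/-- The off-diagonal coefficients `n (N - n)`, which vanish at both ends `0` and `N`. -/
noncomputable def jacobiCoeff (N n : ℕ) : ℝ := n * (N - n)

/-- The three-term expression of the commuting operator on sequences; `s` is twice
`1 - cos (2 π W)`. The truncated `n - 1` at `n = 0` is harmless since `jacobiCoeff N 0 = 0`. -/
noncomputable def jacobiExpr (N : ℕ) (s : ℝ) (V : ℕ → ℝ) (n : ℕ) : ℝ :=
  -jacobiCoeff N (n + 1) * (V (n + 1) - V n) + jacobiCoeff N n * (V n - V (n - 1)) +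
    s * ((n : ℝ) - (N - 1) / 2) ^ 2 * V n

lemma jacobiCoeff_zero (N : ℕ) : jacobiCoeff N 0 = 0 := by simp [jacobiCoeff]

lemma jacobiCoeff_self (N : ℕ) : jacobiCoeff N N = 0 := by simp [jacobiCoeff]

lemma jacobiCoeff_pos {N n : ℕ} (h0 : 0 < n) (h : n < N) : 0 < jacobiCoeff N n := by
  have h1 : (0 : ℝ) < n := by exact_mod_cast h0
  have h2 : (n : ℝ) < N := by exact_mod_cast h
  exact mul_pos h1 (by linarith)

lemma sum_jacobiExpr_mul (N : ℕ) (s : ℝ) (V U : ℕ → ℝ) :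
    ∑ n ∈ Finset.range N, jacobiExpr N s V n * U n =
      ∑ n ∈ Finset.range N, (jacobiCoeff N n * ((V n - V (n - 1)) * (U n - U (n - 1))) +
        s * ((n : ℝ) - (N - 1) / 2) ^ 2 * (V n * U n)) := by
  have h := sum_range_shift (N := N) (f := fun n => jacobiCoeff N n * (V n - V (n - 1)) * U (n - 1))
    (by simp [jacobiCoeff_zero, jacobiCoeff_self])
  simp only [Nat.add_sub_cancel] at h
  rw [← sub_eq_zero, ← Finset.sum_sub_distrib]
  rw [eq_comm, ← sub_eq_zero, ← Finset.sum_sub_distrib] at h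
  rw [← h]
  refine Finset.sum_congr rfl fun n _ => ?_
  rw [jacobiExpr]; ring

/-- An eigenvector is determined by its first entry, by the three-term recursion. -/
lemma eq_zero_of_jacobiExpr_eq {N : ℕ} {s χ : ℝ} {V : ℕ → ℝ}
    (hV : ∀ n < N, jacobiExpr N s V n = χ * V n) (h0 : V 0 = 0) : ∀ n < N, V n = 0 := by
  intro n
  induction n using Nat.strong_induction_on with
  | _ n ih =>
    intro hn
    rcases n with _ | n
    · exact h0
    have e := hV n (by omega)
    have e1 := ih n (by omega) (by omega)
    have e2 := ih (n - 1) (by omega) (by omega)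
    rw [jacobiExpr, e1, e2] at e
    have := jacobiCoeff_pos (N := N) (n := n + 1) (by omega) hn
    have e3 : jacobiCoeff N (n + 1) * V (n + 1) = 0 := by linarith
    exact (mul_eq_zero.mp e3).resolve_left this.ne'

/-- For `s = 0` the operator is triangular on the sequences of binomial coefficients. -/
lemma jacobiExpr_choose {N j n : ℕ} (hn : n < N) :
    jacobiExpr N 0 (fun m => (m.choose j : ℝ)) n =
      j * (j + 1) * (n.choose j : ℝ) - j * (N - j) * (n.choose (j - 1) : ℝ) := by
  rcases j with _ | j
  · simp [jacobiExpr]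
  have h1 : ((n + 1).choose (j + 1) : ℝ) - n.choose (j + 1) = n.choose j := by
    rw [Nat.choose_succ_succ]; push_cast; ring
  have h2 : (n : ℝ) * ((n.choose (j + 1) : ℝ) - (n - 1).choose (j + 1)) =
      (j + 1) * n.choose (j + 1) := by
    rcases n with _ | n
    · simp
    · have := Nat.add_one_mul_choose_eq n j
      have h3 : ((n : ℝ) + 1) * n.choose j = (n + 1).choose (j + 1) * (j + 1) := by exact_mod_cast this
      rw [Nat.add_sub_cancel]
      have h4 : ((n + 1).choose (j + 1) : ℝ) - n.choose (j + 1) = n.choose j := by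
        rw [Nat.choose_succ_succ]; push_cast; ring
      rw [h4]; push_cast; linarith
  have h3 : ((j : ℝ) + 1) * n.choose (j + 1) = (n - j) * n.choose j := by
    rcases le_or_gt j n with h | h
    · have := Nat.choose_succ_right_eq n j
      have h5 : (n.choose (j + 1) : ℝ) * (j + 1) = n.choose j * ((n - j : ℕ) : ℝ) := by
        exact_mod_cast this
      rw [Nat.cast_sub h] at h5; linarith
    · rw [Nat.choose_eq_zero_of_lt h, Nat.choose_eq_zero_of_lt (by omega)]; simp
  rw [jacobiExpr, jacobiCoeff, jacobiCoeff]
  simp only [h1, Nat.add_sub_cancel]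
  push_cast
  linear_combination ((N : ℝ) - n) * h2 + (((N : ℝ) - n) - (j + 2)) * h3

/-- An eigenvector of the three-term operator turns into a solution of the differential equation: the
terms produced by multiplication with `cos θ` and `sin θ` shift the frequency by one and telescope. -/
theorem spheroidalSolution_of_jacobiExpr {N : ℕ} {θ₀ χ : ℝ} {V : ℕ → ℝ}
    (hV : ∀ n < N, jacobiExpr N (2 * (1 - Real.cos θ₀)) V n = χ * V n) (α : ℝ) :
    SpheroidalSolution θ₀ (fun θ => (χ - ((N : ℝ) ^ 2 - 1) * ((1 - Real.cos θ) / 2)) / 2)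
      (fun θ => ∑ n ∈ Finset.range N, V n * Real.cos (((n : ℝ) - (N - 1) / 2) * θ + α))
      (fun θ => ∑ n ∈ Finset.range N, -(V n * ((n : ℝ) - (N - 1) / 2)) *
        Real.sin (((n : ℝ) - (N - 1) / 2) * θ + α))
      (fun θ => ∑ n ∈ Finset.range N, -(V n * ((n : ℝ) - (N - 1) / 2)) *
        (((n : ℝ) - (N - 1) / 2) * Real.cos (((n : ℝ) - (N - 1) / 2) * θ + α))) := by
  have hlin : ∀ (x θ : ℝ), HasDerivAt (fun θ => x * θ + α) x θ := fun x θ => by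
    simpa using ((hasDerivAt_id' θ).const_mul x).add_const α
  refine ⟨fun θ => ?_, fun θ => ?_, fun θ => ?_⟩
  · refine HasDerivAt.fun_sum fun n _ => ?_
    refine (((hlin ((n : ℝ) - (N - 1) / 2) θ).cos).const_mul (V n)).congr_deriv ?_
    ring
  · refine HasDerivAt.fun_sum fun n _ => ?_
    refine (((hlin ((n : ℝ) - (N - 1) / 2) θ).sin).const_mul _).congr_deriv ?_
    ring
  · set c : ℕ → ℝ := fun n => Real.cos (((n : ℝ) - (N - 1) / 2) * θ + α) with hc
    -- the same cosine with the frequency lowered by one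
    set d : ℕ → ℝ := fun n => Real.cos (((n : ℝ) - (N - 1) / 2) * θ + α - θ) with hd
    have h1 := sum_range_shift (N := N) (f := fun n => jacobiCoeff N n * V (n - 1) * c n)
      (by simp [jacobiCoeff_zero, jacobiCoeff_self])
    have h2 := sum_range_shift (N := N) (f := fun n => jacobiCoeff N n * V n * d n)
      (by simp [jacobiCoeff_zero, jacobiCoeff_self])
    have hd1 : ∀ n, d (n + 1) = c n := by
      intro n; simp only [hd, hc]; congr 1; push_cast; ring
    simp only [Nat.add_sub_cancel, hd1] at h1 h2
    have key : ∀ n ∈ Finset.range N,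
        (Real.cos θ - Real.cos θ₀) * (-(V n * ((n : ℝ) - (N - 1) / 2)) *
          (((n : ℝ) - (N - 1) / 2) * c n))
        - Real.sin θ * (-(V n * ((n : ℝ) - (N - 1) / 2)) *
          Real.sin (((n : ℝ) - (N - 1) / 2) * θ + α))
        + (χ - ((N : ℝ) ^ 2 - 1) * ((1 - Real.cos θ) / 2)) / 2 * (V n * c n)
        = (jacobiCoeff N (n + 1) * V n * c (n + 1) - jacobiCoeff N n * V (n - 1) * c n) / 2
          - (jacobiCoeff N (n + 1) * V (n + 1) * c n - jacobiCoeff N n * V n * d n) / 2 := by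
      intro n hn
      have e := hV n (Finset.mem_range.mp hn)
      have hc1 : c (n + 1) = c n * Real.cos θ -
          Real.sin (((n : ℝ) - (N - 1) / 2) * θ + α) * Real.sin θ := by
        simp only [hc]; rw [← Real.cos_add]; congr 1; push_cast; ring
      have hd0 : d n = c n * Real.cos θ +
          Real.sin (((n : ℝ) - (N - 1) / 2) * θ + α) * Real.sin θ := by
        simp only [hc, hd]; rw [← Real.cos_sub]
      rw [hc1, hd0]
      rw [jacobiExpr] at e
      simp only [jacobiCoeff] at e ⊢
      push_cast at e ⊢
      generalize c n = C at *
      linear_combination (-C / 2) * e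
    rw [Finset.mul_sum, Finset.mul_sum, Finset.mul_sum, ← Finset.sum_sub_distrib,
      ← Finset.sum_add_distrib, Finset.sum_congr rfl key, Finset.sum_sub_distrib,
      ← Finset.sum_div, ← Finset.sum_div, Finset.sum_sub_distrib, Finset.sum_sub_distrib, h1, h2]
    ring

/-! ### The spectrum of the commuting operator -/

/-- The entries of `v` as a sequence, zero beyond the last index. -/
noncomputable def extendZero {N : ℕ} (v : EuclideanSpace ℝ (Fin N)) (n : ℕ) : ℝ :=
  if h : n < N then v ⟨n, h⟩ else 0

lemma extendZero_coe {N : ℕ} (v : EuclideanSpace ℝ (Fin N)) (n : Fin N) :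
    extendZero v n = v n := by simp [extendZero]

lemma extendZero_add {N : ℕ} (v w : EuclideanSpace ℝ (Fin N)) (n : ℕ) :
    extendZero (v + w) n = extendZero v n + extendZero w n := by
  unfold extendZero; split_ifs <;> simp

lemma extendZero_smul {N : ℕ} (c : ℝ) (v : EuclideanSpace ℝ (Fin N)) (n : ℕ) :
    extendZero (c • v) n = c * extendZero v n := by
  unfold extendZero; split_ifs <;> simp

lemma inner_eq_sum_extendZero {N : ℕ} (v w : EuclideanSpace ℝ (Fin N)) :
    ⟪v, w⟫_ℝ = ∑ n ∈ Finset.range N, extendZero v n * extendZero w n := by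
  rw [← Fin.sum_univ_eq_sum_range (fun n => extendZero v n * extendZero w n), PiLp.inner_apply]
  refine Finset.sum_congr rfl fun n _ => ?_
  rw [extendZero_coe, extendZero_coe]
  simp [mul_comm]

/-- The tridiagonal operator on `ℝᴺ` given by `jacobiExpr`. -/
noncomputable def jacobiOp (N : ℕ) (s : ℝ) :
    EuclideanSpace ℝ (Fin N) →ₗ[ℝ] EuclideanSpace ℝ (Fin N) where
  toFun v := WithLp.toLp 2 fun n => jacobiExpr N s (extendZero v) n
  map_add' v w := by
    ext n
    simp only [jacobiExpr, extendZero_add, PiLp.add_apply]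
    ring
  map_smul' c v := by
    ext n
    simp only [jacobiExpr, extendZero_smul, PiLp.smul_apply, smul_eq_mul, RingHom.id_apply]
    ring

lemma extendZero_jacobiOp {N n : ℕ} (s : ℝ) (v : EuclideanSpace ℝ (Fin N)) (hn : n < N) :
    extendZero (jacobiOp N s v) n = jacobiExpr N s (extendZero v) n := by
  simp [extendZero, hn, jacobiOp]

lemma inner_jacobiOp {N : ℕ} (s : ℝ) (v w : EuclideanSpace ℝ (Fin N)) :
    ⟪jacobiOp N s v, w⟫_ℝ = ∑ n ∈ Finset.range N, (jacobiCoeff N n *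
      ((extendZero v n - extendZero v (n - 1)) * (extendZero w n - extendZero w (n - 1))) +
        s * ((n : ℝ) - (N - 1) / 2) ^ 2 * (extendZero v n * extendZero w n)) := by
  rw [inner_eq_sum_extendZero, ← sum_jacobiExpr_mul]
  refine Finset.sum_congr rfl fun n hn => ?_
  rw [extendZero_jacobiOp s v (Finset.mem_range.mp hn)]

lemma jacobiOp_isSymmetric (N : ℕ) (s : ℝ) : (jacobiOp N s).IsSymmetric := by
  intro v w
  rw [inner_jacobiOp, real_inner_comm, inner_jacobiOp]
  exact Finset.sum_congr rfl fun n _ => by ring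

lemma inner_jacobiOp_zero_le {N : ℕ} {s : ℝ} (hs : 0 ≤ s) (v : EuclideanSpace ℝ (Fin N)) :
    ⟪jacobiOp N 0 v, v⟫_ℝ ≤ ⟪jacobiOp N s v, v⟫_ℝ := by
  rw [inner_jacobiOp, inner_jacobiOp]
  refine Finset.sum_le_sum fun n _ => ?_
  have := mul_nonneg (mul_nonneg hs (sq_nonneg ((n : ℝ) - (N - 1) / 2)))
    (mul_self_nonneg (extendZero v n))
  linarith

lemma jacobiExpr_of_eigenvector {N : ℕ} {s χ : ℝ} {v : EuclideanSpace ℝ (Fin N)}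
    (hv : jacobiOp N s v = χ • v) : ∀ n < N, jacobiExpr N s (extendZero v) n = χ * extendZero v n := by
  intro n hn
  rw [← extendZero_jacobiOp s v hn, hv, extendZero_smul]

lemma eq_zero_of_extendZero_eq_zero {N : ℕ} {v : EuclideanSpace ℝ (Fin N)}
    (h : ∀ n < N, extendZero v n = 0) : v = 0 := by
  ext n
  rw [← extendZero_coe, h n n.2]; rfl

/-- The eigenvalues of `jacobiOp` are simple. -/
lemma jacobiOp_eigenvalue_ne {N : ℕ} {s χ χ' : ℝ} {v w : EuclideanSpace ℝ (Fin N)}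
    (hv : jacobiOp N s v = χ • v) (hw : jacobiOp N s w = χ' • w) (hvn : ‖v‖ = 1) (hwn : ‖w‖ = 1)
    (hvw : ⟪v, w⟫_ℝ = 0) : χ ≠ χ' := by
  rintro rfl
  obtain ⟨a, ha⟩ : ∃ a, a = extendZero v 0 := ⟨_, rfl⟩
  obtain ⟨b, hb⟩ : ∃ b, b = extendZero w 0 := ⟨_, rfl⟩
  have hz : ∀ u : EuclideanSpace ℝ (Fin N), jacobiOp N s u = χ • u → extendZero u 0 = 0 → u = 0 :=
    fun u hu h0 => eq_zero_of_extendZero_eq_zero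
      (eq_zero_of_jacobiExpr_eq (jacobiExpr_of_eigenvector hu) h0)
  have hcomb : b • v + (-a) • w = 0 := by
    refine hz _ ?_ ?_
    · rw [map_add, map_smul, map_smul, hv, hw, smul_add, smul_comm b, smul_comm (-a)]
    · rw [extendZero_add, extendZero_smul, extendZero_smul, ← ha, ← hb]; ring
  have hb0 : b = 0 := by
    have := congrArg (fun u => ⟪v, u⟫_ℝ) hcomb
    simpa [inner_add_right, inner_smul_right, hvw, hvn] using this
  have hw0 := hz w hw (hb ▸ hb0)
  rw [hw0, norm_zero] at hwn
  exact zero_ne_one hwn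

/-- The vector of binomial coefficients `n.choose j`. -/
noncomputable def chooseVec (N j : ℕ) : EuclideanSpace ℝ (Fin N) :=
  WithLp.toLp 2 fun n => ((n : ℕ).choose j : ℝ)

lemma extendZero_chooseVec {N j n : ℕ} (hn : n < N) :
    extendZero (chooseVec N j) n = (n.choose j : ℝ) := by simp [extendZero, chooseVec, hn]

lemma inner_chooseVec {N : ℕ} (j : ℕ) (v : EuclideanSpace ℝ (Fin N)) :
    ⟪v, chooseVec N j⟫_ℝ = ∑ n ∈ Finset.range N, extendZero v n * (n.choose j : ℝ) := by
  rw [inner_eq_sum_extendZero]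
  exact Finset.sum_congr rfl fun n hn => by rw [extendZero_chooseVec (Finset.mem_range.mp hn)]

lemma jacobiOp_chooseVec (N j : ℕ) : jacobiOp N 0 (chooseVec N j) =
    ((j : ℝ) * (j + 1)) • chooseVec N j - ((j : ℝ) * (N - j)) • chooseVec N (j - 1) := by
  ext n
  have h := jacobiExpr_choose (j := j) n.2
  have e : jacobiExpr N 0 (extendZero (chooseVec N j)) n =
      jacobiExpr N 0 (fun m => (m.choose j : ℝ)) n := by
    have h0 := extendZero_chooseVec (N := N) (j := j) n.2
    have h1 := extendZero_chooseVec (N := N) (j := j) (n := (n : ℕ) - 1) (by have := n.2; omega)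
    have h2 : jacobiCoeff N (n + 1) * extendZero (chooseVec N j) (n + 1) =
        jacobiCoeff N (n + 1) * ((n + 1 : ℕ).choose j : ℝ) := by
      rcases lt_or_ge ((n : ℕ) + 1) N with h | h
      · rw [extendZero_chooseVec h]
      · have : (n : ℕ) + 1 = N := by have := n.2; omega
        rw [this, jacobiCoeff_self]; ring
    rw [jacobiExpr, jacobiExpr, h0, h1]
    linarith
  change jacobiExpr N 0 (extendZero (chooseVec N j)) n = _
  rw [e, h]
  simp [chooseVec]

lemma exists_inner_chooseVec_ne_zero {N : ℕ} {v : EuclideanSpace ℝ (Fin N)} (hv : v ≠ 0) :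
    ∃ j, ⟪v, chooseVec N j⟫_ℝ ≠ 0 := by
  by_contra! h
  refine hv (eq_zero_of_extendZero_eq_zero ?_)
  by_contra! hn
  classical
  obtain ⟨m, hm, hmax⟩ : ∃ m ∈ (Finset.range N).filter (fun n => extendZero v n ≠ 0),
      ∀ n ∈ (Finset.range N).filter (fun n => extendZero v n ≠ 0), n ≤ m := by
    obtain ⟨n, hn1, hn2⟩ := hn
    exact Finset.exists_max_image _ id ⟨n, by simp [hn1, hn2]⟩
  rw [Finset.mem_filter] at hm
  have := h m
  rw [inner_chooseVec, Finset.sum_eq_single m] at this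
  · rw [Nat.choose_self, Nat.cast_one, mul_one] at this
    exact hm.2 this
  · intro n hn hne
    rcases lt_or_gt_of_ne hne with hlt | hgt
    · rw [Nat.choose_eq_zero_of_lt hlt]; simp
    · by_cases h0 : extendZero v n = 0
      · rw [h0, zero_mul]
      · have := hmax n (Finset.mem_filter.mpr ⟨hn, h0⟩); omega
  · exact fun h => absurd hm.1 h

/-- The eigenvalue is read off from the first binomial vector not orthogonal to the eigenvector. -/
lemma exists_eigenvalue_eq {N : ℕ} {χ : ℝ} {v : EuclideanSpace ℝ (Fin N)} (hv0 : v ≠ 0)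
    (hv : jacobiOp N 0 v = χ • v) : ∃ j : ℕ, χ = j * (j + 1) := by
  classical
  have hex := exists_inner_chooseVec_ne_zero hv0
  refine ⟨Nat.find hex, ?_⟩
  have hne := Nat.find_spec hex
  have hlt : ∀ i < Nat.find hex, ⟪v, chooseVec N i⟫_ℝ = 0 := fun i hi => by
    simpa using Nat.find_min hex hi
  generalize Nat.find hex = j at *
  have h := jacobiOp_isSymmetric N 0 v (chooseVec N j)
  rw [hv, jacobiOp_chooseVec, inner_smul_left, inner_sub_right, inner_smul_right,
    inner_smul_right] at h
  have h2 : (j : ℝ) * (N - j) * ⟪v, chooseVec N (j - 1)⟫_ℝ = 0 := by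
    rcases j with _ | j
    · simp
    · rw [Nat.add_sub_cancel, hlt j (by omega), mul_zero]
  rw [h2, sub_zero] at h
  exact mul_right_cancel₀ hne (by simpa using h)

lemma card_eigenvalues_zero_lt (N k : ℕ) :
    (Finset.univ.filter fun i : Fin N =>
      (jacobiOp_isSymmetric N 0).eigenvalues (by simp) i < (k : ℝ) * (k + 1)).card ≤ k := by
  have hT := jacobiOp_isSymmetric N 0
  have hn : Module.finrank ℝ (EuclideanSpace ℝ (Fin N)) = N := by simp
  set u := hT.eigenvectorBasis hn with hu
  have hTu : ∀ j, jacobiOp N 0 (u j) = hT.eigenvalues hn j • u j :=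
    fun j => hT.apply_eigenvectorBasis hn j
  have hex : ∀ i, ∃ j : ℕ, hT.eigenvalues hn i = j * (j + 1) := fun i =>
    exists_eigenvalue_eq (u.orthonormal.ne_zero i) (hTu i)
  choose j hj using hex
  have hinj : Function.Injective j := by
    intro a b hab
    by_contra hne
    refine jacobiOp_eigenvalue_ne (hTu a) (hTu b) (u.orthonormal.1 a) (u.orthonormal.1 b)
      (u.orthonormal.2 hne) ?_
    rw [hj a, hj b, hab]
  calc _ ≤ (Finset.range k).card := by
        refine Finset.card_le_card_of_injOn j ?_ hinj.injOn
        intro i hi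
        simp only [Finset.coe_filter, Finset.mem_univ, true_and, Set.mem_ofPred_eq] at hi
        rw [hj i] at hi
        simp only [Finset.coe_range, Set.mem_Iio]
        by_contra! hk
        have : (k : ℝ) ≤ j i := by exact_mod_cast hk
        have : (k : ℝ) * (k + 1) ≤ j i * (j i + 1) := by gcongr
        linarith
    _ = k := Finset.card_range k

/-- Monotonicity in `s` of the number of eigenvalues below a threshold, starting from the explicit
spectrum at `s = 0`: otherwise the span of low eigenvectors for `s` would meet the span of high
eigenvectors for `0`. -/
lemma card_eigenvalues_lt (N k : ℕ) {s : ℝ} (hs : 0 ≤ s) :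
    (Finset.univ.filter fun i : Fin N =>
      (jacobiOp_isSymmetric N s).eigenvalues (by simp) i < (k : ℝ) * (k + 1)).card ≤ k := by
  have hn : Module.finrank ℝ (EuclideanSpace ℝ (Fin N)) = N := by simp
  have h0 := jacobiOp_isSymmetric N 0
  have hT := jacobiOp_isSymmetric N s
  set u := h0.eigenvectorBasis hn with hu
  set ψ := hT.eigenvectorBasis hn with hψ
  set I := Finset.univ.filter fun i : Fin N => h0.eigenvalues hn i < (k : ℝ) * (k + 1) with hI
  set J := Finset.univ.filter fun i : Fin N => hT.eigenvalues hn i < (k : ℝ) * (k + 1) with hJ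
  have hIk : I.card ≤ k := card_eigenvalues_zero_lt N k
  change J.card ≤ k
  by_contra! hJk
  have hcompl : Iᶜ.card = N - I.card := by rw [Finset.card_compl, Fintype.card_fin]
  let bu : {i // i ∈ Iᶜ} → EuclideanSpace ℝ (Fin N) := fun i => u i
  let bψ : {i // i ∈ J} → EuclideanSpace ℝ (Fin N) := fun i => ψ i
  have hbu : LinearIndependent ℝ bu :=
    u.orthonormal.linearIndependent.comp _ Subtype.val_injective
  have hbψ : LinearIndependent ℝ bψ :=
    ψ.orthonormal.linearIndependent.comp _ Subtype.val_injective
  have hne : Submodule.span ℝ (Set.range bu) ⊓ Submodule.span ℝ (Set.range bψ) ≠ ⊥ := by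
    intro hbot
    have h1 := Submodule.finrank_sup_add_finrank_inf_eq (Submodule.span ℝ (Set.range bu))
      (Submodule.span ℝ (Set.range bψ))
    have h2 := Submodule.finrank_le
      (Submodule.span ℝ (Set.range bu) ⊔ Submodule.span ℝ (Set.range bψ))
    rw [hbot, finrank_bot, finrank_span_eq_card hbu, finrank_span_eq_card hbψ,
      Fintype.card_coe, Fintype.card_coe] at h1
    have h3 : I.card ≤ N := by simpa using Finset.card_le_univ I
    omega
  obtain ⟨x, hx, hx0⟩ := Submodule.exists_mem_ne_zero_of_ne_bot hne
  have hlow : (k : ℝ) * (k + 1) * ‖x‖ ^ 2 ≤ RCLike.re ⟪jacobiOp N 0 x, x⟫_ℝ :=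
    h0.mul_norm_sq_le_re_inner_of_mem_span (ν := fun i : {i // i ∈ Iᶜ} => h0.eigenvalues hn i)
      (fun i => h0.apply_eigenvectorBasis hn i)
      (fun i => by have := i.2; simp only [hI, Finset.mem_compl, Finset.mem_filter,
        Finset.mem_univ, true_and, not_lt] at this; exact this) hx.1
  have hJne : Nonempty {i // i ∈ J} := by
    obtain ⟨i, hi⟩ := Finset.card_pos.mp (lt_of_le_of_lt (Nat.zero_le k) hJk)
    exact ⟨⟨i, hi⟩⟩
  obtain ⟨i₀, hi₀⟩ := Finite.exists_max fun i : {i // i ∈ J} => hT.eigenvalues hn i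
  have hi₀lt : hT.eigenvalues hn i₀ < (k : ℝ) * (k + 1) := by
    have := i₀.2
    simp only [hJ, Finset.mem_filter, Finset.mem_univ, true_and] at this
    exact this
  have hTn : (-jacobiOp N s).IsSymmetric := by
    intro v w
    simp only [LinearMap.neg_apply, inner_neg_left, inner_neg_right, hT v w]
  have hup : -hT.eigenvalues hn i₀ * ‖x‖ ^ 2 ≤ RCLike.re ⟪(-jacobiOp N s) x, x⟫_ℝ :=
    hTn.mul_norm_sq_le_re_inner_of_mem_span (ν := fun i : {i // i ∈ J} => -hT.eigenvalues hn i)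
      (b := bψ) (fun i => by
        rw [LinearMap.neg_apply, hT.apply_eigenvectorBasis hn i]; simp [bψ, hψ])
      (fun i => neg_le_neg (hi₀ i)) hx.2
  have hmid := inner_jacobiOp_zero_le hs x
  rw [LinearMap.neg_apply, inner_neg_left] at hup
  simp only [RCLike.re_to_real] at hlow hup
  have h3 : 0 < ‖x‖ ^ 2 := by have := norm_pos_iff.mpr hx0; positivity
  nlinarith

/-! ### Eigenvectors as pairs of real solutions -/

/-- The real trigonometric sum `∑ Vₙ cos (xₙ θ + α)` at the centred frequencies
`xₙ = n - (N - 1) / 2`; the phases `0` and `-π / 2` give the cosine and the sine sum. -/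
noncomputable def phaseSum (N : ℕ) (V : ℕ → ℝ) (α θ : ℝ) : ℝ :=
  ∑ n ∈ Finset.range N, V n * Real.cos (((n : ℝ) - (N - 1) / 2) * θ + α)

/-- The derivative of `phaseSum`. -/
noncomputable def phaseSumDeriv (N : ℕ) (V : ℕ → ℝ) (α θ : ℝ) : ℝ :=
  ∑ n ∈ Finset.range N, -(V n * ((n : ℝ) - (N - 1) / 2)) *
    Real.sin (((n : ℝ) - (N - 1) / 2) * θ + α)

lemma continuous_phaseSum (N : ℕ) (V : ℕ → ℝ) (α : ℝ) : Continuous (phaseSum N V α) := by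
  unfold phaseSum; fun_prop

lemma phaseSum_neg_zero (N : ℕ) (V : ℕ → ℝ) (θ : ℝ) : phaseSum N V 0 (-θ) = phaseSum N V 0 θ := by
  refine Finset.sum_congr rfl fun n _ => ?_
  rw [← Real.cos_neg]; congr 2; ring

lemma phaseSum_neg_half_pi (N : ℕ) (V : ℕ → ℝ) (θ : ℝ) :
    phaseSum N V (-(Real.pi / 2)) (-θ) = -phaseSum N V (-(Real.pi / 2)) θ := by
  rw [phaseSum, phaseSum, ← Finset.sum_neg_distrib]
  refine Finset.sum_congr rfl fun n _ => ?_
  rw [← sub_eq_add_neg, ← sub_eq_add_neg, Real.cos_sub_pi_div_two, Real.cos_sub_pi_div_two,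
    mul_neg, Real.sin_neg, mul_neg]

lemma phaseSum_mul_deriv_zero (N : ℕ) (V : ℕ → ℝ) {α : ℝ} (hα : α = 0 ∨ α = -(Real.pi / 2)) :
    phaseSum N V α 0 * phaseSumDeriv N V α 0 = 0 := by
  rcases hα with rfl | rfl
  · simp [phaseSumDeriv]
  · simp [phaseSum]

/-- The vector `v` with real entries as a vector with complex entries. -/
noncomputable def complexify {N : ℕ} (v : EuclideanSpace ℝ (Fin N)) : EuclideanSpace ℂ (Fin N) :=
  WithLp.toLp 2 fun n => (v n : ℂ)

lemma inner_complexify {N : ℕ} (v w : EuclideanSpace ℝ (Fin N)) :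
    ⟪complexify v, complexify w⟫_ℂ = (⟪v, w⟫_ℝ : ℝ) := by
  simp [PiLp.inner_apply, complexify]

lemma trigSum_complexify {N : ℕ} (v : EuclideanSpace ℝ (Fin N)) (x : ℝ) :
    trigSum (complexify v) x = phaseSum N (extendZero v) 0 (2 * Real.pi * x) +
      phaseSum N (extendZero v) (-(Real.pi / 2)) (2 * Real.pi * x) * Complex.I := by
  rw [phaseSum, phaseSum, ← Fin.sum_univ_eq_sum_range (fun n => extendZero v n *
      Real.cos (((n : ℝ) - (N - 1) / 2) * (2 * Real.pi * x) + 0)),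
    ← Fin.sum_univ_eq_sum_range (fun n => extendZero v n *
      Real.cos (((n : ℝ) - (N - 1) / 2) * (2 * Real.pi * x) + -(Real.pi / 2))), trigSum]
  push_cast
  rw [Finset.sum_mul, ← Finset.sum_add_distrib]
  refine Finset.sum_congr rfl fun n _ => ?_
  rw [extendZero_coe, ← sub_eq_add_neg, Complex.cos_sub_pi_div_two, expMode, Complex.exp_mul_I,
    complexify, centeredFreq]
  push_cast
  rw [add_zero, show 2 * (Real.pi : ℂ) * ((n : ℂ) - (N - 1) / 2) * x =
    ((n : ℂ) - (N - 1) / 2) * (2 * Real.pi * x) by ring]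
  ring

lemma norm_sq_trigSum_complexify {N : ℕ} (v : EuclideanSpace ℝ (Fin N)) (x : ℝ) :
    ‖trigSum (complexify v) x‖ ^ 2 = phaseSum N (extendZero v) 0 (2 * Real.pi * x) ^ 2 +
      phaseSum N (extendZero v) (-(Real.pi / 2)) (2 * Real.pi * x) ^ 2 := by
  rw [trigSum_complexify, Complex.sq_norm, Complex.normSq_add_mul_I]

/-- Two solutions with different spectral parameters are orthogonal on `[-θ₀, θ₀]`: the equation is
in divergence form and its leading coefficient vanishes at both end points. -/
lemma SpheroidalSolution.integral_mul_eq_zero {θ₀ χ χ' : ℝ} {r g g' g'' h h' h'' : ℝ → ℝ}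
    (hχ : χ ≠ χ') (hg : SpheroidalSolution θ₀ (fun θ => (χ - r θ) / 2) g g' g'')
    (hh : SpheroidalSolution θ₀ (fun θ => (χ' - r θ) / 2) h h' h'') :
    ∫ θ in (-θ₀)..θ₀, g θ * h θ = 0 := by
  have hd : ∀ θ, HasDerivAt (fun θ => (Real.cos θ - Real.cos θ₀) * (g' θ * h θ - g θ * h' θ))
      (-((χ - χ') / 2) * (g θ * h θ)) θ := by
    intro θ
    refine (((Real.hasDerivAt_cos θ).sub_const _).mul
      (((hg.deriv₂ θ).mul (hh.deriv₁ θ)).sub ((hg.deriv₁ θ).mul (hh.deriv₂ θ)))).congr_deriv ?_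
    simp only [Pi.mul_apply, Pi.sub_apply]
    linear_combination h θ * hg.ode θ - g θ * hh.ode θ
  have hcg : Continuous g := continuous_iff_continuousAt.2 fun θ => (hg.deriv₁ θ).continuousAt
  have hch : Continuous h := continuous_iff_continuousAt.2 fun θ => (hh.deriv₁ θ).continuousAt
  have := intervalIntegral.integral_eq_sub_of_hasDerivAt (a := -θ₀) (b := θ₀) (fun θ _ => hd θ)
    ((continuous_const.mul (hcg.mul hch)).intervalIntegrable _ _)
  rw [intervalIntegral.integral_const_mul] at this
  simp only [Real.cos_neg, sub_self, zero_mul] at this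
  refine (mul_eq_zero.mp this).resolve_left ?_
  exact neg_ne_zero.mpr (div_ne_zero (sub_ne_zero.mpr hχ) two_ne_zero)

lemma integral_comp_two_pi_mul (f : ℝ → ℝ) (W : ℝ) :
    ∫ x in (-W)..W, f (2 * Real.pi * x) =
      (2 * Real.pi)⁻¹ * ∫ θ in (-(2 * Real.pi * W))..(2 * Real.pi * W), f θ := by
  rw [intervalIntegral.integral_comp_mul_left f (by positivity), smul_eq_mul, mul_neg]

lemma jacobiOp_inner_windowGram_eq_zero {N : ℕ} {W χ χ' : ℝ} {v w : EuclideanSpace ℝ (Fin N)}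
    (hv : jacobiOp N (2 * (1 - Real.cos (2 * Real.pi * W))) v = χ • v)
    (hw : jacobiOp N (2 * (1 - Real.cos (2 * Real.pi * W))) w = χ' • w) (hχ : χ ≠ χ') :
    ⟪complexify v, windowGram N W (complexify w)⟫_ℂ = 0 := by
  have key : ∀ α β, ∫ x in (-W)..W, phaseSum N (extendZero v) α (2 * Real.pi * x) *
      phaseSum N (extendZero w) β (2 * Real.pi * x) = 0 := by
    intro α β
    have := (spheroidalSolution_of_jacobiExpr (jacobiExpr_of_eigenvector hv) α).integral_mul_eq_zero
      hχ (spheroidalSolution_of_jacobiExpr (jacobiExpr_of_eigenvector hw) β)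
    rw [integral_comp_two_pi_mul (fun θ => phaseSum N (extendZero v) α θ *
      phaseSum N (extendZero w) β θ)]
    simp only [phaseSum]
    rw [this, mul_zero]
  have hc : ∀ α β, Continuous (fun x => phaseSum N (extendZero v) α (2 * Real.pi * x) *
      phaseSum N (extendZero w) β (2 * Real.pi * x)) := fun α β =>
    ((continuous_phaseSum N _ α).comp (by fun_prop)).mul
      ((continuous_phaseSum N _ β).comp (by fun_prop))
  have hi := fun α β => (hc α β).intervalIntegrable (μ := volume) (-W) W
  rw [inner_windowGram]
  set a := -(Real.pi / 2)
  have e : ∀ x, conj (trigSum (complexify v) x) * trigSum (complexify w) x =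
      ((phaseSum N (extendZero v) 0 (2 * Real.pi * x) * phaseSum N (extendZero w) 0 (2 * Real.pi * x)
        + phaseSum N (extendZero v) a (2 * Real.pi * x) *
          phaseSum N (extendZero w) a (2 * Real.pi * x) : ℝ) : ℂ) +
      ((phaseSum N (extendZero v) 0 (2 * Real.pi * x) * phaseSum N (extendZero w) a (2 * Real.pi * x)
        - phaseSum N (extendZero v) a (2 * Real.pi * x) *
          phaseSum N (extendZero w) 0 (2 * Real.pi * x) : ℝ) : ℂ) * Complex.I := by
    intro x
    rw [trigSum_complexify, trigSum_complexify]
    simp only [map_add, map_mul, Complex.conj_ofReal, Complex.conj_I]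
    push_cast
    linear_combination (-(phaseSum N (extendZero v) a (2 * Real.pi * x) : ℂ) *
          phaseSum N (extendZero w) a (2 * Real.pi * x)) * Complex.I_sq
  simp only [e]
  rw [intervalIntegral.integral_add, intervalIntegral.integral_mul_const,
    intervalIntegral.integral_ofReal, intervalIntegral.integral_ofReal,
    intervalIntegral.integral_add (hi 0 0) (hi a a), intervalIntegral.integral_sub (hi 0 a) (hi a 0)]
  · simp only [key]; simp
  · exact (Complex.continuous_ofReal.comp ((hc 0 0).add (hc a a))).intervalIntegrable _ _
  · exact ((Complex.continuous_ofReal.comp ((hc 0 a).sub (hc a 0))).mul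
      continuous_const).intervalIntegrable _ _

lemma sin_mul_sum_cos (N : ℕ) (θ : ℝ) :
    Real.sin θ * ∑ n ∈ Finset.range N, Real.cos (2 * (((n : ℝ) - (N - 1) / 2) * θ)) =
      Real.sin (N * θ) ∧
    Real.sin θ * ∑ n ∈ Finset.range N, Real.sin (2 * (((n : ℝ) - (N - 1) / 2) * θ)) = 0 := by
  have h := sin_mul_sum_exp N (θ / Real.pi)
  have hp := Real.pi_ne_zero
  simp only [centeredFreq] at h
  rw [Fin.sum_univ_eq_sum_range (fun n : ℕ => Complex.exp
    ((2 * Real.pi * ((n : ℝ) - (N - 1) / 2) * (θ / Real.pi) : ℝ) * Complex.I)) N,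
    mul_div_cancel₀ _ hp, mul_assoc, mul_div_cancel₀ _ hp] at h
  have e : ∀ n : ℕ, 2 * Real.pi * ((n : ℝ) - (N - 1) / 2) * (θ / Real.pi) =
      2 * (((n : ℝ) - (N - 1) / 2) * θ) := fun n => by field_simp
  simp only [e] at h
  have h1 := congrArg Complex.re h
  have h2 := congrArg Complex.im h
  rw [Complex.re_ofReal_mul, Complex.re_sum, Complex.ofReal_re] at h1
  rw [Complex.im_ofReal_mul, Complex.im_sum, Complex.ofReal_im] at h2
  simp only [Complex.exp_ofReal_mul_I_re] at h1
  simp only [Complex.exp_ofReal_mul_I_im] at h2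
  exact ⟨h1, h2⟩

/-- Bessel's inequality for the two orthogonal vectors `(cos xₙθ)` and `(sin xₙθ)`. -/
lemma phaseSum_sq_add_sq_le {N : ℕ} (v : EuclideanSpace ℝ (Fin N)) {θ δ : ℝ}
    (hθ : 0 < Real.sin θ) (hδ : 1 ≤ δ * Real.sin θ) :
    phaseSum N (extendZero v) 0 θ ^ 2 + phaseSum N (extendZero v) (-(Real.pi / 2)) θ ^ 2 ≤
      (N + δ) / 2 * ‖v‖ ^ 2 := by
  obtain ⟨hc, hs⟩ := sin_mul_sum_cos N θ
  set x : ℕ → ℝ := fun n => ((n : ℝ) - (N - 1) / 2) * θ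
  set V := extendZero v
  set D := ∑ n ∈ Finset.range N, Real.cos (2 * x n)
  have hs0 : ∑ n ∈ Finset.range N, Real.sin (2 * x n) = 0 := (mul_eq_zero.mp hs).resolve_left hθ.ne'
  have hD : |D| ≤ δ := by
    have : |Real.sin θ * D| ≤ 1 := by rw [hc]; exact Real.abs_sin_le_one _
    rw [abs_mul, abs_of_pos hθ] at this
    by_contra! hlt
    nlinarith
  set P := phaseSum N V 0 θ with hP
  set Q := phaseSum N V (-(Real.pi / 2)) θ with hQ
  have hP' : P = ∑ n ∈ Finset.range N, V n * Real.cos (x n) := by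
    rw [hP, phaseSum]; simp only [add_zero]; rfl
  have hQ' : Q = ∑ n ∈ Finset.range N, V n * Real.sin (x n) := by
    rw [hQ, phaseSum]; simp only [← sub_eq_add_neg, Real.cos_sub_pi_div_two]; rfl
  have hnorm : ‖v‖ ^ 2 = ∑ n ∈ Finset.range N, V n ^ 2 := by
    rw [← real_inner_self_eq_norm_sq, inner_eq_sum_extendZero]; simp only [pow_two]; rfl
  have h1 : P ^ 2 + Q ^ 2 = ∑ n ∈ Finset.range N, V n * (P * Real.cos (x n) + Q * Real.sin (x n)) := by
    simp only [mul_add, Finset.sum_add_distrib]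
    rw [pow_two, pow_two]
    nth_rewrite 2 [hP']; nth_rewrite 2 [hQ']
    rw [Finset.mul_sum, Finset.mul_sum]
    congr 1 <;> exact Finset.sum_congr rfl fun n _ => by ring
  have h2 : ∑ n ∈ Finset.range N, (P * Real.cos (x n) + Q * Real.sin (x n)) ^ 2 =
      P ^ 2 * ((N + D) / 2) + Q ^ 2 * ((N - D) / 2) := by
    have : ∀ n ∈ Finset.range N, (P * Real.cos (x n) + Q * Real.sin (x n)) ^ 2 =
        (P ^ 2 + Q ^ 2) / 2 + (P ^ 2 - Q ^ 2) / 2 * Real.cos (2 * x n) +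
          P * Q * Real.sin (2 * x n) := by
      intro n _
      rw [Real.sin_two_mul, Real.cos_two_mul]
      linear_combination Q ^ 2 * Real.sin_sq_add_cos_sq (x n)
    rw [Finset.sum_congr rfl this, Finset.sum_add_distrib, Finset.sum_add_distrib,
      ← Finset.mul_sum, ← Finset.mul_sum, hs0]
    simp only [Finset.sum_const, Finset.card_range, nsmul_eq_mul]
    ring
  have h3 := Finset.sum_mul_sq_le_sq_mul_sq (Finset.range N) V
    (fun n => P * Real.cos (x n) + Q * Real.sin (x n))
  rw [← h1, h2, ← hnorm] at h3
  obtain ⟨hD1, hD2⟩ := abs_le.mp hD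
  have h4 : P ^ 2 * ((N + D) / 2) + Q ^ 2 * ((N - D) / 2) ≤ (N + δ) / 2 * (P ^ 2 + Q ^ 2) := by
    nlinarith [sq_nonneg P, sq_nonneg Q]
  have hPQ : 0 ≤ P ^ 2 + Q ^ 2 := by positivity
  have hδ0 : 0 ≤ δ := (abs_nonneg D).trans hD
  rcases hPQ.eq_or_lt with h0 | h0
  · rw [← h0]; positivity
  · refine le_of_mul_le_mul_right ?_ h0
    calc (P ^ 2 + Q ^ 2) * (P ^ 2 + Q ^ 2) = (P ^ 2 + Q ^ 2) ^ 2 := by ring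
      _ ≤ ‖v‖ ^ 2 * ((N + δ) / 2 * (P ^ 2 + Q ^ 2)) := h3.trans (by gcongr)
      _ = _ := by ring

lemma integral_symm_of_even {f : ℝ → ℝ} (hf : Continuous f) (he : ∀ x, f (-x) = f x) (a : ℝ) :
    ∫ x in (-a)..a, f x = 2 * ∫ x in (0 : ℝ)..a, f x := by
  rw [← intervalIntegral.integral_add_adjacent_intervals (hf.intervalIntegrable (-a) 0)
    (hf.intervalIntegrable 0 a), ← neg_zero, ← intervalIntegral.integral_comp_neg]
  simp only [he, neg_zero]; ring

/-! ### From eigenvectors of the commuting operator to eigenvalues -/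

lemma re_inner_map_le_of_mem_span {E ι : Type*} [NormedAddCommGroup E] [InnerProductSpace ℂ E]
    [Fintype ι] (G : E →ₗ[ℂ] E) {φ : ι → E} {B : ℝ} (hφ : Orthonormal ℂ φ)
    (hG : ∀ i j, i ≠ j → ⟪φ i, G (φ j)⟫_ℂ = 0) (hB : ∀ i, (⟪φ i, G (φ i)⟫_ℂ).re ≤ B) {b : E}
    (hb : b ∈ Submodule.span ℂ (Set.range φ)) : (⟪b, G b⟫_ℂ).re ≤ B * ‖b‖ ^ 2 := by
  classical
  obtain ⟨c, rfl⟩ := (Submodule.mem_span_range_iff_exists_fun ℂ).mp hb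
  have h1 : ⟪∑ i, c i • φ i, G (∑ i, c i • φ i)⟫_ℂ =
      ∑ i, ((‖c i‖ ^ 2 : ℝ) : ℂ) * ⟪φ i, G (φ i)⟫_ℂ := by
    rw [sum_inner]
    refine Finset.sum_congr rfl fun i _ => ?_
    rw [inner_smul_left, map_sum, inner_sum, Finset.sum_eq_single i]
    · rw [map_smul, inner_smul_right, ← mul_assoc, Complex.conj_mul']
      push_cast; rfl
    · intro j _ hj
      rw [map_smul, inner_smul_right, hG i j hj.symm, mul_zero]
    · simp
  have h2 : ‖∑ i, c i • φ i‖ ^ 2 = ∑ i, ‖c i‖ ^ 2 := by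
    have := hφ.inner_sum c c Finset.univ
    rw [inner_self_eq_norm_sq_to_K] at this
    have h3 : ((‖∑ i, c i • φ i‖ ^ 2 : ℝ) : ℂ) = ((∑ i, ‖c i‖ ^ 2 : ℝ) : ℂ) := by
      push_cast
      refine this.trans (Finset.sum_congr rfl fun i _ => ?_)
      exact Complex.conj_mul' _
    exact_mod_cast h3
  rw [h1, h2, Complex.re_sum, Finset.mul_sum]
  refine Finset.sum_le_sum fun i _ => ?_
  rw [Complex.re_ofReal_mul, mul_comm]
  exact mul_le_mul_of_nonneg_right (hB i) (by positivity)

/-- The energy estimate for the cosine and the sine sum of an eigenvector together. -/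
lemma integral_norm_sq_trigSum_le {N : ℕ} {W χ t κ2 : ℝ} {v : EuclideanSpace ℝ (Fin N)}
    (hW : 0 < W) (hW1 : 2 * Real.pi * W ≤ Real.pi / 2) (hN : 1 ≤ N) (hκ : 0 < κ2) (hχ : κ2 ≤ χ)
    (ht : 0 < t) (ht1 : t ≤ 1)
    (hΛ : ((N : ℝ) ^ 2 - 1) * ((1 - Real.cos (2 * Real.pi * W)) / 2) ≤ (1 - t) * κ2)
    (hv : jacobiOp N (2 * (1 - Real.cos (2 * Real.pi * W))) v = χ • v) :
    (1 + min 1 (3 * t) - 6 / κ2) * ∫ x in (-W)..W, ‖trigSum (complexify v) x‖ ^ 2 ≤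
      2 * W * ‖trigSum (complexify v) W‖ ^ 2 := by
  have hΛ0 : (0 : ℝ) ≤ (N : ℝ) ^ 2 - 1 := by
    have : (1 : ℝ) ≤ N := by exact_mod_cast hN
    nlinarith
  have key : ∀ α, α = 0 ∨ α = -(Real.pi / 2) → (1 + min 1 (3 * t) - 6 / κ2) *
      ∫ θ in (0 : ℝ)..(2 * Real.pi * W), phaseSum N (extendZero v) α θ ^ 2 ≤
        2 * Real.pi * W * phaseSum N (extendZero v) α (2 * Real.pi * W) ^ 2 := fun α hα =>
    (spheroidalSolution_of_jacobiExpr (jacobiExpr_of_eigenvector hv) α).integral_sq_le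
      (by positivity) hW1 hκ hχ hΛ0 ht ht1 hΛ (phaseSum_mul_deriv_zero N _ hα)
  have hc : ∀ α, Continuous fun θ => phaseSum N (extendZero v) α θ ^ 2 :=
    fun α => (continuous_phaseSum N _ α).pow 2
  have k1 := key 0 (Or.inl rfl)
  have k2 := key _ (Or.inr rfl)
  simp only [norm_sq_trigSum_complexify]
  rw [integral_comp_two_pi_mul (fun θ => phaseSum N (extendZero v) 0 θ ^ 2 +
      phaseSum N (extendZero v) (-(Real.pi / 2)) θ ^ 2),
    integral_symm_of_even (f := fun θ => phaseSum N (extendZero v) 0 θ ^ 2 +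
      phaseSum N (extendZero v) (-(Real.pi / 2)) θ ^ 2) ((hc _).add (hc _)) (fun x => by
      rw [phaseSum_neg_zero, phaseSum_neg_half_pi, neg_sq]),
    intervalIntegral.integral_add ((hc _).intervalIntegrable _ _) ((hc _).intervalIntegrable _ _)]
  have hp := Real.pi_pos
  generalize ∫ θ in (0 : ℝ)..(2 * Real.pi * W), phaseSum N (extendZero v) 0 θ ^ 2 = I1 at *
  generalize ∫ θ in (0 : ℝ)..(2 * Real.pi * W),
    phaseSum N (extendZero v) (-(Real.pi / 2)) θ ^ 2 = I2 at *
  have e : (1 + min 1 (3 * t) - 6 / κ2) * ((2 * Real.pi)⁻¹ * (2 * (I1 + I2))) =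
      ((1 + min 1 (3 * t) - 6 / κ2) * I1 + (1 + min 1 (3 * t) - 6 / κ2) * I2) / Real.pi := by
    field_simp
  rw [e, div_le_iff₀ hp]
  linarith

/-- The growth estimate for an eigenvector. Here `z₁` is the value of `(1 - cos θ) / 2` at the turning
point `θ₁`, and `δ` bounds the reciprocal of `sin θ₁`. -/
lemma norm_sq_trigSum_mul_exp_le {N : ℕ} {W χ κ M v E b z₁ δ : ℝ} {u : EuclideanSpace ℝ (Fin N)}
    (hW : 0 < W) (hW1 : 2 * Real.pi * W ≤ Real.pi) (hκ : 0 < κ) (hχ : κ ^ 2 ≤ χ)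
    (hM1 : 1 < M) (hM : (M + 1) * ((1 - Real.cos (2 * Real.pi * W)) / 2) = 2 * z₁)
    (hv : v = M - 1) (hE : E = 4 * (M + 1) / κ)
    (hb : b = κ * M / (2 * √(v ^ 2 + E ^ 2 + E * v / 4)))
    (hz : z₁ < 1) (hΛ : ((N : ℝ) ^ 2 - 1) * z₁ ≤ κ ^ 2)
    (hδ : 0 ≤ δ) (hδ1 : 1 ≤ δ ^ 2 * (4 * (z₁ * (1 - z₁))))
    (hu : jacobiOp N (2 * (1 - Real.cos (2 * Real.pi * W))) u = χ • u) :
    ‖trigSum (complexify u) W‖ ^ 2 * Real.exp (2 * b * (Real.log M - 1 + 1 / M)) ≤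
      (N + δ) / 2 * ‖u‖ ^ 2 := by
  set θ₀ := 2 * Real.pi * W with hθ₀
  have h0 : 0 < θ₀ := by positivity
  have hcos : Real.cos θ₀ < 1 := by
    rw [← Real.cos_zero]
    exact Real.cos_lt_cos_of_nonneg_of_le_pi le_rfl hW1 h0
  have hcos1 := Real.neg_one_le_cos θ₀
  set z₀ := (1 - Real.cos θ₀) / 2 with hz₀
  have hz00 : 0 < z₀ := by linarith
  have hz01 : z₀ < z₁ := by nlinarith
  obtain ⟨θ₁, hθ₁⟩ : ∃ θ₁, θ₁ = Real.arccos (1 - 2 * z₁) := ⟨_, rfl⟩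
  have hcosθ₁ : Real.cos θ₁ = 1 - 2 * z₁ := by
    rw [hθ₁, Real.cos_arccos (by linarith) (by linarith)]
  have h1 : θ₁ ≤ Real.pi := hθ₁ ▸ Real.arccos_le_pi _
  have h10 : 0 ≤ θ₁ := hθ₁ ▸ Real.arccos_nonneg _
  have h01 : θ₀ < θ₁ := by
    by_contra! h
    have := Real.cos_le_cos_of_nonneg_of_le_pi h10 hW1 h
    rw [hcosθ₁] at this
    linarith
  have hθ1pi : θ₁ < Real.pi := by
    refine lt_of_le_of_ne h1 fun h => ?_
    rw [h, Real.cos_pi] at hcosθ₁; linarith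
  have hsin : 0 < Real.sin θ₁ := Real.sin_pos_of_pos_of_lt_pi (h0.trans h01) hθ1pi
  have hδs : 1 ≤ δ * Real.sin θ₁ := by
    have hs2 : Real.sin θ₁ ^ 2 = 4 * (z₁ * (1 - z₁)) := by
      rw [Real.sin_sq, hcosθ₁]; ring
    rw [← hs2, ← mul_pow] at hδ1
    exact (one_le_sq_iff₀ (by positivity)).mp hδ1
  have hb0 : 0 ≤ b := by rw [hb]; positivity
  have hMz : M + 1 = 2 * z₁ / z₀ := by rw [eq_div_iff hz00.ne']; exact hM
  have hz1 : 0 < z₁ := hz00.trans hz01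
  have hMθ : 2 * (1 - Real.cos θ₁) / (1 - Real.cos θ₀) - 1 = M := by
    rw [hcosθ₁, show 1 - Real.cos θ₀ = 2 * z₀ by rw [hz₀]; ring]
    have : 2 * (1 - (1 - 2 * z₁)) / (2 * z₀) = 2 * z₁ / z₀ := by field_simp; ring
    rw [this, ← hMz]; ring
  have grow : ∀ α, phaseSum N (extendZero u) α θ₀ ^ 2 *
      Real.exp (2 * b * (Real.log M - 1 + 1 / M)) ≤ phaseSum N (extendZero u) α θ₁ ^ 2 := by
    intro α
    refine SpheroidalSolution.growth (C := κ ^ 2 / (2 * (M + 1))) h0 h01 h1 hM1 hb0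
      (by have : 0 < M + 1 := by linarith
          positivity) hMθ
      (fun m hm hmM => riccati_feasible hκ hm hmM hM1 hv hE hb rfl) ?_
      (spheroidalSolution_of_jacobiExpr (jacobiExpr_of_eigenvector hu) α)
    intro θ
    set z := (1 - Real.cos θ) / 2 with hz'
    have hzn : 0 ≤ z := by have := Real.cos_le_one θ; rw [hz']; linarith
    have e : κ ^ 2 / (2 * (M + 1)) * (M - (2 * (1 - Real.cos θ) / (1 - Real.cos θ₀) - 1)) =
        (κ ^ 2 - κ ^ 2 * (z / z₁)) / 2 := by
      rw [show 1 - Real.cos θ₀ = 2 * z₀ by rw [hz₀]; ring,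
        show 1 - Real.cos θ = 2 * z by rw [hz']; ring,
        show M - (2 * (2 * z) / (2 * z₀) - 1) = (M + 1) - 2 * z / z₀ by field_simp; ring, hMz]
      field_simp
    rw [e]
    have h5 : ((N : ℝ) ^ 2 - 1) * z ≤ κ ^ 2 * (z / z₁) := by
      calc ((N : ℝ) ^ 2 - 1) * z = ((N : ℝ) ^ 2 - 1) * z₁ * (z / z₁) := by field_simp
        _ ≤ κ ^ 2 * (z / z₁) := by gcongr
    linarith
  have := phaseSum_sq_add_sq_le u hsin hδs
  rw [norm_sq_trigSum_complexify, add_mul]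
  exact (add_le_add (grow _) (grow _)).trans this

lemma orthonormal_complexify {N : ℕ} {ι : Type*} {ψ : ι → EuclideanSpace ℝ (Fin N)}
    (hψ : Orthonormal ℝ ψ) : Orthonormal ℂ fun i => complexify (ψ i) := by
  classical
  rw [orthonormal_iff_ite] at hψ ⊢
  intro i j
  rw [inner_complexify, hψ i j]
  split_ifs <;> simp

/-- A quadratic-form bound on the individual eigenvectors of the commuting operator with eigenvalue
at least `k (k + 1)` bounds the `k`-th eigenvalue, since these eigenvectors are orthogonal for both
forms and at most `k` eigenvectors are left out. -/
lemma dpswfEigenvalue_le_of_eigenvector {N k : ℕ} {W B : ℝ} (hW : 0 < W) (hW2 : W ≤ 1 / 2)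
    (hB : 0 ≤ B)
    (h : ∀ (χ : ℝ) (v : EuclideanSpace ℝ (Fin N)), (k : ℝ) * (k + 1) ≤ χ → ‖v‖ = 1 →
      jacobiOp N (2 * (1 - Real.cos (2 * Real.pi * W))) v = χ • v →
      ∫ x in (-W)..W, ‖trigSum (complexify v) x‖ ^ 2 ≤ B) :
    dpswfEigenvalue N W k ≤ B := by
  classical
  set s := 2 * (1 - Real.cos (2 * Real.pi * W)) with hs
  have hs0 : 0 ≤ s := by have := Real.cos_le_one (2 * Real.pi * W); rw [hs]; linarith
  have hsym := jacobiOp_isSymmetric N s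
  set χ := hsym.eigenvalues (n := N) (by simp)
  set ψ := hsym.eigenvectorBasis (n := N) (by simp)
  have hψ : ∀ i, jacobiOp N s (ψ i) = χ i • ψ i := fun i => hsym.apply_eigenvectorBasis _ i
  have hψn : ∀ i, ‖ψ i‖ = 1 := ψ.orthonormal.1
  let S := {i : Fin N // (k : ℝ) * (k + 1) ≤ χ i}
  have hcard : N ≤ Fintype.card S + k := by
    have h1 : (Finset.univ.filter fun i => χ i < (k : ℝ) * (k + 1)).card ≤ k :=
      card_eigenvalues_lt N k hs0
    have h2 := Finset.card_filter_add_card_filter_not (s := (Finset.univ : Finset (Fin N)))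
      (fun i => (k : ℝ) * (k + 1) ≤ χ i)
    simp only [not_le, Finset.card_univ, Fintype.card_fin] at h2
    rw [Fintype.card_subtype]
    omega
  have hφ : Orthonormal ℂ fun i : S => complexify (ψ i) :=
    (orthonormal_complexify ψ.orthonormal).comp _ Subtype.val_injective
  refine dpswfEigenvalue_le hW hW2 (Submodule.span ℂ (Set.range fun i : S => complexify (ψ i)))
    ?_ hB ?_
  · rw [finrank_span_eq_card hφ.linearIndependent]; exact hcard
  · intro b hb
    have hre : ∀ b : EuclideanSpace ℂ (Fin N),
        (⟪b, windowGram N W b⟫_ℂ).re = ∫ x in (-W)..W, ‖trigSum b x‖ ^ 2 := by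
      intro b
      rw [← re_inner_windowGram_self]
      exact inner_re_symm (𝕜 := ℂ) _ _
    rw [← hre]
    refine re_inner_map_le_of_mem_span (windowGram N W) hφ ?_ ?_ hb
    · intro i j hij
      refine jacobiOp_inner_windowGram_eq_zero (hψ i) (hψ j) ?_
      exact jacobiOp_eigenvalue_ne (hψ i) (hψ j) (hψn i) (hψn j)
        (ψ.orthonormal.2 fun h => hij (Subtype.ext h))
    · intro i
      rw [hre]
      exact h _ _ i.2 (hψn i) (hψ i)

/-! ### The two decay estimates -/
lemma mul_sq_le_sin_sq {x : ℝ} (h0 : 0 ≤ x) (h1 : x ≤ 0.7358) : 0.827 * x ^ 2 ≤ Real.sin x ^ 2 := by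
  have h2 := Real.sin_ge_sub_cube h0
  have h3 : x ^ 2 ≤ 0.7358 ^ 2 := by gcongr
  have h4 : x * x ^ 2 ≤ x * 0.7358 ^ 2 := by gcongr
  have h5 : 0.9097 * x ≤ Real.sin x := by
    rw [show x ^ 3 = x * x ^ 2 by ring] at h2
    linarith
  have h6 := pow_le_pow_left₀ (by positivity) h5 2
  rw [mul_pow] at h6
  have := sq_nonneg x
  linarith

/-- The energy and growth estimates combined. The factor `1.21` is `1 + δ / N` with `δ = 0.21 N` in the
bound at the turning point; `k ≥ 7`, which follows from `N W ≥ 2.1`, is what makes this `δ` admissible. -/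
theorem dpswfEigenvalue_le_ode {N k : ℕ} {W κ M v E c1 : ℝ} (hW : 0 < W)
    (hW2 : W < 2 / (Real.exp 1 * Real.pi)) (hkN : k < N) (ha : 2.1 ≤ N * W)
    (hka : Real.exp 1 * Real.pi * (N * W) ≤ 2 * (k + N * W)) (hκ : κ = √(k * (k + 1)))
    (hM : M = 2 * κ ^ 2 / (Real.pi * (N * W)) ^ 2 - 1) (hv : v = M - 1) (hE : E = 4 * (M + 1) / κ)
    (hc1 : c1 = 1 + min 1 (3 * (1 - (Real.pi * (N * W)) ^ 2 / κ ^ 2)) - 6 / κ ^ 2) (hc10 : 0 < c1) :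
    dpswfEigenvalue N W k ≤ 1.21 * (N * W) /
      (c1 * Real.exp (κ * M / √(v ^ 2 + E ^ 2 + E * v / 4) * (Real.log M - 1 + 1 / M))) := by
  have hp := Real.pi_pos
  have hp1 := Real.pi_gt_d4
  have hp2 := Real.pi_lt_d4
  have he := Real.exp_one_gt_d9
  set a := (N : ℝ) * W with ha'
  have ha0 : 0 < a := by linarith
  have hep : 8.53948 ≤ Real.exp 1 * Real.pi := by nlinarith
  have hak : 6.53948 * a ≤ 2 * k := by nlinarith
  have hk7 : (7 : ℝ) ≤ k := by
    have : (6 : ℝ) < k := by linarith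
    exact_mod_cast this
  have hk0 : (0 : ℝ) < k := by linarith
  have hkN' : (k : ℝ) + 1 ≤ N := by exact_mod_cast hkN
  have hN0 : (0 : ℝ) < N := by linarith
  have hκ2 : κ ^ 2 = k * (k + 1) := by rw [hκ]; exact Real.sq_sqrt (by positivity)
  have hκ0 : 0 < κ := by rw [hκ]; exact Real.sqrt_pos.mpr (by positivity)
  have hc : Real.pi * a ≤ 0.961 * k := by nlinarith
  have hcκ : (Real.pi * a) ^ 2 < κ ^ 2 := by
    have : (Real.pi * a) ^ 2 ≤ (0.961 * k) ^ 2 := by gcongr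
    rw [hκ2]; nlinarith
  have hc0 : 0 < (Real.pi * a) ^ 2 := by positivity
  have hpW : Real.pi * W ≤ 0.7358 := by
    rw [lt_div_iff₀ (by positivity)] at hW2
    nlinarith
  have hW1 : W ≤ 1 / 2 := by
    have := mul_le_mul_of_nonneg_right hp1.le hW.le
    linarith
  have hpW0 : 0 < Real.pi * W := by positivity
  -- `z₀` and `z₁` are `(1 - cos θ) / 2` at the window edge and at the turning point
  obtain ⟨z₀, hz₀⟩ : ∃ z₀, z₀ = Real.sin (Real.pi * W) ^ 2 := ⟨_, rfl⟩
  have hz₀' : (1 - Real.cos (2 * Real.pi * W)) / 2 = z₀ := by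
    rw [hz₀, Real.sin_sq_eq_half_sub, ← mul_assoc]; ring
  obtain ⟨r, hr⟩ : ∃ r, r = z₀ / (Real.pi * W) ^ 2 := ⟨_, rfl⟩
  have hzr : z₀ = r * (Real.pi * W) ^ 2 := by rw [hr]; field_simp
  have hr1 : r ≤ 1 := by
    rw [hr, div_le_one (by positivity), hz₀]
    exact pow_le_pow_left₀ (Real.sin_nonneg_of_nonneg_of_le_pi hpW0.le (by linarith))
      (Real.sin_le hpW0.le) 2
  have hr0 : 0.827 ≤ r := by
    rw [hr, le_div_iff₀ (by positivity), hz₀]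
    exact mul_sq_le_sin_sq hpW0.le hpW
  have hN1 : κ ^ 2 * (k + 1) ≤ k * (N : ℝ) ^ 2 := by
    rw [hκ2]
    calc (k : ℝ) * (k + 1) * (k + 1) = k * (k + 1) ^ 2 := by ring
      _ ≤ k * (N : ℝ) ^ 2 := by gcongr
  obtain ⟨z₁, hz₁⟩ : ∃ z₁, z₁ = κ ^ 2 * r / (N : ℝ) ^ 2 := ⟨_, rfl⟩
  have hz₁N : z₁ * (N : ℝ) ^ 2 = κ ^ 2 * r := by rw [hz₁]; field_simp
  have hz₁k : z₁ * (k + 1) ≤ k := by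
    have h1 : z₁ * (k + 1) * (N : ℝ) ^ 2 ≤ k * (N : ℝ) ^ 2 := by
      calc z₁ * (k + 1) * (N : ℝ) ^ 2 = κ ^ 2 * (k + 1) * r := by linear_combination (k + 1) * hz₁N
        _ ≤ κ ^ 2 * (k + 1) * 1 := by gcongr
        _ ≤ _ := by linarith
    exact le_of_mul_le_mul_right h1 (by positivity)
  have hz₁0 : 0 < z₁ := by rw [hz₁]; positivity
  have hz₁1 : z₁ < 1 := by
    by_contra! h
    have := mul_le_mul_of_nonneg_right h (by positivity : (0 : ℝ) ≤ k + 1)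
    linarith
  have hM1 : 1 < M := by
    have : 1 < κ ^ 2 / (Real.pi * a) ^ 2 := (one_lt_div hc0).mpr hcκ
    rw [hM, mul_div_assoc]; linarith
  have hMz : (M + 1) * ((1 - Real.cos (2 * Real.pi * W)) / 2) = 2 * z₁ := by
    rw [hz₀', hM, hzr, hz₁, ha']; field_simp; ring
  have hNW : (N : ℝ) ^ 2 * (Real.pi * W) ^ 2 = (Real.pi * a) ^ 2 := by rw [ha']; ring
  have hδ1 : 1 ≤ (0.21 * (N : ℝ)) ^ 2 * (4 * (z₁ * (1 - z₁))) := by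
    have h1 : 1 / ((k : ℝ) + 1) ≤ 1 - z₁ := by
      rw [div_le_iff₀ (by positivity)]; linarith
    calc (1 : ℝ) ≤ 0.1764 * (7 * 0.827) := by norm_num
      _ ≤ 0.1764 * (k * r) := by gcongr
      _ = 0.1764 * (κ ^ 2 * r * (1 / (k + 1))) := by rw [hκ2]; field_simp
      _ ≤ 0.1764 * (κ ^ 2 * r * (1 - z₁)) := by gcongr
      _ = _ := by rw [← hz₁N]; ring
  obtain ⟨b, hb⟩ : ∃ b, b = κ * M / (2 * √(v ^ 2 + E ^ 2 + E * v / 4)) := ⟨_, rfl⟩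
  have hb2 : κ * M / √(v ^ 2 + E ^ 2 + E * v / 4) = 2 * b := by rw [hb]; ring
  rw [hb2]
  refine dpswfEigenvalue_le_of_eigenvector hW hW1 (by positivity) fun χ u hχ hu hχu => ?_
  rw [← hκ2] at hχ
  have inside := integral_norm_sq_trigSum_le (t := 1 - (Real.pi * a) ^ 2 / κ ^ 2) (κ2 := κ ^ 2) hW
    (by linarith) (by exact_mod_cast (by omega : 1 ≤ N)) (by positivity) hχ
    (by rw [sub_pos, div_lt_one (by positivity)]; exact hcκ)
    (by have : 0 ≤ (Real.pi * a) ^ 2 / κ ^ 2 := by positivity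
        linarith)
    (by
      have e : (1 - (1 - (Real.pi * a) ^ 2 / κ ^ 2)) * κ ^ 2 = (Real.pi * a) ^ 2 := by field_simp; ring
      rw [e, hz₀', hzr, ← hNW]
      have h1 : 0 < (Real.pi * W) ^ 2 := by positivity
      have h2 : 0 ≤ (1 - r) * ((N : ℝ) ^ 2 * (Real.pi * W) ^ 2) := by
        have := sub_nonneg.mpr hr1
        positivity
      have h3 : 0 < r * (Real.pi * W) ^ 2 := by positivity
      linarith) hχu
  rw [← hc1] at inside
  have outside := norm_sq_trigSum_mul_exp_le (δ := 0.21 * N) hW (by linarith) hκ0 hχ hM1 hMz hv hE hb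
    hz₁1 (by
      have h1 : 0 ≤ κ ^ 2 * (1 - r) := mul_nonneg (sq_nonneg _) (sub_nonneg.mpr hr1)
      linarith) (by positivity) hδ1 hχu
  rw [hu] at outside
  rw [le_div_iff₀ (by positivity)]
  have hH := Real.exp_pos (2 * b * (Real.log M - 1 + 1 / M))
  generalize Real.exp (2 * b * (Real.log M - 1 + 1 / M)) = H at *
  calc (∫ x in (-W)..W, ‖trigSum (complexify u) x‖ ^ 2) * (c1 * H)
      = c1 * (∫ x in (-W)..W, ‖trigSum (complexify u) x‖ ^ 2) * H := by ring
    _ ≤ 2 * W * ‖trigSum (complexify u) W‖ ^ 2 * H := by gcongr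
    _ = 2 * W * (‖trigSum (complexify u) W‖ ^ 2 * H) := by ring
    _ ≤ 2 * W * ((N + 0.21 * N) / 2 * 1 ^ 2) := by gcongr
    _ = 1.21 * a := by rw [ha']; ring

/-- The two ranges of `N W` meet at `2.1`. -/
theorem dpswfEigenvalue_le_inv_pow {N k : ℕ} {W : ℝ} (hk : 1 ≤ k) (hkN : k < N) (hW : 0 < W)
    (hW2 : W < 2 / (Real.exp 1 * Real.pi))
    (hka : Real.exp 1 * Real.pi * (N * W) ≤ 2 * (k + N * W)) :
    dpswfEigenvalue N W k ≤ 2 / (2 * (k + N * W) / (Real.exp 1 * Real.pi * (N * W))) ^ (2 * k) := by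
  have hp := Real.pi_pos
  have hW12 : W ≤ 1 / 2 := by
    rw [lt_div_iff₀ (by positivity)] at hW2
    nlinarith [exp_mul_pi_bounds.1]
  have hN0 : (0 : ℝ) < N := by exact_mod_cast (by omega : 0 < N)
  rcases le_total ((N : ℝ) * W) 2.1 with h | h
  · exact dpswfEigenvalue_le_inv_pow_of_small hk (by omega) hW hW12 h hka
  obtain ⟨hc10, hfin⟩ := growth_beats_target h hka rfl rfl rfl rfl rfl
  refine (dpswfEigenvalue_le_ode hW hW2 hkN h hka rfl rfl rfl rfl rfl hc10).trans ?_
  have hk0 : (0 : ℝ) < k := by exact_mod_cast hk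
  rw [div_le_div_iff₀ (mul_pos hc10 (Real.exp_pos _)) (by positivity)]
  linarith

theorem slepianDecay_two {N₁ : ℕ} {W ε : ℝ} (hN₁ : 3 ≤ N₁) (hW : 0 < W)
    (hW2 : W ≤ 2 / (Real.exp 1 * Real.pi) * (((N₁ : ℝ) - 1) / N₁))
    (hε : (Real.exp 1 * Real.pi - 6) / 4 < ε) :
    SlepianDecay W ε 2
      (4 * W * (1 + ε) * Real.log ((4 * (1 + ε) + 2) / (Real.exp 1 * Real.pi))) N₁ := by
  intro N k hN hk hkN
  have hp := Real.pi_pos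
  have hep := exp_mul_pi_bounds
  have hN0 : (0 : ℝ) < N := by exact_mod_cast (by omega : 0 < N)
  have hε0 : 0 < 1 + ε := by linarith
  have hkx : 2 * (N : ℝ) * W * (1 + ε) ≤ k := by
    have := Int.ceil_le.mp hk
    exact_mod_cast this
  have hk0 : (0 : ℝ) < k := lt_of_lt_of_le (by positivity) hkx
  have hW3 : W < 2 / (Real.exp 1 * Real.pi) := by
    refine hW2.trans_lt ?_
    have hN₁0 : (0 : ℝ) < N₁ := by exact_mod_cast (by omega : 0 < N₁)
    have : ((N₁ : ℝ) - 1) / N₁ < 1 := by rw [div_lt_one hN₁0]; linarith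
    have h2 : 0 < 2 / (Real.exp 1 * Real.pi) := by positivity
    nlinarith
  have hY1 : 1 < (4 * (1 + ε) + 2) / (Real.exp 1 * Real.pi) := by
    rw [one_lt_div (by positivity)]; linarith
  have hXY : (4 * (1 + ε) + 2) / (Real.exp 1 * Real.pi) ≤
      2 * (k + N * W) / (Real.exp 1 * Real.pi * (N * W)) := by
    rw [div_le_div_iff₀ (by positivity) (by positivity)]
    have := mul_le_mul_of_nonneg_left hkx (show 0 ≤ Real.exp 1 * Real.pi by positivity)
    linarith
  have hX1 : 1 ≤ 2 * (k + N * W) / (Real.exp 1 * Real.pi * (N * W)) := hY1.le.trans hXY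
  have hX0 : 0 < 2 * (k + N * W) / (Real.exp 1 * Real.pi * (N * W)) := by linarith
  have hka : Real.exp 1 * Real.pi * (N * W) ≤ 2 * (k + N * W) :=
    (one_le_div (by positivity)).mp hX1
  refine (dpswfEigenvalue_le_inv_pow (by exact_mod_cast hk0) hkN hW hW3 hka).trans ?_
  have hpow : (2 * (k + N * W) / (Real.exp 1 * Real.pi * (N * W))) ^ (2 * k) =
      Real.exp (2 * k * Real.log (2 * (k + N * W) / (Real.exp 1 * Real.pi * (N * W)))) := by
    conv_lhs => rw [← Real.exp_log hX0, ← Real.exp_nat_mul]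
    push_cast; rfl
  rw [hpow, div_eq_mul_inv, ← Real.exp_neg]
  gcongr
  have hlog := Real.log_le_log (by linarith) hXY
  have hlogY := Real.log_nonneg hY1.le
  have := mul_le_mul (mul_le_mul_of_nonneg_left hkx zero_le_two) hlog hlogY (by positivity)
  linarith

theorem mainTheorem4 :
    (∀ (N : ℕ) (W : ℝ), 3 ≤ N → 0 < W →
      W < 2 / (Real.exp 1 * Real.pi) * (((N : ℝ) - 1) / N) →
      ∀ k : ℕ, 2 ≤ Real.exp 1 * Real.pi / 2 * (N * W) →
        Real.exp 1 * Real.pi / 2 * (N * W) ≤ k → k < N →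
        dpswfEigenvalue N W k ≤
          2 * Real.exp (-(2 * (k : ℝ) + 1) *
            Real.log (2 * ((k : ℝ) + 1) / (Real.exp 1 * Real.pi * N * W)))) ∧
    (∀ (N₁ : ℕ) (W ε : ℝ), 3 ≤ N₁ → 0 < W →
      W ≤ 2 / (Real.exp 1 * Real.pi) * (((N₁ : ℝ) - 1) / N₁) →
      (Real.exp 1 * Real.pi - 6) / 4 < ε →
      SlepianDecay W ε 2
        (4 * W * (1 + ε) * Real.log ((4 * (1 + ε) + 2) / (Real.exp 1 * Real.pi))) N₁) := by
  refine ⟨fun N W hN hW hW2 k h2 hk hkN => ?_, fun N₁ W ε hN₁ hW hW2 hε =>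
    slepianDecay_two hN₁ hW hW2 hε⟩
  have hp := Real.pi_pos
  have hN0 : (0 : ℝ) < N := by exact_mod_cast (by omega : 0 < N)
  have hk1 : 1 ≤ k := by
    have : (0 : ℝ) < k := by linarith
    exact_mod_cast this
  have hW12 : W ≤ 1 / 2 := by
    have h1 : ((N : ℝ) - 1) / N ≤ 1 := by rw [div_le_one hN0]; linarith
    have h2 : 2 / (Real.exp 1 * Real.pi) ≤ 1 / 2 := by
      rw [div_le_iff₀ (by positivity)]; linarith [exp_mul_pi_bounds.1]
    have h3 : 0 ≤ 2 / (Real.exp 1 * Real.pi) := by positivity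
    nlinarith
  exact dpswfEigenvalue_le_exp_neg_log hk1 (by omega) hW hW12
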